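/- Let $k$ be an algebraically closed field of characteristic $0$, let $(Y,\Lambda_0)$ be a nonsingular Poisson variety over $k$, with bracket $\{-,-\}$ on $\mathcal O_Y$, and let $X\hookrightarrow (Y,\Lambda_0)$ be a regular closed embedding of Poisson schemes, so that $X$ is defined by a sheaf $\mathcal I$ of Poisson ideals which near each point of $X$ is generated by a regular sequence. For a local Artinian $k$-algebra $A$ with residue field $k$, an *infinitesimal deformation of $X$ in $(Y,\Lambda_0)$ over $A$* is a closed subscheme $\mathcal X\subset Y\times\operatorname{Spec}A$, flat over $A$, with fibre $X\subset Y$ over the closed point, whose ideal sheaf is Poisson for the $A$-bilinear extension of the bracket; let $H_X^{(Y,\Lambda_0)}(A)$ be the set of these. Let $\mathcal N_{X/Y}=\mathcal Hom_{\mathcal O_X}(\mathcal I/\mathcal I^2,\mathcal O_X)$, and let $\mathcal N^\bullet_{X/Y}$ be the complex $$\mathcal N_{X/Y}\xrightarrow{\nabla}\mathcal N_{X/Y}\otimes T_Y|_X\xrightarrow{\nabla}\mathcal N_{X/Y}\otimes \wedge^2T_Y|_X\xrightarrow{\nabla}\cdots$$ where a section of $\mathcal N_{X/Y}\otimes\wedge^pT_Y|_X$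 is regarded as an $\mathcal O_Y$-linear map $\psi$ from $\mathcal I$ to skew-symmetric $p$-derivations of $\mathcal O_Y$ with values in $\mathcal O_X$, and $$(\nabla\psi)(f;a_0,\dots,a_p)=\sum_i(-1)^i\bigl(\{a_i,\psi(f;\dots\hat a_i\dots)\}-\psi(\{a_i,f\};\dots\hat a_i\dots)\bigr)+\sum_{i<j}(-1)^{i+j}\psi(f;\{a_i,a_j\},\dots\hat a_i\dots\hat a_j\dots).$$ Write $\mathbb H^i(X,\mathcal N^\bullet_{X/Y})$ for its hypercohomology. 1. There is a natural bijection $H_X^{(Y,\Lambda_0)}(k[\epsilon])\cong\mathbb H^0(X,\mathcal N^\bullet_{X/Y})$: to a first-order deformation with ideal sheaf $\mathcal J$ corresponds the section $\varphi$ of $\mathcal N_{X/Y}$ with $\nabla\varphi=0$ such that $\varphi(f)=\bar g$ whenever $f$ and $g$ are local sections of $\mathcal I$ and $\mathcal O_Y$ with $f+\epsilon g\in\mathcal J$. 2. Let $e:0\to(t)\to\tilde A\to A\to0$ be a small extension of local Artinian $k$-algebras with residue field $k$ ($t\neq 0$ is annihilated by the maximal ideal of $\tilde A$), and let $\eta\in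 H_X^{(Y,\Lambda_0)}(A)$. There is a class $o_\eta(e)\in\mathbb H^1(X,\mathcal N^\bullet_{X/Y})$ which is zero if and only if $\eta$ lifts to an element of $H_X^{(Y,\Lambda_0)}(\tilde A)$. It is obtained as follows. There exist affine opens $U_x$ of $Y$ covering $X$ and, over each of them, an $\tilde A$-flat closed subscheme of $U_x\times\operatorname{Spec}\tilde A$, with ideal $\tilde{\mathcal J}_x$, that restricts to $\eta$ over $A$. For every such choice there is exactly one Čech $1$-cocycle $(-G,h)$ of $\mathcal N^\bullet_{X/Y}$, with $G_x\in\Gamma(U_x\cap X,\mathcal N_{X/Y}\otimes T_Y|_X)$ and $h_{xy}\in\Gamma(U_x\cap U_y\cap X,\mathcal N_{X/Y})$, such that, whenever $F\in\tilde{\mathcal J}_x$ reduces to $f\in\mathcal I$: $\{F,a\}=K+tc$ with $K\in\tilde{\mathcal J}_x$ implies $G_x(f)(a)=\bar c$, and $F=F'+tc$ with $F'\in\tilde{\mathcal J}_y$ implies $h_{xy}(f)=\bar c$. Its class is $o_\eta(e)$, for every choice. -/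

import Mathlib

open AlgebraicGeometry CategoryTheory CategoryTheory.Limits TopologicalSpace TensorProduct

universe u

noncomputable section

/-! ### Nonsingular varieties, Poisson structures, Poisson closed subschemes -/

/-- A nonsingular variety over a field `k`: an integral separated scheme of finite type over `k`
which is smooth over `k` (over an algebraically closed field, smooth = nonsingular). -/
structure NonsingularVariety (k : Type u) [Field k] where
  /-- the underlying scheme -/
  scheme : Scheme.{u}
  /-- the structure morphism -/
  str : scheme ⟶ Spec (CommRingCat.of k)
  [isIntegral : IsIntegral scheme]
  [isSeparated : IsSeparated str]
  [locallyOfFiniteType : LocallyOfFiniteType str]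
  [quasiCompact : QuasiCompact str]
  [smooth : Smooth str]

namespace NonsingularVariety

attribute [instance] isIntegral isSeparated locallyOfFiniteType quasiCompact smooth

variable {k : Type u} [Field k] (Y : NonsingularVariety k)

/-- The sections of the structure sheaf form a `k`-algebra through the structure morphism. -/
instance sectionsAlgebra (U : Y.scheme.Opens) : Algebra k Γ(Y.scheme, U) :=
  ((Scheme.ΓSpecIso (CommRingCat.of k)).inv ≫ Y.str.appTop ≫
    Y.scheme.presheaf.map (homOfLE le_top).op).hom.toAlgebra

/-- The restriction map of the structure sheaf, as a homomorphism of `k`-algebras. -/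
def res {U V : Y.scheme.Opens} (h : V ≤ U) : Γ(Y.scheme, U) →ₐ[k] Γ(Y.scheme, V) where
  toRingHom := (Y.scheme.presheaf.map (homOfLE h).op).hom
  commutes' r := by
    have h : Y.scheme.presheaf.map (homOfLE (le_top : U ≤ ⊤)).op ≫
        Y.scheme.presheaf.map (homOfLE h).op = Y.scheme.presheaf.map (homOfLE le_top).op := by
      rw [← Functor.map_comp, ← op_comp, homOfLE_comp]
    exact congrArg (fun g => ((Scheme.ΓSpecIso (CommRingCat.of k)).inv ≫
      Y.str.appTop ≫ g).hom r) h

end NonsingularVariety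

/-- A Poisson structure on `Y`: the structure sheaf is a sheaf of Poisson `k`-algebras. -/
structure PoissonStructure {k : Type u} [Field k] (Y : NonsingularVariety k) where
  /-- the bracket `{a, b}` of sections over `U` -/
  bracket (U : Y.scheme.Opens) : Γ(Y.scheme, U) →ₗ[k] Γ(Y.scheme, U) →ₗ[k] Γ(Y.scheme, U)
  bracket_self (U : Y.scheme.Opens) (a : Γ(Y.scheme, U)) : bracket U a a = 0
  leibniz (U : Y.scheme.Opens) (a b c : Γ(Y.scheme, U)) :
    bracket U a (b * c) = b * bracket U a c + c * bracket U a b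
  jacobi (U : Y.scheme.Opens) (a b c : Γ(Y.scheme, U)) :
    bracket U a (bracket U b c) = bracket U (bracket U a b) c + bracket U b (bracket U a c)
  bracket_res {U V : Y.scheme.Opens} (h : V ≤ U) (a b : Γ(Y.scheme, U)) :
    Y.res h (bracket U a b) = bracket V (Y.res h a) (Y.res h b)

/-- A Poisson closed subscheme of `(Y, Λ₀)`: a closed subscheme defined by a sheaf of Poisson
ideals. -/
structure PoissonSubscheme {k : Type u} [Field k] {Y : NonsingularVariety k}
    (P : PoissonStructure Y) where
  /-- the ideal sheaf of the closed subscheme -/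
  ideal : Y.scheme.IdealSheafData
  bracket_mem (U : Y.scheme.affineOpens) (a f : Γ(Y.scheme, U.1)) (hf : f ∈ ideal.ideal U) :
    P.bracket U.1 a f ∈ ideal.ideal U

namespace PoissonSubscheme

variable {k : Type u} [Field k] {Y : NonsingularVariety k} {P : PoissonStructure Y}
  (X : PoissonSubscheme P)

/-- `X ↪ Y` is a regular embedding: near each point of `X` the ideal of `X` is generated by a
regular sequence. -/
def IsRegularEmbedding : Prop :=
  ∀ x ∈ X.ideal.support, ∃ U : Y.scheme.affineOpens, x ∈ U.1 ∧
    ∃ fs : List Γ(Y.scheme, U.1),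
      RingTheory.Sequence.IsRegular Γ(Y.scheme, U.1) fs ∧ X.ideal.ideal U = Ideal.ofList fs

/-! ### The complex `N ⟶ N ⊗ T_Y|_X ⟶ N ⊗ ⋀² T_Y|_X ⟶ ⋯` of the normal sheaf

Over an affine open `V` of `Y`, with `I = I(V)`, the sections of `N ⊗ ⋀ᵖ T_Y|_X`, where
`N = Hom(I/I², O_X)`, are the `Γ(V)`-linear maps from `I` to `Γ(V, ⋀ᵖ T_Y|_X)`, and `⋀ᵖ T_Y|_X` is
the module of skew-symmetric `p`-derivations of `Γ(V)` with values in `Γ(V)/I`. -/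

/-- The functions on `X ∩ V`, for an affine open `V` of `Y`. -/
abbrev Fun (V : Y.scheme.affineOpens) : Type u := Γ(Y.scheme, V.1) ⧸ X.ideal.ideal V

/-- The operator `{a, -}` on the functions on `X ∩ V`. -/
def ham (V : Y.scheme.affineOpens) (a : Γ(Y.scheme, V.1)) : X.Fun V →ₗ[k] X.Fun V :=
  (Submodule.Quotient.restrictScalarsEquiv k (X.ideal.ideal V)).toLinearMap ∘ₗ
    Submodule.mapQ ((X.ideal.ideal V).restrictScalars k) ((X.ideal.ideal V).restrictScalars k)
      (P.bracket V.1 a) (fun f hf => X.bracket_mem V a f hf) ∘ₗ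
    (Submodule.Quotient.restrictScalarsEquiv k (X.ideal.ideal V)).symm.toLinearMap

@[simp]
theorem ham_mk (V : Y.scheme.affineOpens) (a b : Γ(Y.scheme, V.1)) :
    X.ham V a (Ideal.Quotient.mk _ b) = Ideal.Quotient.mk _ (P.bracket V.1 a b) := rfl

/-- The element `{a, f}` of the Poisson ideal. -/
def hamIdeal (V : Y.scheme.affineOpens) (a : Γ(Y.scheme, V.1)) (f : X.ideal.ideal V) :
    X.ideal.ideal V :=
  ⟨P.bracket V.1 a f, X.bracket_mem V a f f.2⟩

/-- Restriction of functions on `X` between affine opens. -/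
def resFun {V W : Y.scheme.affineOpens} (h : W ≤ V) : X.Fun V →+* X.Fun W :=
  Ideal.quotientMap _ (Y.scheme.presheaf.map (homOfLE h).op).hom (X.ideal.ideal_le_comap_ideal h)

/-- Restriction of sections of the ideal sheaf between affine opens. -/
def resIdeal {V W : Y.scheme.affineOpens} (h : W ≤ V) (f : X.ideal.ideal V) : X.ideal.ideal W :=
  ⟨Y.res h f, X.ideal.ideal_le_comap_ideal h f.2⟩

/-- The affine opens of `Y` contained in `U`. -/
abbrev AffineIn (_X : PoissonSubscheme P) (U : Y.scheme.Opens) : Type u :=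
  {V : Y.scheme.affineOpens // V.1 ≤ U}

/-- Families of functions, one for each affine open contained in `U`. The sections of
`N ⊗ ⋀ᵖ T_Y|_X` over `U ∩ X` are the families `IsSection` below. -/
abbrev Cochain (p : ℕ) (U : Y.scheme.Opens) : Type u :=
  ∀ V : X.AffineIn U, X.ideal.ideal V.1 → (Fin p → Γ(Y.scheme, V.1.1)) → X.Fun V.1

/-- A family `ψ` is a section over `U ∩ X` of the sheaf `N ⊗ ⋀ᵖ T_Y|_X`: over each affine open it is
linear on the ideal with values in the skew-symmetric `p`-derivations, and it is compatible with
restriction. -/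
structure IsSection (p : ℕ) (U : Y.scheme.Opens) (ψ : X.Cochain p U) : Prop where
  map_add (V : X.AffineIn U) (f g : X.ideal.ideal V.1) (a : Fin p → Γ(Y.scheme, V.1.1)) :
    ψ V (f + g) a = ψ V f a + ψ V g a
  map_smul (V : X.AffineIn U) (b : Γ(Y.scheme, V.1.1)) (f : X.ideal.ideal V.1)
    (a : Fin p → Γ(Y.scheme, V.1.1)) : ψ V (b • f) a = b • ψ V f a
  update_add (V : X.AffineIn U) (f : X.ideal.ideal V.1) (a : Fin p → Γ(Y.scheme, V.1.1))
    (i : Fin p) (b c : Γ(Y.scheme, V.1.1)) :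
    ψ V f (Function.update a i (b + c)) =
      ψ V f (Function.update a i b) + ψ V f (Function.update a i c)
  update_smul (V : X.AffineIn U) (f : X.ideal.ideal V.1) (a : Fin p → Γ(Y.scheme, V.1.1))
    (i : Fin p) (r : k) (b : Γ(Y.scheme, V.1.1)) :
    ψ V f (Function.update a i (r • b)) = r • ψ V f (Function.update a i b)
  leibniz (V : X.AffineIn U) (f : X.ideal.ideal V.1) (a : Fin p → Γ(Y.scheme, V.1.1))
    (i : Fin p) (b c : Γ(Y.scheme, V.1.1)) :
    ψ V f (Function.update a i (b * c)) =
      b • ψ V f (Function.update a i c) + c • ψ V f (Function.update a i b)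
  alternating (V : X.AffineIn U) (f : X.ideal.ideal V.1) (a : Fin p → Γ(Y.scheme, V.1.1))
    (i j : Fin p) (hij : i ≠ j) (h : a i = a j) : ψ V f a = 0
  compatible (V W : X.AffineIn U) (h : W.1 ≤ V.1) (f : X.ideal.ideal V.1)
    (a : Fin p → Γ(Y.scheme, V.1.1)) :
    X.resFun h (ψ V f a) = ψ W (X.resIdeal h f) (fun i => Y.res h (a i))

theorem resFun_smul {V W : Y.scheme.affineOpens} (h : W ≤ V) (r : k) (c : X.Fun V) :
    X.resFun h (r • c) = r • X.resFun h c := by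
  obtain ⟨c, rfl⟩ := Ideal.Quotient.mk_surjective c
  exact congrArg (Ideal.Quotient.mk (X.ideal.ideal W)) (_root_.map_smul (Y.res h) r c)

/-- The `k`-module of sections of `N ⊗ ⋀ᵖ T_Y|_X` over `U ∩ X`. -/
def sections (p : ℕ) (U : Y.scheme.Opens) : Submodule k (X.Cochain p U) where
  carrier := {ψ | X.IsSection p U ψ}
  zero_mem' := by constructor <;> simp
  add_mem' {ψ χ} hψ hχ := by
    constructor
    · intro V f g a; simp only [Pi.add_apply, hψ.map_add, hχ.map_add]; abel
    · intro V b f a; simp only [Pi.add_apply, hψ.map_smul, hχ.map_smul, smul_add]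
    · intro V f a i b c; simp only [Pi.add_apply, hψ.update_add, hχ.update_add]; abel
    · intro V f a i r b; simp only [Pi.add_apply, hψ.update_smul, hχ.update_smul, smul_add]
    · intro V f a i b c
      simp only [Pi.add_apply, hψ.leibniz, hχ.leibniz, smul_add]; abel
    · intro V f a i j hij h
      simp only [Pi.add_apply, hψ.alternating V f a i j hij h, hχ.alternating V f a i j hij h,
        add_zero]
    · intro V W h f a
      simp only [Pi.add_apply, _root_.map_add, hψ.compatible V W h f a, hχ.compatible V W h f a]
  smul_mem' r ψ hψ := by
    constructor
    · intro V f g a; simp only [Pi.smul_apply, hψ.map_add, smul_add]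
    · intro V b f a; simp only [Pi.smul_apply, hψ.map_smul, smul_comm r b]
    · intro V f a i b c; simp only [Pi.smul_apply, hψ.update_add, smul_add]
    · intro V f a i s b; simp only [Pi.smul_apply, hψ.update_smul, smul_comm r s]
    · intro V f a i b c
      simp only [Pi.smul_apply, hψ.leibniz, smul_add, smul_comm r b, smul_comm r c]
    · intro V f a i j hij h
      simp only [Pi.smul_apply, hψ.alternating V f a i j hij h, smul_zero]
    · intro V W h f a
      simp only [Pi.smul_apply, resFun_smul, hψ.compatible V W h f a]

/-- The differential `∇`. In terms of local generators `f^α` of the ideal, `[Λ₀, f^α] = {f^α, -}`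
`= ∑_β f^β T_α^β` and `g^α = ψ(f^α)`, the terms with `{aᵢ, ψ(f; …)}` and `ψ(f; …, {aᵢ, aⱼ}, …)`
make up `-[g^α, Λ₀]` (Schouten bracket), and the terms with `ψ({aᵢ, f}; …)` make up
`(-1)^p ∑_β g^β ∧ T_α^β`, both evaluated on `(a₀, …, a_p)`. -/
def nabla (p : ℕ) (U : Y.scheme.Opens) : X.Cochain p U →ₗ[k] X.Cochain (p + 1) U where
  toFun ψ V f a := ∑ i : Fin (p + 1), (-1 : ℤ) ^ (i : ℕ) •
    (X.ham V.1 (a i) (ψ V f (i.removeNth a)) - ψ V (X.hamIdeal V.1 (a i) f) (i.removeNth a)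
      - ∑ j : Fin p with i < i.succAbove j,
          ψ V f (Function.update (i.removeNth a) j (P.bracket V.1.1 (a i) (a (i.succAbove j)))))
  map_add' ψ χ := by
    funext V f a
    simp only [Pi.add_apply, map_add, Finset.sum_add_distrib]
    rw [← Finset.sum_add_distrib]
    refine Finset.sum_congr rfl fun i _ => ?_
    rw [← smul_add]
    congr 1
    abel
  map_smul' r ψ := by
    funext V f a
    simp only [Pi.smul_apply, map_smul, RingHom.id_apply]
    rw [Finset.smul_sum]
    refine Finset.sum_congr rfl fun i _ => ?_
    rw [← Finset.smul_sum, ← smul_sub, ← smul_sub, smul_comm]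

/-- Restriction of families to a smaller open. -/
def restrict (p : ℕ) {U W : Y.scheme.Opens} (h : W ≤ U) : X.Cochain p U →ₗ[k] X.Cochain p W where
  toFun ψ V := ψ ⟨V.1, V.2.trans h⟩
  map_add' _ _ := rfl
  map_smul' _ _ := rfl

theorem restrict_mem (p : ℕ) {U W : Y.scheme.Opens} (h : W ≤ U) {ψ : X.Cochain p U}
    (hψ : ψ ∈ X.sections p U) : X.restrict p h ψ ∈ X.sections p W where
  map_add V := hψ.map_add ⟨V.1, V.2.trans h⟩
  map_smul V := hψ.map_smul ⟨V.1, V.2.trans h⟩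
  update_add V := hψ.update_add ⟨V.1, V.2.trans h⟩
  update_smul V := hψ.update_smul ⟨V.1, V.2.trans h⟩
  leibniz V := hψ.leibniz ⟨V.1, V.2.trans h⟩
  alternating V := hψ.alternating ⟨V.1, V.2.trans h⟩
  compatible V V' := hψ.compatible ⟨V.1, V.2.trans h⟩ ⟨V'.1, V'.2.trans h⟩

theorem nabla_zero_apply (U : Y.scheme.Opens) (ψ : X.Cochain 0 U) (V : X.AffineIn U)
    (f : X.ideal.ideal V.1) (a : Fin 1 → Γ(Y.scheme, V.1.1)) :
    X.nabla 0 U ψ V f a =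
      X.ham V.1 (a 0) (ψ V f ![]) - ψ V (X.hamIdeal V.1 (a 0) f) ![] := by
  have h : ∀ b : Fin 0 → Γ(Y.scheme, V.1.1), b = ![] := fun b => Subsingleton.elim _ _
  simp [nabla, h]

theorem nabla_one_apply (U : Y.scheme.Opens) (ψ : X.Cochain 1 U) (V : X.AffineIn U)
    (f : X.ideal.ideal V.1) (a b : Γ(Y.scheme, V.1.1)) :
    X.nabla 1 U ψ V f ![a, b] =
      (X.ham V.1 a (ψ V f ![b]) - ψ V (X.hamIdeal V.1 a f) ![b])
        - (X.ham V.1 b (ψ V f ![a]) - ψ V (X.hamIdeal V.1 b f) ![a])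
        - ψ V f ![P.bracket V.1.1 a b] := by
  have h0 : (0 : Fin 2).removeNth ![a, b] = ![b] := by ext i; fin_cases i; rfl
  have h1 : (1 : Fin 2).removeNth ![a, b] = ![a] := by ext i; fin_cases i; rfl
  have h2 : ∀ c d : Γ(Y.scheme, V.1.1), Function.update ![c] 0 d = ![d] := by
    intro c d; ext i; fin_cases i; rfl
  have e0 : (Finset.univ.filter fun j : Fin 1 => (0 : Fin 2) < (0 : Fin 2).succAbove j) = {0} := by
    decide
  have e1 : (Finset.univ.filter fun j : Fin 1 => (1 : Fin 2) < (1 : Fin 2).succAbove j) = ∅ := by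
    decide
  refine (Fin.sum_univ_two (M := X.Fun V.1) _).trans ?_
  rw [h0, h1]
  erw [e0, e1]
  rw [Finset.sum_singleton, Finset.sum_empty, h2]
  simp only [Fin.val_zero, pow_zero, one_smul, Fin.val_one, pow_one, neg_smul, sub_zero]
  change (X.ham V.1 a (ψ V f ![b]) - ψ V (X.hamIdeal V.1 a f) ![b])
    - ψ V f ![P.bracket V.1.1 a b]
    + -(X.ham V.1 b (ψ V f ![a]) - ψ V (X.hamIdeal V.1 b f) ![a]) = _
  abel

theorem ham_add (V : Y.scheme.affineOpens) (a b : Γ(Y.scheme, V.1)) (c : X.Fun V) :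
    X.ham V (a + b) c = X.ham V a c + X.ham V b c := by
  obtain ⟨c, rfl⟩ := Ideal.Quotient.mk_surjective c
  simp

theorem hamIdeal_add (V : Y.scheme.affineOpens) (a b : Γ(Y.scheme, V.1)) (f : X.ideal.ideal V) :
    X.hamIdeal V (a + b) f = X.hamIdeal V a f + X.hamIdeal V b f :=
  Subtype.ext (by simp [hamIdeal])

theorem bracket_skew (P : PoissonStructure Y) (U : Y.scheme.Opens) (a b : Γ(Y.scheme, U)) :
    P.bracket U a b = - P.bracket U b a := by
  have h := P.bracket_self U (a + b)
  simp only [map_add, LinearMap.add_apply, P.bracket_self, zero_add, add_zero] at h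
  exact eq_neg_of_add_eq_zero_right h

theorem bracket_mul_left (P : PoissonStructure Y) (U : Y.scheme.Opens) (a b c : Γ(Y.scheme, U)) :
    P.bracket U (a * b) c = a * P.bracket U b c + b * P.bracket U a c := by
  rw [bracket_skew, P.leibniz, bracket_skew P U c b, bracket_skew P U c a]
  ring

theorem smul_mk (V : Y.scheme.affineOpens) (b c : Γ(Y.scheme, V.1)) :
    b • (Ideal.Quotient.mk (X.ideal.ideal V) c) = Ideal.Quotient.mk _ (b * c) := rfl

/-- `∇` maps the sections of `N` to sections of `N ⊗ T_Y|_X`. -/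
theorem nabla_zero_mem {U : Y.scheme.Opens} {ψ : X.Cochain 0 U} (hψ : ψ ∈ X.sections 0 U) :
    X.nabla 0 U ψ ∈ X.sections 1 U where
  map_add V f g a := by
    have h : X.hamIdeal V.1 (a 0) (f + g) = X.hamIdeal V.1 (a 0) f + X.hamIdeal V.1 (a 0) g :=
      Subtype.ext (by simp [hamIdeal])
    simp only [nabla_zero_apply, hψ.map_add, h, map_add]
    abel
  map_smul V b f a := by
    have h : X.hamIdeal V.1 (a 0) (b • f) =
        b • X.hamIdeal V.1 (a 0) f + P.bracket V.1.1 (a 0) b • f :=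
      Subtype.ext (by simp [hamIdeal, P.leibniz, mul_comm])
    simp only [nabla_zero_apply, hψ.map_add, hψ.map_smul, h]
    obtain ⟨c, hc⟩ := Ideal.Quotient.mk_surjective (ψ V f ![])
    rw [← hc, smul_mk, ham_mk, P.leibniz, ham_mk, smul_mk, smul_sub, smul_mk, map_add,
      mul_comm c]
    abel
  update_add V f a i b c := by
    obtain rfl := Subsingleton.elim i 0
    simp only [nabla_zero_apply, Function.update_self, ham_add, hamIdeal_add, hψ.map_add]
    abel
  update_smul V f a i r b := by
    obtain rfl := Subsingleton.elim i 0
    have h : X.hamIdeal V.1 (r • b) f = algebraMap k Γ(Y.scheme, V.1.1) r • X.hamIdeal V.1 b f :=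
      Subtype.ext (by simp [hamIdeal, algebraMap_smul])
    obtain ⟨c, hc⟩ := Ideal.Quotient.mk_surjective (ψ V f ![])
    rw [nabla_zero_apply, nabla_zero_apply, Function.update_self, Function.update_self, h,
      hψ.map_smul, algebraMap_smul, smul_sub, ← hc, ham_mk, ham_mk, map_smul,
      LinearMap.smul_apply]
    rfl
  leibniz V f a i b c := by
    obtain rfl := Subsingleton.elim i 0
    have h : X.hamIdeal V.1 (b * c) f = b • X.hamIdeal V.1 c f + c • X.hamIdeal V.1 b f :=
      Subtype.ext (by simp [hamIdeal, bracket_mul_left])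
    obtain ⟨d, hd⟩ := Ideal.Quotient.mk_surjective (ψ V f ![])
    simp only [nabla_zero_apply, Function.update_self, h, hψ.map_smul, hψ.map_add, smul_sub,
      ← hd, ham_mk, bracket_mul_left, map_add, smul_mk]
    abel
  alternating V f a i j hij := absurd (Subsingleton.elim i j) hij
  compatible V W h f a := by
    obtain ⟨d, hd⟩ := Ideal.Quotient.mk_surjective (ψ V f ![])
    have h1 := hψ.compatible V W h f ![]
    have h2 := hψ.compatible V W h (X.hamIdeal V.1 (a 0) f) ![]
    have e : (fun i => Y.res h ((![] : Fin 0 → Γ(Y.scheme, V.1.1)) i)) = ![] :=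
      Subsingleton.elim _ _
    have h3 : X.resIdeal h (X.hamIdeal V.1 (a 0) f) =
        X.hamIdeal W.1 (Y.res h (a 0)) (X.resIdeal h f) :=
      Subtype.ext (P.bracket_res h _ _)
    rw [e] at h1 h2
    rw [nabla_zero_apply, nabla_zero_apply, _root_.map_sub, h2, h3, ← h1, ← hd]
    congr 1
    exact congrArg (Ideal.Quotient.mk (X.ideal.ideal W.1)) (P.bracket_res h (a 0) d)

theorem nabla_nabla_zero {U : Y.scheme.Opens} {ψ : X.Cochain 0 U} (hψ : ψ ∈ X.sections 0 U) :
    X.nabla 1 U (X.nabla 0 U ψ) = 0 := by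
  funext V f a
  have ha : a = ![a 0, a 1] := by ext i; fin_cases i <;> rfl
  rw [ha, X.nabla_one_apply]
  simp only [nabla_zero_apply, Matrix.cons_val_zero]
  have h : X.hamIdeal V.1 (P.bracket V.1.1 (a 0) (a 1)) f =
      X.hamIdeal V.1 (a 0) (X.hamIdeal V.1 (a 1) f) - X.hamIdeal V.1 (a 1) (X.hamIdeal V.1 (a 0) f) :=
    Subtype.ext (by simp [hamIdeal, P.jacobi V.1.1 (a 0) (a 1) f])
  have hs : ∀ f g : X.ideal.ideal V.1, ψ V (f - g) ![] = ψ V f ![] - ψ V g ![] := fun f g => by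
    rw [eq_sub_iff_add_eq, ← hψ.map_add, sub_add_cancel]
  obtain ⟨c, hc⟩ := Ideal.Quotient.mk_surjective (ψ V f ![])
  rw [h, hs, map_sub, map_sub, ← hc]
  simp only [ham_mk]
  rw [P.jacobi V.1.1 (a 0) (a 1) c, map_add]
  simp only [Pi.zero_apply]
  abel

/-- The differential `∇ : N ⟶ N ⊗ T_Y|_X` on sections over `U ∩ X`. -/
def nablaZero (U : Y.scheme.Opens) : X.sections 0 U →ₗ[k] X.sections 1 U :=
  (X.nabla 0 U).restrict fun _ hψ => X.nabla_zero_mem hψ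

/-- Restriction of sections to a smaller open. -/
def resSection (p : ℕ) {U W : Y.scheme.Opens} (h : W ≤ U) :
    X.sections p U →ₗ[k] X.sections p W :=
  (X.restrict p h).restrict fun _ hψ => X.restrict_mem p h hψ

/-! ### Hypercohomology in degrees `0` and `1` -/

/-- `ℍ⁰(X, N^•)`: the kernel of `∇` on the global sections of `N`. -/
def H0 : Submodule k (X.Cochain 0 ⊤) := X.sections 0 ⊤ ⊓ LinearMap.ker (X.nabla 0 ⊤)

/-- Open coverings of `X` by the traces of open subsets of `Y`, indexed by the points of `X`. Every
open covering of `X` is refined by one of these. -/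
structure Covering where
  /-- the open subset of `Y` attached to a point of `X` -/
  opens : X.ideal.support → Y.scheme.Opens
  mem (x : X.ideal.support) : x.1 ∈ opens x

/-- `𝒱 ≤ 𝒰` means that `𝒱` refines `𝒰`. -/
instance : Preorder X.Covering := Preorder.lift Covering.opens

variable {X}

/-- Čech cochains of total degree `1` of the complex `N^•`: `C⁰(𝒰, N ⊗ T_Y|_X) ⊕ C¹(𝒰, N)`. -/
def C1 (𝒰 : X.Covering) : Type u :=
  (∀ x, X.sections 1 (𝒰.opens x)) × (∀ x y, X.sections 0 (𝒰.opens x ⊓ 𝒰.opens y))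

instance (𝒰 : X.Covering) : AddCommGroup (C1 𝒰) :=
  inferInstanceAs (AddCommGroup
    ((∀ x, X.sections 1 (𝒰.opens x)) × (∀ x y, X.sections 0 (𝒰.opens x ⊓ 𝒰.opens y))))

instance (𝒰 : X.Covering) : Module k (C1 𝒰) :=
  inferInstanceAs (Module k
    ((∀ x, X.sections 1 (𝒰.opens x)) × (∀ x y, X.sections 0 (𝒰.opens x ⊓ 𝒰.opens y))))

/-- The component `G_x` of a cochain `(G, h)`. -/
def compG (𝒰 : X.Covering) (x : X.ideal.support) : C1 𝒰 →ₗ[k] X.Cochain 1 (𝒰.opens x) where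
  toFun z := (z.1 x).1
  map_add' _ _ := rfl
  map_smul' _ _ := rfl

/-- The component `h_{xy}` of a cochain `(G, h)`. -/
def compH (𝒰 : X.Covering) (x y : X.ideal.support) :
    C1 𝒰 →ₗ[k] X.Cochain 0 (𝒰.opens x ⊓ 𝒰.opens y) where
  toFun z := (z.2 x y).1
  map_add' _ _ := rfl
  map_smul' _ _ := rfl

/-- The component `∇ G` in `C⁰(𝒰, N ⊗ ⋀² T_Y|_X)` of the differential of `(G, h)`. -/
def dNabla (𝒰 : X.Covering) (x : X.ideal.support) : C1 𝒰 →ₗ[k] X.Cochain 2 (𝒰.opens x) :=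
  X.nabla 1 _ ∘ₗ compG 𝒰 x

/-- The component `δ G + ∇ h` in `C¹(𝒰, N ⊗ T_Y|_X)` of the differential of `(G, h)`. -/
def dMixed (𝒰 : X.Covering) (x y : X.ideal.support) :
    C1 𝒰 →ₗ[k] X.Cochain 1 (𝒰.opens x ⊓ 𝒰.opens y) :=
  X.restrict 1 inf_le_right ∘ₗ compG 𝒰 y - X.restrict 1 inf_le_left ∘ₗ compG 𝒰 x
    + X.nabla 0 _ ∘ₗ compH 𝒰 x y

/-- The component `δ h` in `C²(𝒰, N)` of the differential of `(G, h)`. -/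
def dCech (𝒰 : X.Covering) (x y w : X.ideal.support) :
    C1 𝒰 →ₗ[k] X.Cochain 0 (𝒰.opens x ⊓ 𝒰.opens y ⊓ 𝒰.opens w) :=
  X.restrict 0 (inf_le_inf_right _ inf_le_right) ∘ₗ compH 𝒰 y w
    - X.restrict 0 (inf_le_inf_right _ inf_le_left) ∘ₗ compH 𝒰 x w
    + X.restrict 0 inf_le_left ∘ₗ compH 𝒰 x y

/-- The cocycles of total degree `1`: `∇ G = 0`, `δ G + ∇ h = 0` and `δ h = 0`. -/
def Z1 (𝒰 : X.Covering) : Submodule k (C1 𝒰) :=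
  (⨅ x, LinearMap.ker (dNabla 𝒰 x)) ⊓ (⨅ x, ⨅ y, LinearMap.ker (dMixed 𝒰 x y)) ⊓
    ⨅ x, ⨅ y, ⨅ w, LinearMap.ker (dCech 𝒰 x y w)

theorem mem_Z1 {𝒰 : X.Covering} {z : C1 𝒰} : z ∈ Z1 𝒰 ↔
    (∀ x, dNabla 𝒰 x z = 0) ∧ (∀ x y, dMixed 𝒰 x y z = 0) ∧ ∀ x y w, dCech 𝒰 x y w z = 0 := by
  simp only [Z1, Submodule.mem_inf, Submodule.mem_iInf, LinearMap.mem_ker, and_assoc]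

/-- The differential `A ↦ (∇ A, -δ A)` from `C⁰(𝒰, N)` to the cochains of total degree `1`. -/
def d0 (𝒰 : X.Covering) : (∀ x, X.sections 0 (𝒰.opens x)) →ₗ[k] C1 𝒰 where
  toFun A := (fun x => X.nablaZero _ (A x),
    fun x y => X.resSection 0 inf_le_left (A x) - X.resSection 0 inf_le_right (A y))
  map_add' A B := by
    refine Prod.ext (funext fun x => map_add (X.nablaZero _) (A x) (B x))
      (funext fun x => funext fun y => ?_)
    exact (congrArg₂ (· - ·) (map_add (X.resSection 0 inf_le_left) (A x) (B x))
      (map_add (X.resSection 0 inf_le_right) (A y) (B y))).trans (add_sub_add_comm _ _ _ _)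
  map_smul' r A := by
    refine Prod.ext (funext fun x => map_smul (X.nablaZero _) r (A x))
      (funext fun x => funext fun y => ?_)
    exact (congrArg₂ (· - ·) (map_smul (X.resSection 0 inf_le_left) r (A x))
      (map_smul (X.resSection 0 inf_le_right) r (A y))).trans (smul_sub _ _ _).symm

theorem d0_mem_Z1 (𝒰 : X.Covering) (A : ∀ x, X.sections 0 (𝒰.opens x)) : d0 𝒰 A ∈ Z1 𝒰 := by
  rw [mem_Z1]
  refine ⟨fun x => X.nabla_nabla_zero (A x).2, fun x y => ?_, fun x y w => ?_⟩
  · change X.nabla 0 _ (X.restrict 0 inf_le_right (A y).1)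
      - X.nabla 0 _ (X.restrict 0 inf_le_left (A x).1)
      + X.nabla 0 (𝒰.opens x ⊓ 𝒰.opens y)
        (X.restrict 0 inf_le_left (A x).1 - X.restrict 0 inf_le_right (A y).1) = 0
    rw [map_sub]
    abel
  · have e : ∀ a b c : X.Cochain 0 (𝒰.opens x ⊓ 𝒰.opens y ⊓ 𝒰.opens w),
        (b - c) - (a - c) + (a - b) = 0 := fun a b c => by abel
    exact e (X.restrict 0 (inf_le_left.trans inf_le_left) (A x).1)
      (X.restrict 0 (inf_le_left.trans inf_le_right) (A y).1)
      (X.restrict 0 inf_le_right (A w).1)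

/-- The coboundaries of total degree `1`. -/
def B1 (𝒰 : X.Covering) : Submodule k (Z1 𝒰) :=
  LinearMap.range ((d0 𝒰).codRestrict (Z1 𝒰) (d0_mem_Z1 𝒰))

/-- Restriction of cochains along a refinement. -/
def refineC {𝒰 𝒱 : X.Covering} (h : 𝒱 ≤ 𝒰) : C1 𝒰 →ₗ[k] C1 𝒱 where
  toFun z := (fun x => X.resSection 1 (h x) (z.1 x),
    fun x y => X.resSection 0 (inf_le_inf (h x) (h y)) (z.2 x y))
  map_add' _ _ := rfl
  map_smul' _ _ := rfl

/-- Restriction of cocycles along a refinement. -/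
def refineZ {𝒰 𝒱 : X.Covering} (h : 𝒱 ≤ 𝒰) : Z1 𝒰 →ₗ[k] Z1 𝒱 :=
  (refineC h).restrict fun z hz => by
    rw [mem_Z1] at hz ⊢
    refine ⟨fun x => ?_, fun x y => ?_, fun x y w => ?_⟩
    · funext V
      exact congrFun (hz.1 x) ⟨V.1, V.2.trans (h x)⟩
    · funext V
      exact congrFun (hz.2.1 x y) ⟨V.1, V.2.trans (inf_le_inf (h x) (h y))⟩
    · funext V
      exact congrFun (hz.2.2 x y w) ⟨V.1, V.2.trans (inf_le_inf (inf_le_inf (h x) (h y)) (h w))⟩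

/-- The restriction map on cohomology along a refinement. -/
def refineH {𝒰 𝒱 : X.Covering} (h : 𝒱 ≤ 𝒰) : (Z1 𝒰 ⧸ B1 𝒰) →ₗ[k] (Z1 𝒱 ⧸ B1 𝒱) :=
  Submodule.mapQ _ _ (refineZ h) (by
    rintro z ⟨A, hA⟩
    refine ⟨fun x => X.resSection 0 (h x) (A x), ?_⟩
    exact Subtype.ext (congrArg (refineC h) (congrArg Subtype.val hA)))

open Classical in
variable (X) in
/-- `ℍ¹(X, N^•)`: the colimit over all open coverings of `X` of the first cohomology of the total
Čech complex of `N^•` (in degrees `0` and `1` this is hypercohomology, on any space). -/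
def H1 : Type u :=
  Module.DirectLimit (R := k) (ι := X.Coveringᵒᵈ)
    (fun 𝒰 => Z1 (OrderDual.ofDual 𝒰) ⧸ B1 (OrderDual.ofDual 𝒰))
    (fun _ _ h => refineH (OrderDual.ofDual_le_ofDual.mpr h))

open Classical in
instance : AddCommGroup X.H1 := 
  inferInstanceAs (AddCommGroup (Module.DirectLimit (R := k) (ι := X.Coveringᵒᵈ)
    (fun 𝒰 => Z1 (OrderDual.ofDual 𝒰) ⧸ B1 (OrderDual.ofDual 𝒰))
    (fun _ _ h => refineH (OrderDual.ofDual_le_ofDual.mpr h))))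

open Classical in
instance : Module k X.H1 := 
  inferInstanceAs (Module k (Module.DirectLimit (R := k) (ι := X.Coveringᵒᵈ)
    (fun 𝒰 => Z1 (OrderDual.ofDual 𝒰) ⧸ B1 (OrderDual.ofDual 𝒰))
    (fun _ _ h => refineH (OrderDual.ofDual_le_ofDual.mpr h))))

open Classical in
/-- The class in `ℍ¹(X, N^•)` of a Čech cocycle. -/
def classH1 (𝒰 : X.Covering) : Z1 𝒰 →ₗ[k] X.H1 :=
  (Module.DirectLimit.of k X.Coveringᵒᵈ
    (fun 𝒰 => Z1 (OrderDual.ofDual 𝒰) ⧸ B1 (OrderDual.ofDual 𝒰))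
    (fun _ _ h => refineH (OrderDual.ofDual_le_ofDual.mpr h)) (OrderDual.toDual 𝒰)) ∘ₗ
    (B1 𝒰).mkQ

end PoissonSubscheme

/-! ### Infinitesimal deformations -/

namespace NonsingularVariety

variable {k : Type u} [Field k] (Y : NonsingularVariety k)

/-- The product `Y × Spec A` over `k`. -/
abbrev prodSpec (A : Type u) [CommRing A] [Algebra k A] : Scheme.{u} :=
  pullback Y.str (Spec.map (CommRingCat.ofHom (algebraMap k A)))

/-- The projection `Y × Spec A ⟶ Y`. -/
abbrev prodFst (A : Type u) [CommRing A] [Algebra k A] : Y.prodSpec A ⟶ Y.scheme :=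
  pullback.fst _ _

/-- The projection `Y × Spec A ⟶ Spec A`. -/
abbrev prodSnd (A : Type u) [CommRing A] [Algebra k A] :
    Y.prodSpec A ⟶ Spec (CommRingCat.of A) :=
  pullback.snd _ _

/-- The morphism `Y × Spec B ⟶ Y × Spec A` induced by a homomorphism `A → B`. -/
def prodMap {A B : Type u} [CommRing A] [Algebra k A] [CommRing B] [Algebra k B]
    (φ : A →ₐ[k] B) : Y.prodSpec B ⟶ Y.prodSpec A :=
  pullback.lift (Y.prodFst B) (Y.prodSnd B ≫ Spec.map (CommRingCat.ofHom φ.toRingHom)) (by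
    rw [Category.assoc, ← Spec.map_comp, ← CommRingCat.ofHom_comp]
    have : φ.toRingHom.comp (algebraMap k A) = algebraMap k B := φ.comp_algebraMap
    rw [this, pullback.condition])

/-- The inclusion `Y ⟶ Y × Spec A` of the fibre over the `k`-point of `Spec A` given by
`ε : A → k`. -/
def closedFibre {A : Type u} [CommRing A] [Algebra k A] (ε : A →ₐ[k] k) :
    Y.scheme ⟶ Y.prodSpec A :=
  pullback.lift (𝟙 _) (Y.str ≫ Spec.map (CommRingCat.ofHom ε.toRingHom)) (by
    rw [Category.assoc, ← Spec.map_comp, ← CommRingCat.ofHom_comp]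
    have : ε.toRingHom.comp (algebraMap k A) = RingHom.id k := ε.comp_algebraMap
    rw [this, CommRingCat.ofHom_id, Spec.map_id, Category.comp_id, Category.id_comp])

theorem prodSections_aux (A : Type u) [CommRing A] [Algebra k A] (U : Y.scheme.Opens) :
    CommRingCat.ofHom (algebraMap k A) ≫ (Scheme.ΓSpecIso (CommRingCat.of A)).inv ≫
        (Y.prodSnd A).appTop ≫
          (Y.prodSpec A).presheaf.map (homOfLE (le_top : Y.prodFst A ⁻¹ᵁ U ≤ ⊤)).op =
      ((Scheme.ΓSpecIso (CommRingCat.of k)).inv ≫ Y.str.appTop ≫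
        Y.scheme.presheaf.map (homOfLE (le_top : U ≤ ⊤)).op) ≫ (Y.prodFst A).app U := by
  have h := congrArg Scheme.Hom.appTop (pullback.condition (f := Y.str)
    (g := Spec.map (CommRingCat.ofHom (algebraMap k A))))
  rw [Scheme.Hom.comp_appTop, Scheme.Hom.comp_appTop] at h
  rw [Scheme.ΓSpecIso_inv_naturality_assoc, Category.assoc, Category.assoc,
    Scheme.Hom.naturality, ← Category.assoc (Scheme.Hom.appTop _), ← h, Category.assoc]
  rfl

instance (A : Type u) [CommRing A] [Algebra k A] : IsAffineHom (Y.prodFst A) := by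
  have : IsAffineHom (Spec.map (CommRingCat.ofHom (algebraMap k A))) := inferInstance
  exact isAffineHom_isStableUnderBaseChange.of_isPullback (IsPullback.of_hasPullback _ _).flip this

/-- The canonical map from `A ⊗ Γ(Y, U)` to the functions on the open `U × Spec A` of
`Y × Spec A`. -/
def prodSections (A : Type u) [CommRing A] [Algebra k A] (U : Y.scheme.Opens) :
    A ⊗[k] Γ(Y.scheme, U) →+* Γ(Y.prodSpec A, Y.prodFst A ⁻¹ᵁ U) :=
  letI g : Γ(Y.scheme, U) →+* Γ(Y.prodSpec A, Y.prodFst A ⁻¹ᵁ U) := ((Y.prodFst A).app U).hom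
  letI : Algebra k Γ(Y.prodSpec A, Y.prodFst A ⁻¹ᵁ U) := (g.comp (algebraMap k _)).toAlgebra
  letI a : A →ₐ[k] Γ(Y.prodSpec A, Y.prodFst A ⁻¹ᵁ U) :=
    { toRingHom := ((Scheme.ΓSpecIso (CommRingCat.of A)).inv ≫
        (Y.prodSnd A).appTop ≫ (Y.prodSpec A).presheaf.map (homOfLE le_top).op).hom
      commutes' := by
        intro r
        exact congrArg (fun q => q.hom r) (Y.prodSections_aux A U) }
  letI b : Γ(Y.scheme, U) →ₐ[k] Γ(Y.prodSpec A, Y.prodFst A ⁻¹ᵁ U) :=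
    { toRingHom := g, commutes' := fun _ => rfl }
  (Algebra.TensorProduct.lift a b fun _ _ => Commute.all _ _).toRingHom

/-- The ideal of `A ⊗ Γ(Y, U)` defined by an ideal sheaf on `Y × Spec A`. -/
def pulledIdeal {A : Type u} [CommRing A] [Algebra k A] (J : (Y.prodSpec A).IdealSheafData)
    (U : Y.scheme.affineOpens) : Ideal (A ⊗[k] Γ(Y.scheme, U.1)) :=
  (J.ideal ⟨Y.prodFst A ⁻¹ᵁ U.1, U.2.preimage (Y.prodFst A)⟩).comap (Y.prodSections A U.1)

/-- Restriction `A ⊗ Γ(Y, U) → A ⊗ Γ(Y, V)`. -/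
def tensorRes (A : Type u) [CommRing A] [Algebra k A] {U V : Y.scheme.Opens} (h : V ≤ U) :
    A ⊗[k] Γ(Y.scheme, U) →ₐ[k] A ⊗[k] Γ(Y.scheme, V) :=
  Algebra.TensorProduct.map (AlgHom.id k A) (Y.res h)

/-- Base change `A ⊗ Γ(Y, U) → B ⊗ Γ(Y, U)`. -/
def tensorBase {A B : Type u} [CommRing A] [Algebra k A] [CommRing B] [Algebra k B]
    (φ : A →ₐ[k] B) (U : Y.scheme.Opens) :
    A ⊗[k] Γ(Y.scheme, U) →ₐ[k] B ⊗[k] Γ(Y.scheme, U) :=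
  Algebra.TensorProduct.map φ (AlgHom.id k _)

/-- Reduction `A ⊗ Γ(Y, U) → k ⊗ Γ(Y, U) = Γ(Y, U)` along `ε : A → k`. -/
def tensorReduce {A : Type u} [CommRing A] [Algebra k A] (ε : A →ₐ[k] k) (U : Y.scheme.Opens) :
    A ⊗[k] Γ(Y.scheme, U) →ₐ[k] Γ(Y.scheme, U) :=
  (Algebra.TensorProduct.lid k _).toAlgHom.comp (Y.tensorBase ε U)

end NonsingularVariety

namespace PoissonStructure

variable {k : Type u} [Field k] {Y : NonsingularVariety k} (P : PoissonStructure Y)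

/-- The Poisson bracket induced by `Λ₀` on `Y × Spec A` over `A`: the `A`-bilinear extension of the
bracket of `Y`. -/
def bracketBase (A : Type u) [CommRing A] [Algebra k A] (U : Y.scheme.Opens) :
    A ⊗[k] Γ(Y.scheme, U) →ₗ[A] A ⊗[k] Γ(Y.scheme, U) →ₗ[A] A ⊗[k] Γ(Y.scheme, U) :=
  LinearMap.BilinMap.baseChange A (P.bracket U)

end PoissonStructure

open PoissonSubscheme

/-- An infinitesimal deformation of `X` in `(Y, Λ₀)` over the `k`-algebra `A` with augmentation
`ε : A → k`: a Poisson closed subscheme of `(Y × Spec A, Λ₀)`, flat over `A`, whose fibre over the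
`k`-point `ε` is the closed subscheme `X` of `Y`. -/
@[ext]
structure InfDeformation {k : Type u} [Field k] {Y : NonsingularVariety k}
    {P : PoissonStructure Y} (X : PoissonSubscheme P)
    (A : Type u) [CommRing A] [Algebra k A] (ε : A →ₐ[k] k) where
  /-- the ideal sheaf of the closed subscheme of `Y × Spec A` -/
  ideal : (Y.prodSpec A).IdealSheafData
  flat : Flat (ideal.subschemeι ≫ Y.prodSnd A)
  fibre : ideal.comap (Y.closedFibre ε) = X.ideal
  poisson (U : Y.scheme.affineOpens) (F H : A ⊗[k] Γ(Y.scheme, U.1))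
    (hF : F ∈ Y.pulledIdeal ideal U) : P.bracketBase A U.1 H F ∈ Y.pulledIdeal ideal U

/-- `η'` over `B` is a lifting of `η` over `A` along `φ : B → A`: the subscheme `η` is the base
change of `η'`. -/
def InfDeformation.IsLifting {k : Type u} [Field k] {Y : NonsingularVariety k}
    {P : PoissonStructure Y} {X : PoissonSubscheme P}
    {A B : Type u} [CommRing A] [Algebra k A] [CommRing B] [Algebra k B] {ε : A →ₐ[k] k}
    (φ : B →ₐ[k] A) (η' : InfDeformation X B (ε.comp φ)) (η : InfDeformation X A ε) : Prop :=
  η'.ideal.comap (Y.prodMap φ) = η.ideal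

/-- `0 → (t) → B → A → 0` is a small extension: `B → A` is surjective, and its kernel is generated
by a nonzero element `t` which is annihilated by the maximal ideal of `B`. -/
structure IsSmallExtension {k : Type u} [Field k]
    {A B : Type u} [CommRing A] [Algebra k A] [CommRing B] [Algebra k B] [IsLocalRing B]
    (φ : B →ₐ[k] A) (t : B) : Prop where
  surjective : Function.Surjective φ
  ne_zero : t ≠ 0
  ker : RingHom.ker φ = Ideal.span {t}
  annihilated : ∀ m ∈ IsLocalRing.maximalIdeal B, m * t = 0

/-- Local liftings of a deformation `η` to `B`, as flat families that need not be Poisson and need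
not agree on overlaps: a covering of `X` by affine opens `U_x` and, over each of them, an ideal of
`B ⊗ Γ(Y, U_x)` with `B`-flat quotient that lifts the ideal of `η`. -/
structure LocalLiftings {k : Type u} [Field k] {Y : NonsingularVariety k}
    {P : PoissonStructure Y} {X : PoissonSubscheme P}
    {A B : Type u} [CommRing A] [Algebra k A] [CommRing B] [Algebra k B] {ε : A →ₐ[k] k}
    (η : InfDeformation X A ε) (φ : B →ₐ[k] A) where
  /-- the covering -/
  cover : X.Covering
  isAffineOpen (x : X.ideal.support) : IsAffineOpen (cover.opens x)
  /-- the local ideals -/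
  ideal (x : X.ideal.support) : Ideal (B ⊗[k] Γ(Y.scheme, cover.opens x))
  flat (x : X.ideal.support) : Module.Flat B ((B ⊗[k] Γ(Y.scheme, cover.opens x)) ⧸ ideal x)
  lifts (x : X.ideal.support) : (ideal x).map (Y.tensorBase φ (cover.opens x)) =
    Y.pulledIdeal η.ideal ⟨cover.opens x, isAffineOpen x⟩

namespace LocalLiftings

variable {k : Type u} [Field k] {Y : NonsingularVariety k}
  {P : PoissonStructure Y} {X : PoissonSubscheme P}
  {A B : Type u} [CommRing A] [Algebra k A] [CommRing B] [Algebra k B] {ε : A →ₐ[k] k}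
  {η : InfDeformation X A ε} {φ : B →ₐ[k] A} (D : LocalLiftings η φ)

/-- The ideal of the local lifting over `U_x`, restricted to an open `V` of `U_x`. -/
def idealOn (x : X.ideal.support) {V : Y.scheme.Opens} (h : V ≤ D.cover.opens x) :
    Ideal (B ⊗[k] Γ(Y.scheme, V)) :=
  (D.ideal x).map (Y.tensorRes B h)

/-- The Čech cocycle `(-G, h)` measures the failure of the local liftings to be Poisson and to agree
on overlaps. For an equation `f` of `X`, lifted to an equation `F` of the local lifting over `U_x`:
`{F, a} = K + t G(f)(a)` with an equation `K` of the local lifting over `U_x`, and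
`F = F' + t h(f)` with an equation `F'` of the local lifting over `U_y`. -/
def Represents (t : B) (z : Z1 D.cover) : Prop :=
  (∀ (x : X.ideal.support) (V : X.AffineIn (D.cover.opens x)) (f : X.ideal.ideal V.1)
      (F K : B ⊗[k] Γ(Y.scheme, V.1.1)) (a c : Γ(Y.scheme, V.1.1)),
    F ∈ D.idealOn x V.2 → K ∈ D.idealOn x V.2 → Y.tensorReduce (ε.comp φ) V.1.1 F = f →
    P.bracketBase B V.1.1 F (1 ⊗ₜ a) = K + t ⊗ₜ c →
    compG _ x z.1 V f ![a] = - Ideal.Quotient.mk _ c) ∧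
  (∀ (x y : X.ideal.support) (V : X.AffineIn (D.cover.opens x ⊓ D.cover.opens y))
      (f : X.ideal.ideal V.1) (F F' : B ⊗[k] Γ(Y.scheme, V.1.1)) (c : Γ(Y.scheme, V.1.1)),
    F ∈ D.idealOn x (V.2.trans inf_le_left) → F' ∈ D.idealOn y (V.2.trans inf_le_right) →
    Y.tensorReduce (ε.comp φ) V.1.1 F = f → F = F' + t ⊗ₜ c →
    compH _ x y z.1 V f ![] = Ideal.Quotient.mk _ c)

end LocalLiftings

end

/-!
Everything rests on a comparison of the liftings of a flat family along a small extension. Let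
`φ : B → A` be surjective with kernel spanned by an element `t` which the augmentation ideal of `B`
annihilates, let `I` be an ideal of `R`, and let the ideals `J` and `J'` of `B ⊗ R` be flat
liftings of the same deformation of `I` over `A`. An element `F` of `J` is of the form `F' + t c`
with `F' ∈ J'`, and by flatness the class of `c` in `R / I` depends only on the reduction `f ∈ I` of
`F`. This gives an `R`-linear map `ψ : I → R / I`, the difference of `J` and `J'`
(`FlatLift.exists_isDifference`). It vanishes only if `J = J'`, and every `ψ` is the difference of
`J` and a flat lifting `FlatLift.twist h J ψ`; so the liftings over an open, if there are any, form
a torsor under the sections of the normal sheaf.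

If the deformation over `A` is Poisson, then `{F, a} = K + t c` with `K ∈ J`, and the class of `c`
is a function `G` of `f` and `a`, linear in `f` and a derivation in `a`. This is the defect of `J`
(`FlatLift.exists_isDefect`), which vanishes if and only if `J` is Poisson. The Jacobi identity says
that `∇ G = 0`, and computing `{F, a}` through `F = F' + t c` says that `∇ ψ = G' - G`
(`FlatLifting.nabla_defect`, `FlatLifting.nablaZero_diff`).

Obstructions. Liftings exist near every point of `X`, because any lifting of the equations of a
regular sequence defines a flat family (`FlatLift.isDeformation_ofList`, `nonempty_localLiftings`).
The defects and differences of local liftings form the cocycle `(-G, h)`. Other local liftings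
change it by the coboundary of the differences, and the groups `ℍ¹` of all coverings have a common
colimit, so its class is independent of all choices (`FlatLifting.classH1_cocycle_eq`). If the class
vanishes, then on some refinement the cocycle is the coboundary of sections of the normal sheaf;
twisting by them makes the local liftings Poisson and equal on overlaps, and they are glued to a
deformation (`exists_infDeformation`). Conversely, the restrictions of a global Poisson lifting have
cocycle zero (`FlatLifting.classH1_cocycle_eq_zero_iff`).

Gluing takes place on affine opens: over an affine open `U` of `Y` an ideal sheaf on `Y × Spec B` is
an ideal of `B ⊗ Γ(U)` (`NonsingularVariety.prodSections_bijective`). Since `X` is quasi-compact,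
finitely many affine opens suffice, and the glued ideal sheaf is the intersection of the direct
images of the local ones.

First-order deformations. The augmentation `k[ε] → k` is itself a small extension, and every
deformation over `k[ε]` lifts the only deformation over `k`. With the trivial deformation as origin,
the deformations are thus the global sections `ψ` of the normal sheaf with `∇ ψ = 0`
(`FlatLifting.equivH0`).
-/

/-! ### Base change, reduction, and flatness along a nilpotent augmentation ideal -/

noncomputable section

namespace FlatLift

section Reduction

variable {k : Type u} [Field k] {R : Type u} [CommRing R] [Algebra k R]
  {A B : Type u} [CommRing A] [Algebra k A] [CommRing B] [Algebra k B]

variable (R) in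
/-- Base change `B ⊗ R → A ⊗ R`. -/
def base (φ : B →ₐ[k] A) : B ⊗[k] R →ₐ[k] A ⊗[k] R :=
  Algebra.TensorProduct.map φ (AlgHom.id k R)

variable (R) in
/-- Reduction `A ⊗ R → R` along an augmentation of `A`. -/
def reduce (ε : A →ₐ[k] k) : A ⊗[k] R →ₐ[k] R :=
  (Algebra.TensorProduct.lid k R).toAlgHom.comp (base R ε)

@[simp]
theorem base_tmul (φ : B →ₐ[k] A) (b : B) (r : R) : base R φ (b ⊗ₜ r) = φ b ⊗ₜ r := rfl

@[simp]
theorem reduce_tmul (ε : A →ₐ[k] k) (a : A) (r : R) : reduce R ε (a ⊗ₜ r) = ε a • r := by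
  simp [reduce]

@[simp]
theorem reduce_base (ε : A →ₐ[k] k) (φ : B →ₐ[k] A) (x : B ⊗[k] R) :
    reduce R ε (base R φ x) = reduce R (ε.comp φ) x := by
  induction x with
  | zero => simp
  | tmul b r => simp
  | add x y hx hy => simp [hx, hy]

theorem base_surjective {φ : B →ₐ[k] A} (hφ : Function.Surjective φ) :
    Function.Surjective (base R φ) :=
  TensorProduct.map_surjective hφ Function.surjective_id

theorem reduce_surjective (ε : A →ₐ[k] k) : Function.Surjective (reduce R ε) :=
  fun r => ⟨1 ⊗ₜ r, by simp⟩

@[simp]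
theorem reduce_smul (ε : A →ₐ[k] k) (a : A) (x : A ⊗[k] R) :
    reduce R ε (a • x) = ε a • reduce R ε x := by
  rw [Algebra.smul_def, map_mul, Algebra.TensorProduct.algebraMap_apply, reduce_tmul]
  simp

@[simp]
theorem base_smul (φ : B →ₐ[k] A) (b : B) (x : B ⊗[k] R) :
    base R φ (b • x) = φ b • base R φ x := by
  rw [Algebra.smul_def, map_mul, Algebra.TensorProduct.algebraMap_apply, base_tmul,
    Algebra.smul_def, Algebra.TensorProduct.algebraMap_apply]
  simp

/-- Modulo the augmentation ideal an element of `A ⊗ R` is the constant family on its reduction. -/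
theorem sub_reduce_mem (ε : A →ₐ[k] k) (x : A ⊗[k] R) :
    x - 1 ⊗ₜ reduce R ε x ∈ (RingHom.ker ε • ⊤ : Submodule A (A ⊗[k] R)) := by
  induction x with
  | zero => simp
  | tmul a r =>
    have h : a ⊗ₜ[k] r - 1 ⊗ₜ reduce R ε (a ⊗ₜ r) =
        (a - algebraMap k A (ε a)) • ((1 : A) ⊗ₜ[k] r) := by
      rw [reduce_tmul, sub_smul, TensorProduct.smul_tmul', TensorProduct.smul_tmul',
        smul_eq_mul, mul_one, smul_eq_mul, mul_one, Algebra.algebraMap_eq_smul_one,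
        TensorProduct.smul_tmul]
    rw [h]
    exact Submodule.smul_mem_smul (by simp [RingHom.mem_ker]) trivial
  | add x y hx hy =>
    have h : x + y - 1 ⊗ₜ reduce R ε (x + y) =
        (x - 1 ⊗ₜ reduce R ε x) + (y - 1 ⊗ₜ reduce R ε y) := by
      rw [map_add, TensorProduct.tmul_add]; abel
    rw [h]
    exact add_mem hx hy

theorem mem_smul_of_reduce_eq_zero {ε : A →ₐ[k] k} {x : A ⊗[k] R} (h : reduce R ε x = 0) :
    x ∈ (RingHom.ker ε • ⊤ : Submodule A (A ⊗[k] R)) := by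
  simpa [h] using sub_reduce_mem ε x

/-- An element reducing to zero is a combination with coefficients in the augmentation ideal; in
this form the equational criterion for flatness applies to it. -/
theorem exists_finsupp_of_reduce_eq_zero {ε : A →ₐ[k] k} {x : A ⊗[k] R}
    (h : reduce R ε x = 0) :
    ∃ a : (A ⊗[k] R) →₀ A, (∀ i, a i ∈ RingHom.ker ε) ∧ (a.sum fun i c => c • i) = x := by
  have h1 := mem_smul_of_reduce_eq_zero h
  have h2 : (⊤ : Submodule A (A ⊗[k] R)) = Submodule.span A (Set.range id) := by simp
  rw [h2, Submodule.mem_ideal_smul_span_iff_exists_sum] at h1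
  obtain ⟨a, ha, h⟩ := h1
  exact ⟨a, ha, h⟩

/-- If the augmentation ideal annihilates `t`, then `t x` depends only on the reduction of `x`. -/
theorem smul_eq_tmul_reduce {ε : A →ₐ[k] k} {t : A} (ht : ∀ m ∈ RingHom.ker ε, m * t = 0)
    (x : A ⊗[k] R) : t • x = t ⊗ₜ reduce R ε x := by
  have h : t • (x - 1 ⊗ₜ reduce R ε x) = 0 := by
    refine Submodule.smul_induction_on (p := fun y => t • y = 0) (sub_reduce_mem ε x) ?_ ?_
    · intro m hm y _
      rw [smul_smul, mul_comm, ht m hm, zero_smul]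
    · intro y z hy hz
      rw [smul_add, hy, hz, add_zero]
  rw [smul_sub, sub_eq_zero] at h
  rw [h, TensorProduct.smul_tmul', smul_eq_mul, mul_one]

/-- The kernel of the base change along a small extension is `t ⊗ R`. -/
theorem exists_tmul_of_base_eq_zero {ε : B →ₐ[k] k} {φ : B →ₐ[k] A} {t : B}
    (hφ : Function.Surjective φ) (hk : RingHom.ker φ = Ideal.span {t})
    (ht : ∀ m ∈ RingHom.ker ε, m * t = 0) {x : B ⊗[k] R} (h : base R φ x = 0) :
    ∃ c : R, x = t ⊗ₜ c := by
  have h1 : x ∈ RingHom.ker (base R φ) := h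
  have h3 : RingHom.ker (base R φ) =
      (RingHom.ker φ).map (Algebra.TensorProduct.includeLeft : B →ₐ[k] B ⊗[k] R) :=
    Algebra.TensorProduct.rTensor_ker (R := k) (C := R) φ hφ
  rw [h3, hk, Ideal.map_span, Set.image_singleton, Ideal.mem_span_singleton] at h1
  obtain ⟨y, rfl⟩ := h1
  refine ⟨reduce R ε y, ?_⟩
  rw [← smul_eq_tmul_reduce ht, Algebra.smul_def]
  rfl

end Reduction

section Flatness

variable {k : Type u} [Field k] {A : Type u} [CommRing A] [Algebra k A]
  {M : Type u} [AddCommGroup M] [Module A M]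

/-- The lemma of Nakayama for a nilpotent ideal; no finiteness is needed. -/
theorem le_of_le_sup_smul {𝔪 : Ideal A} (h𝔪 : IsNilpotent 𝔪) {N N' : Submodule A M}
    (h : N ≤ N' ⊔ 𝔪 • N) : N ≤ N' := by
  obtain ⟨n, hn⟩ := h𝔪
  have key : ∀ n : ℕ, N ≤ N' ⊔ 𝔪 ^ n • N := by
    intro n
    induction n with
    | zero => simp
    | succ n ih =>
      refine ih.trans (sup_le le_sup_left ?_)
      refine (Submodule.smul_mono le_rfl h).trans ?_
      rw [Submodule.smul_sup, ← Submodule.mul_smul, ← pow_succ]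
      exact sup_le_sup_right Submodule.smul_le_right _
  simpa [hn] using key n

variable (ε : A →ₐ[k] k) {V : Type u} [AddCommGroup V] [Module k V] (π : M →+ V)
  (hπ : ∀ (a : A) (x : M), π (a • x) = ε a • π x)

include hπ in
/-- A family which spans modulo the augmentation ideal spans. Here and in the next two statements
`π : M → V` stands for the reduction of an `A`-module along `ε`: an additive, semilinear map, whose
kernel is contained in `(ker ε) M` where `hker` is assumed. -/
theorem span_eq_top_of_reduction (hm : IsNilpotent (RingHom.ker ε))
    (hker : ∀ x, π x = 0 → x ∈ (RingHom.ker ε • ⊤ : Submodule A M))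
    {ι : Type u} (v : ι → M) (h : Submodule.span k (Set.range (π ∘ v)) = ⊤) :
    Submodule.span A (Set.range v) = ⊤ := by
  rw [eq_top_iff]
  refine le_of_le_sup_smul hm fun x _ => ?_
  have key : ∀ w ∈ Submodule.span k (Set.range (π ∘ v)),
      ∃ y ∈ Submodule.span A (Set.range v), π y = w := by
    intro w hw
    induction hw using Submodule.span_induction with
    | mem w hw =>
      obtain ⟨i, rfl⟩ := hw
      exact ⟨v i, Submodule.subset_span ⟨i, rfl⟩, rfl⟩
    | zero => exact ⟨0, zero_mem _, map_zero π⟩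
    | add w w' _ _ h h' =>
      obtain ⟨y, hy, rfl⟩ := h
      obtain ⟨y', hy', rfl⟩ := h'
      exact ⟨y + y', add_mem hy hy', map_add π y y'⟩
    | smul c w _ h =>
      obtain ⟨y, hy, rfl⟩ := h
      exact ⟨algebraMap k A c • y, Submodule.smul_mem _ _ hy, by simp [hπ]⟩
  obtain ⟨y, hy, hyx⟩ := key (π x) (h ▸ trivial)
  have : x = y + (x - y) := by abel
  rw [this]
  exact Submodule.add_mem_sup hy (hker _ (by rw [map_sub, hyx, sub_self]))

include hπ in
/-- In a flat module over a local ring, a family which is independent after reduction is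
independent. -/
theorem linearIndependent_of_reduction [IsLocalRing A] [Module.Flat A M]
    {ι : Type u} (v : ι → M) (h : LinearIndependent k (π ∘ v)) : LinearIndependent A v := by
  have hmem : ∀ a : A, a ∈ IsLocalRing.maximalIdeal A ↔ ε a = 0 := by
    intro a
    rw [← RingHom.mem_ker, IsLocalRing.eq_maximalIdeal (RingHom.ker_isMaximal_of_surjective ε
      fun c => ⟨algebraMap k A c, by simp⟩)]
  refine Module.IsLocalRing.linearIndependent_of_flat v ?_
  rw [linearIndependent_iff'] at h ⊢
  intro s c hc i hi
  choose a ha using fun i => IsLocalRing.residue_surjective (R := A) (c i)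
  have h1 : TensorProduct.mk A (IsLocalRing.ResidueField A) M 1 (∑ i ∈ s, a i • v i) = 0 := by
    rw [map_sum, ← hc]
    refine Finset.sum_congr rfl fun i _ => ?_
    rw [map_smul, ← ha]
    rfl
  have h2 : ∑ i ∈ s, a i • v i ∈ (IsLocalRing.maximalIdeal A • ⊤ : Submodule A M) := by
    rw [← LinearMap.ker_tensorProductMk]
    exact h1
  have h3 : π (∑ i ∈ s, a i • v i) = 0 := by
    refine Submodule.smul_induction_on (p := fun x => π x = 0) h2 ?_ ?_
    · intro m hm x _
      rw [hπ, (hmem m).mp hm, zero_smul]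
    · intro x y hx hy
      rw [map_add, hx, hy, add_zero]
  have h4 := h s (fun i => ε (a i)) (by simpa [hπ] using h3) i hi
  rw [← ha, IsLocalRing.residue_eq_zero_iff]
  exact (hmem _).mpr h4

include hπ in
/-- The cokernel of an endomorphism `F` of a flat module is flat if the reduction `f` of `F` is
injective: a basis of the reduction adapted to the image of `f` lifts to a basis of `M` in which
the range of `F` is a direct summand. -/
theorem flat_quotient_range [IsLocalRing A] [Module.Flat A M] (hm : IsNilpotent (RingHom.ker ε))
    (hs : Function.Surjective π)
    (hker : ∀ x, π x = 0 → x ∈ (RingHom.ker ε • ⊤ : Submodule A M))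
    (F : M →ₗ[A] M) (f : V →ₗ[k] V) (hf : Function.Injective f)
    (hF : ∀ x, π (F x) = f (π x)) : Module.Flat A (M ⧸ LinearMap.range F) := by
  let b := Module.Basis.ofVectorSpace k V
  have hfb : LinearIndependent k (f ∘ b) :=
    b.linearIndependent.map' f (LinearMap.ker_eq_bot.mpr hf)
  -- the basis `c` consists of the vectors `f (b i)` and of further vectors completing them
  let c := Module.Basis.sumExtend hfb
  choose e he using fun i => hs (b i)
  choose w hw using fun j => hs (c (Sum.inr j))
  -- `u` consists of the elements `F (e i)` and of lifts `w j` of the completing vectors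
  let u := Sum.elim (F ∘ e) w
  have hu : π ∘ u = c := by
    funext i
    rcases i with i | j
    · have : c (Sum.inl i) = f (b i) := by
        simp only [c, Module.Basis.sumExtend, Module.Basis.coe_reindex, Module.Basis.coe_extend,
          Function.comp_apply]
        rfl
      rw [this, ← he, ← hF]
      rfl
    · exact hw j
  have he' : π ∘ e = b := funext he
  have hli := linearIndependent_of_reduction ε π hπ u (hu ▸ c.linearIndependent)
  have hsp := span_eq_top_of_reduction ε π hπ hm hker u (hu ▸ c.span_eq)
  have hspe := span_eq_top_of_reduction ε π hπ hm hker e (he' ▸ b.span_eq)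
  let U := Module.Basis.mk hli hsp.ge
  have hU : ∀ i, U i = u i := fun i => Module.Basis.mk_apply hli hsp.ge i
  -- the projection onto the span of the `w j` which kills the elements `F (e i)`
  let p : M →ₗ[A] M := U.constr A (Sum.elim (fun _ => 0) w)
  have hp0 : LinearMap.range F ≤ LinearMap.ker p := by
    have h : p ∘ₗ F = 0 := by
      refine LinearMap.ext_on_range hspe fun i => ?_
      have h1 : F (e i) = U (Sum.inl i) := by rw [hU]; rfl
      rw [LinearMap.comp_apply, h1, Module.Basis.constr_basis]
      rfl
    rintro _ ⟨x, rfl⟩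
    exact LinearMap.congr_fun h x
  -- it exhibits the quotient by the range of `F` as a retract of the flat module `M`
  refine Module.Flat.of_retract ((LinearMap.range F).liftQ p hp0) (LinearMap.range F).mkQ ?_
  refine Submodule.linearMap_qext _ (U.ext fun i => ?_)
  rcases i with i | j
  · have h1 : U (Sum.inl i) = F (e i) := by rw [hU]; rfl
    have h2 : (LinearMap.range F).mkQ (F (e i)) = 0 := by
      rw [Submodule.mkQ_apply, Submodule.Quotient.mk_eq_zero]
      exact ⟨e i, rfl⟩
    simp only [LinearMap.comp_apply, Submodule.mkQ_apply, Submodule.liftQ_apply,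
      LinearMap.id_apply]
    rw [← Submodule.mkQ_apply, ← Submodule.mkQ_apply, Module.Basis.constr_basis, h1, h2]
    exact map_zero _
  · simp only [LinearMap.comp_apply, Submodule.mkQ_apply, Submodule.liftQ_apply,
      LinearMap.id_apply]
    rw [Module.Basis.constr_basis, hU]
    rfl

end Flatness

end FlatLift
end

/-! ### Flat deformations of an ideal -/

noncomputable section

namespace FlatLift

section Deformation

variable {k : Type u} [Field k] {R : Type u} [CommRing R] [Algebra k R]
  {A B : Type u} [CommRing A] [Algebra k A] [CommRing B] [Algebra k B]

/-- The ideal `J` of `A ⊗ R` defines a flat deformation over `A` of the ideal `I` of `R`. -/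
structure IsDeformation (ε : A →ₐ[k] k) (I : Ideal R) (J : Ideal (A ⊗[k] R)) : Prop where
  flat : Module.Flat A ((A ⊗[k] R) ⧸ J)
  map_reduce : J.map (reduce R ε) = I

namespace IsDeformation

variable {ε : A →ₐ[k] k} {I : Ideal R} {J : Ideal (A ⊗[k] R)} (hJ : IsDeformation ε I J)
include hJ

theorem reduce_mem {F : A ⊗[k] R} (hF : F ∈ J) : reduce R ε F ∈ I :=
  hJ.map_reduce ▸ Ideal.mem_map_of_mem _ hF

theorem exists_reduce_eq {f : R} (hf : f ∈ I) : ∃ F ∈ J, reduce R ε F = f := by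
  rw [← hJ.map_reduce, Ideal.mem_map_iff_of_surjective _ (reduce_surjective ε)] at hf
  exact hf

/-- Flatness of `(A ⊗ R) / J` makes `J ∩ 𝔪 (A ⊗ R) = 𝔪 J`: a relation among the generators of `𝔪`
with coefficients in a flat module is trivial. -/
theorem mem_smul_of_reduce_eq_zero {F : A ⊗[k] R} (hF : F ∈ J) (h : reduce R ε F = 0) :
    F ∈ (RingHom.ker ε • J.restrictScalars A : Submodule A (A ⊗[k] R)) := by
  have := hJ.flat
  obtain ⟨a, ha, rfl⟩ := exists_finsupp_of_reduce_eq_zero h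
  have h0 : ∑ i : a.support, a i • (Ideal.Quotient.mkₐ A J) (i : A ⊗[k] R) = 0 := by
    rw [Finset.sum_coe_sort a.support fun i => a i • (Ideal.Quotient.mkₐ A J) i]
    rw [← Ideal.Quotient.eq_zero_iff_mem] at hF
    rw [← hF, Finsupp.sum, map_sum]
    rfl
  -- the relation `∑ aᵢ xᵢ = 0` modulo `J` is trivial: `xᵢ = ∑ cᵢⱼ yⱼ` modulo `J`, `∑ aᵢ cᵢⱼ = 0`
  obtain ⟨l, c, y, hy, hc⟩ := Module.Flat.isTrivialRelation_of_sum_smul_eq_zero h0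
  choose y' hy' using fun j => Ideal.Quotient.mk_surjective (y j)
  have hn : ∀ i : a.support, (i : A ⊗[k] R) - ∑ j, c i j • y' j ∈ J := by
    intro i
    rw [← Ideal.Quotient.eq_zero_iff_mem, map_sub, sub_eq_zero, map_sum]
    refine (hy i).trans (Finset.sum_congr rfl fun j _ => ?_)
    rw [← hy']
    rfl
  have e : (a.sum fun i c => c • i) =
      ∑ i : a.support, a i • ((i : A ⊗[k] R) - ∑ j, c i j • y' j) := by
    simp only [smul_sub, Finset.sum_sub_distrib, Finset.smul_sum, smul_smul]
    rw [Finset.sum_comm]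
    simp only [← Finset.sum_smul, hc, zero_smul, Finset.sum_const_zero, sub_zero]
    rw [Finset.sum_coe_sort a.support fun i => a i • i]
    rfl
  rw [e]
  exact Submodule.sum_mem _ fun i _ => Submodule.smul_mem_smul (ha i) (hn i)

/-- A flat family contains no smaller ideal with the same reduction, flat or not. -/
theorem eq_of_le (hm : IsNilpotent (RingHom.ker ε)) {J' : Ideal (A ⊗[k] R)}
    (hJ' : J'.map (reduce R ε) = I) (h : J' ≤ J) : J' = J := by
  refine le_antisymm h ?_
  refine le_of_le_sup_smul (N := J.restrictScalars A) (N' := J'.restrictScalars A) hm ?_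
  intro G hG
  have h1 := hJ.reduce_mem hG
  rw [← hJ', Ideal.mem_map_iff_of_surjective _ (reduce_surjective ε)] at h1
  obtain ⟨G', hG', e⟩ := h1
  have : G = G' + (G - G') := by abel
  rw [this]
  exact Submodule.add_mem_sup hG' (hJ.mem_smul_of_reduce_eq_zero (sub_mem hG (h hG'))
    (by rw [map_sub, e, sub_self]))

/-- The reduction `(A ⊗ R) / J → R / I`. -/
def quotientReduce : (A ⊗[k] R) ⧸ J →+* R ⧸ I :=
  Ideal.quotientMap I (reduce R ε).toRingHom fun _ hF => hJ.reduce_mem hF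

theorem quotientReduce_smul (a : A) (x : (A ⊗[k] R) ⧸ J) :
    hJ.quotientReduce (a • x) = ε a • hJ.quotientReduce x := by
  obtain ⟨x, rfl⟩ := Ideal.Quotient.mk_surjective x
  exact congrArg (Ideal.Quotient.mk I) (reduce_smul ε a x)

theorem quotientReduce_surjective : Function.Surjective hJ.quotientReduce := by
  intro y
  obtain ⟨y, rfl⟩ := Ideal.Quotient.mk_surjective y
  obtain ⟨x, rfl⟩ := reduce_surjective ε y
  exact ⟨Ideal.Quotient.mk J x, rfl⟩

theorem mem_smul_of_quotientReduce_eq_zero (x : (A ⊗[k] R) ⧸ J)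
    (hx : hJ.quotientReduce x = 0) :
    x ∈ (RingHom.ker ε • ⊤ : Submodule A ((A ⊗[k] R) ⧸ J)) := by
  obtain ⟨x, rfl⟩ := Ideal.Quotient.mk_surjective x
  have h1 : reduce R ε x ∈ I := Ideal.Quotient.eq_zero_iff_mem.mp hx
  obtain ⟨F, hF, e⟩ := hJ.exists_reduce_eq h1
  have h2 : Ideal.Quotient.mk J x = (Ideal.Quotient.mkₐ A J).toLinearMap (x - F) := by
    refine Ideal.Quotient.eq.mpr ?_
    simpa using hF
  rw [h2]
  have h3 := FlatLift.mem_smul_of_reduce_eq_zero (ε := ε) (x := x - F)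
    (by rw [map_sub, e, sub_self])
  have h4 := Submodule.mem_map_of_mem (f := (Ideal.Quotient.mkₐ A J).toLinearMap) h3
  rw [Submodule.map_smul''] at h4
  exact Submodule.smul_mono le_rfl le_top h4

/-- Dividing out a further equation whose reduction is a nonzerodivisor modulo `I` keeps the family
flat. -/
theorem sup_span_singleton [IsLocalRing A] (hm : IsNilpotent (RingHom.ker ε)) (F : A ⊗[k] R)
    (hF : ∀ r, r * reduce R ε F ∈ I → r ∈ I) :
    IsDeformation ε (I ⊔ Ideal.span {reduce R ε F}) (J ⊔ Ideal.span {F}) where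
  flat := by
    have := hJ.flat
    let π := hJ.quotientReduce.toAddMonoidHom
    let M := (A ⊗[k] R) ⧸ J
    -- the new quotient is the cokernel of multiplication by `F` on the old one
    let mF : M →ₗ[A] M := LinearMap.mulLeft A (Ideal.Quotient.mk J F)
    have h := flat_quotient_range ε π hJ.quotientReduce_smul hm hJ.quotientReduce_surjective
      hJ.mem_smul_of_quotientReduce_eq_zero mF
      (LinearMap.mulLeft k (Ideal.Quotient.mk I (reduce R ε F))) ?_ ?_
    · let q : ((A ⊗[k] R) ⧸ J) →ₗ[A] ((A ⊗[k] R) ⧸ (J ⊔ Ideal.span {F})) :=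
        (Ideal.Quotient.factorₐ A (le_sup_left : J ≤ J ⊔ Ideal.span {F})).toLinearMap
      have hq : Function.Surjective q := Ideal.Quotient.factor_surjective le_sup_left
      have hk : LinearMap.ker q = LinearMap.range mF := by
        ext x
        obtain ⟨x, rfl⟩ := Ideal.Quotient.mk_surjective x
        have h1 : q (Ideal.Quotient.mk J x) = 0 ↔ x ∈ J ⊔ Ideal.span {F} :=
          Ideal.Quotient.eq_zero_iff_mem
        rw [LinearMap.mem_ker, h1, LinearMap.mem_range, Submodule.mem_sup]
        constructor
        · rintro ⟨y, hy, z, hz, rfl⟩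
          obtain ⟨z, rfl⟩ := Ideal.mem_span_singleton'.mp hz
          refine ⟨Ideal.Quotient.mk J z, ?_⟩
          change Ideal.Quotient.mk J F * Ideal.Quotient.mk J z = _
          rw [← map_mul, Ideal.Quotient.eq]
          convert! neg_mem hy using 1
          ring
        · rintro ⟨z, hz⟩
          obtain ⟨z, rfl⟩ := Ideal.Quotient.mk_surjective z
          change Ideal.Quotient.mk J F * Ideal.Quotient.mk J z = _ at hz
          rw [← map_mul, Ideal.Quotient.eq] at hz
          exact ⟨x - F * z, by convert! neg_mem hz using 1; ring, F * z,
            Ideal.mul_mem_right _ _ (Ideal.mem_span_singleton_self F), by ring⟩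
      exact Module.Flat.of_linearEquiv
        ((Submodule.quotEquivOfEq _ _ hk).symm ≪≫ₗ q.quotKerEquivOfSurjective hq).symm
    · rw [← LinearMap.ker_eq_bot, LinearMap.ker_eq_bot']
      intro r hr
      obtain ⟨r, rfl⟩ := Ideal.Quotient.mk_surjective r
      rw [LinearMap.mulLeft_apply, ← map_mul, Ideal.Quotient.eq_zero_iff_mem, mul_comm] at hr
      exact Ideal.Quotient.eq_zero_iff_mem.mpr (hF r hr)
    · intro x
      exact map_mul hJ.quotientReduce _ _
  map_reduce := by
    rw [Ideal.map_sup, hJ.map_reduce, Ideal.map_span, Set.image_singleton]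

end IsDeformation

theorem isDeformation_bot (ε : A →ₐ[k] k) :
    IsDeformation ε (⊥ : Ideal R) (⊥ : Ideal (A ⊗[k] R)) where
  flat := Module.Flat.of_linearEquiv (AlgEquiv.quotientBot A (A ⊗[k] R)).toLinearEquiv
  map_reduce := Ideal.map_bot

/-- Any lifting of the members of a regular sequence defines a flat family. -/
theorem isDeformation_ofList [IsLocalRing A] {ε : A →ₐ[k] k} (hm : IsNilpotent (RingHom.ker ε))
    (Fs : List (A ⊗[k] R)) (h : RingTheory.Sequence.IsWeaklyRegular R (Fs.map (reduce R ε))) :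
    IsDeformation ε (Ideal.ofList (Fs.map (reduce R ε))) (Ideal.ofList Fs) := by
  induction Fs using List.reverseRecOn with
  | nil =>
    rw [List.map_nil, Ideal.ofList_nil, Ideal.ofList_nil]
    exact isDeformation_bot ε
  | append_singleton Fs F ih =>
    rw [List.map_append, List.map_singleton,
      RingTheory.Sequence.isWeaklyRegular_append_iff] at h
    rw [List.map_append, List.map_singleton, Ideal.ofList_append, Ideal.ofList_append,
      Ideal.ofList_singleton, Ideal.ofList_singleton]
    refine (ih h.1).sup_span_singleton hm F fun r hr => ?_
    have h2 := ((RingTheory.Sequence.isWeaklyRegular_cons_iff _ _ _).mp h.2).1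
    have h3 : (Submodule.Quotient.mk r : R ⧸ (Ideal.ofList (Fs.map (reduce R ε)) • ⊤ :
        Submodule R R)) = 0 := by
      refine h2.right_eq_zero_of_smul ?_
      rw [← Submodule.Quotient.mk_smul, Submodule.Quotient.mk_eq_zero]
      simpa [mul_comm] using hr
    rw [Submodule.Quotient.mk_eq_zero] at h3
    simpa using h3

end Deformation

end FlatLift
end

/-! ### Flat liftings along a small extension -/

noncomputable section

namespace FlatLift

section Lift

variable {k : Type u} [Field k] {R : Type u} [CommRing R] [Algebra k R]
  {A B : Type u} [CommRing A] [Algebra k A] [CommRing B] [Algebra k B]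

/-- A small extension of augmented `k`-algebras, in terms of the augmentation ideals. -/
structure IsSmall (ε : A →ₐ[k] k) (φ : B →ₐ[k] A) (t : B) : Prop where
  surjective : Function.Surjective φ
  ne_zero : t ≠ 0
  ker : RingHom.ker φ = Ideal.span {t}
  annihilated : ∀ m ∈ RingHom.ker (ε.comp φ), m * t = 0
  isNilpotent : IsNilpotent (RingHom.ker ε)

namespace IsSmall

variable {ε : A →ₐ[k] k} {φ : B →ₐ[k] A} {t : B} (h : IsSmall ε φ t)
include h

theorem map_eq_zero : φ t = 0 := by
  rw [← RingHom.mem_ker, h.ker]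
  exact Ideal.mem_span_singleton_self t

@[simp]
theorem base_tmul (c : R) : base R φ (t ⊗ₜ c) = 0 := by
  rw [FlatLift.base_tmul, h.map_eq_zero, TensorProduct.zero_tmul]

@[simp]
theorem reduce_tmul (c : R) : reduce R (ε.comp φ) (t ⊗ₜ c) = 0 := by
  rw [FlatLift.reduce_tmul, AlgHom.comp_apply, h.map_eq_zero, map_zero, zero_smul]

theorem smul_eq (x : B ⊗[k] R) : t • x = t ⊗ₜ reduce R (ε.comp φ) x :=
  smul_eq_tmul_reduce h.annihilated x

/-- The kernel `t ⊗ R` is a module over `R`: elements of `B ⊗ R` act through their reductions. -/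
theorem mul_tmul (x : B ⊗[k] R) (c : R) :
    x * t ⊗ₜ c = t ⊗ₜ (reduce R (ε.comp φ) x * c) := by
  have : (t ⊗ₜ[k] c : B ⊗[k] R) = t • ((1 : B) ⊗ₜ c) := by
    rw [TensorProduct.smul_tmul', smul_eq_mul, mul_one]
  rw [this, mul_smul_comm, h.smul_eq, map_mul, FlatLift.reduce_tmul, map_one, one_smul]

theorem exists_tmul {x : B ⊗[k] R} (hx : base R φ x = 0) : ∃ c : R, x = t ⊗ₜ c :=
  exists_tmul_of_base_eq_zero h.surjective h.ker h.annihilated hx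

end IsSmall

/-- The ideal `J` of `B ⊗ R` is a flat lifting of the ideal `J₀` of `A ⊗ R`. -/
structure IsLift (φ : B →ₐ[k] A) (J₀ : Ideal (A ⊗[k] R)) (J : Ideal (B ⊗[k] R)) : Prop where
  flat : Module.Flat B ((B ⊗[k] R) ⧸ J)
  map_base : J.map (base R φ) = J₀

namespace IsLift

variable {ε : A →ₐ[k] k} {φ : B →ₐ[k] A} {t : B} {I : Ideal R} {J₀ : Ideal (A ⊗[k] R)}
  {J J' : Ideal (B ⊗[k] R)}

theorem isDeformation (h₀ : IsDeformation ε I J₀) (hJ : IsLift φ J₀ J) :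
    IsDeformation (ε.comp φ) I J where
  flat := hJ.flat
  map_reduce := by
    have h : (reduce R (ε.comp φ) : B ⊗[k] R →+* R) =
        (reduce R ε : A ⊗[k] R →+* R).comp (base R φ : B ⊗[k] R →+* A ⊗[k] R) :=
      RingHom.ext fun x => (reduce_base ε φ x).symm
    have h1 := h₀.map_reduce
    rw [← hJ.map_base] at h1
    have h2 := Ideal.map_map (I := J) (base R φ : B ⊗[k] R →+* A ⊗[k] R)
      (reduce R ε : A ⊗[k] R →+* R)
    rw [← h] at h2
    exact h2.symm.trans h1

theorem base_mem (hJ : IsLift φ J₀ J) {F : B ⊗[k] R} (hF : F ∈ J) : base R φ F ∈ J₀ :=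
  hJ.map_base ▸ Ideal.mem_map_of_mem _ hF

variable (h : IsSmall ε φ t)
include h

/-- An element whose base change lies in `J₀` lies in `J` up to a multiple `t c`. Both the
difference of two liftings and the Poisson defect of one are read off from such a `c`. -/
theorem exists_eq_add (hJ : IsLift φ J₀ J) {F : B ⊗[k] R} (hF : base R φ F ∈ J₀) :
    ∃ F' ∈ J, ∃ c : R, F = F' + t ⊗ₜ c := by
  rw [← hJ.map_base, Ideal.mem_map_iff_of_surjective _ (base_surjective h.surjective)] at hF
  obtain ⟨F', hF', e⟩ := hF
  obtain ⟨c, hc⟩ := h.exists_tmul (x := F - F') (by rw [map_sub, e, sub_self])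
  exact ⟨F', hF', c, by rw [← hc]; abel⟩

theorem tmul_mem (h₀ : IsDeformation ε I J₀) (hJ : IsLift φ J₀ J) {c : R} (hc : c ∈ I) :
    t ⊗ₜ[k] c ∈ J := by
  obtain ⟨F, hF, rfl⟩ := (hJ.isDeformation h₀).exists_reduce_eq hc
  rw [← h.smul_eq, Algebra.smul_def]
  exact Ideal.mul_mem_left _ _ hF

/-- For a flat lifting, `t c ∈ J` only if `c ∈ I`, because the elements of a flat `B`-module
annihilated by `t` lie in its product with the augmentation ideal. -/
theorem mem_of_tmul_mem (h₀ : IsDeformation ε I J₀) (hJ : IsLift φ J₀ J) {c : R}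
    (hc : t ⊗ₜ[k] c ∈ J) : c ∈ I := by
  have h1 := hJ.isDeformation h₀
  have := hJ.flat
  have h3 : ∑ i : Fin 1, (fun _ => t) i •
      (fun _ => Ideal.Quotient.mk J ((1 : B) ⊗ₜ[k] c)) i = 0 := by
    rw [Fin.sum_univ_one]
    have : t ⊗ₜ[k] c = t • ((1 : B) ⊗ₜ[k] c) := by
      rw [TensorProduct.smul_tmul', smul_eq_mul, mul_one]
    rw [this] at hc
    exact Ideal.Quotient.eq_zero_iff_mem.mpr hc
  obtain ⟨l, a, y, hy, ha⟩ := Module.Flat.isTrivialRelation_of_sum_smul_eq_zero h3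
  have h4 : h1.quotientReduce (Ideal.Quotient.mk J ((1 : B) ⊗ₜ[k] c)) = 0 := by
    rw [show Ideal.Quotient.mk J ((1 : B) ⊗ₜ[k] c) = _ from hy 0, map_sum]
    refine Finset.sum_eq_zero fun j _ => ?_
    have hj : t * a 0 j = 0 := by simpa using ha j
    -- a unit cannot annihilate `t`
    have hz : ε.comp φ (a 0 j) = 0 := by
      by_contra hne
      have h5 : (a 0 j - algebraMap k B (ε.comp φ (a 0 j))) * t = 0 :=
        h.annihilated _ (by rw [RingHom.mem_ker, map_sub, AlgHom.commutes]; exact sub_self _)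
      rw [sub_mul, mul_comm, hj, zero_sub, neg_eq_zero, ← Algebra.smul_def] at h5
      exact h.ne_zero ((smul_eq_zero.mp h5).resolve_left hne)
    rw [h1.quotientReduce_smul, hz, zero_smul]
  have h5 : reduce R (ε.comp φ) ((1 : B) ⊗ₜ[k] c) ∈ I := Ideal.Quotient.eq_zero_iff_mem.mp h4
  simpa using h5

/-- The converse of `mem_of_tmul_mem`: an ideal lifting `J₀` is flat if `t c ∈ J` only for `c ∈ I`.
A `k`-basis of `R / I` gives a basis of `(A ⊗ R) / J₀` over `A`, and the condition on `t` makes it a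
basis of `(B ⊗ R) / J` over `B`. -/
theorem of_mem_of_tmul_mem [IsLocalRing A] (h₀ : IsDeformation ε I J₀)
    (hb : J.map (base R φ) = J₀) (ht : ∀ c : R, t ⊗ₜ[k] c ∈ J → c ∈ I) : IsLift φ J₀ J where
  flat := by
    have := h₀.flat
    let b := Module.Basis.ofVectorSpace k (R ⧸ I)
    choose σ hσ using fun i => Ideal.Quotient.mk_surjective (b i)
    let v₀ := fun i => Ideal.Quotient.mk J₀ ((1 : A) ⊗ₜ[k] σ i)
    let v := fun i => Ideal.Quotient.mk J ((1 : B) ⊗ₜ[k] σ i)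
    have hv₀ : h₀.quotientReduce.toAddMonoidHom ∘ v₀ = b := by
      funext i
      rw [← hσ]
      have e : h₀.quotientReduce (v₀ i) =
        Ideal.Quotient.mk I (reduce R ε ((1 : A) ⊗ₜ[k] σ i)) := rfl
      simpa using e
    have hli₀ := linearIndependent_of_reduction ε h₀.quotientReduce.toAddMonoidHom
      h₀.quotientReduce_smul v₀ (hv₀ ▸ b.linearIndependent)
    have hsp₀ := span_eq_top_of_reduction ε h₀.quotientReduce.toAddMonoidHom
      h₀.quotientReduce_smul h.isNilpotent h₀.mem_smul_of_quotientReduce_eq_zero v₀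
      (hv₀ ▸ b.span_eq)
    have htm : ∀ c ∈ I, t ⊗ₜ[k] c ∈ J := by
      intro c hc
      obtain ⟨G, hG, rfl⟩ := h₀.exists_reduce_eq hc
      rw [← hb, Ideal.mem_map_iff_of_surjective _ (base_surjective h.surjective)] at hG
      obtain ⟨F, hF, rfl⟩ := hG
      rw [reduce_base, ← h.smul_eq, Algebra.smul_def]
      exact Ideal.mul_mem_left _ _ hF
    have hbJ : ∀ F ∈ J, base R φ F ∈ J₀ := fun F hF => hb ▸ Ideal.mem_map_of_mem _ hF
    have hli : LinearIndependent B v := by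
      rw [linearIndependent_iff'] at hli₀ ⊢
      intro s c hc i hi
      have h1 : ∑ i ∈ s, c i • ((1 : B) ⊗ₜ[k] σ i) ∈ J := by
        rw [← Ideal.Quotient.eq_zero_iff_mem, map_sum]
        exact hc
      -- over `A` the relation is trivial, so its coefficients are multiples `d i • t`
      have h2 : ∀ i ∈ s, φ (c i) = 0 := by
        refine hli₀ s (fun i => φ (c i)) ?_
        have h3 := hbJ _ h1
        rw [map_sum] at h3
        simp only [base_smul, base_tmul, map_one] at h3
        rw [← Ideal.Quotient.eq_zero_iff_mem, map_sum] at h3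
        exact h3
      have h4 : ∀ i, ∃ d : k, i ∈ s → c i = d • t := by
        intro i
        by_cases hi : i ∈ s
        · have h5 : c i ∈ RingHom.ker φ := h2 i hi
          rw [h.ker, Ideal.mem_span_singleton'] at h5
          obtain ⟨d, hd⟩ := h5
          refine ⟨ε.comp φ d, fun _ => ?_⟩
          have h6 := h.annihilated (d - algebraMap k B (ε.comp φ d))
            (by rw [RingHom.mem_ker, map_sub, AlgHom.commutes]; exact sub_self _)
          rw [sub_mul, sub_eq_zero, ← Algebra.smul_def, hd] at h6
          exact h6
        · exact ⟨0, fun hi' => absurd hi' hi⟩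
      choose d hd using h4
      have h7 : ∑ i ∈ s, c i • ((1 : B) ⊗ₜ[k] σ i) = t ⊗ₜ[k] (∑ i ∈ s, d i • σ i) := by
        rw [TensorProduct.tmul_sum]
        refine Finset.sum_congr rfl fun i hi => ?_
        rw [hd i hi, TensorProduct.smul_tmul', smul_eq_mul, mul_one, TensorProduct.smul_tmul]
      rw [h7] at h1
      -- by hypothesis `∑ d i • σ i ∈ I`, which is a relation in the basis of `R / I`
      have h8 : ∑ i ∈ s, d i • b i = 0 := by
        have := Ideal.Quotient.eq_zero_iff_mem.mpr (ht _ h1)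
        rw [map_sum] at this
        rw [← this]
        refine Finset.sum_congr rfl fun i _ => ?_
        rw [← hσ]
        rfl
      rw [hd i hi, linearIndependent_iff'.mp b.linearIndependent s d h8 i hi, zero_smul]
    have hsp : ⊤ ≤ Submodule.span B (Set.range v) := by
      intro x _
      obtain ⟨x, rfl⟩ := Ideal.Quotient.mk_surjective x
      have key : ∀ y ∈ Submodule.span A (Set.range v₀), ∃ z : B ⊗[k] R,
          Ideal.Quotient.mk J z ∈ Submodule.span B (Set.range v) ∧
            Ideal.Quotient.mk J₀ (base R φ z) = y := by
        intro y hy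
        induction hy using Submodule.span_induction with
        | mem y hy =>
          obtain ⟨i, rfl⟩ := hy
          exact ⟨1 ⊗ₜ σ i, Submodule.subset_span ⟨i, rfl⟩, by simp [v₀]⟩
        | zero => exact ⟨0, by simp, by simp⟩
        | add y y' _ _ h h' =>
          obtain ⟨z, hz, rfl⟩ := h
          obtain ⟨z', hz', rfl⟩ := h'
          exact ⟨z + z', by rw [map_add]; exact add_mem hz hz', by simp⟩
        | smul a y _ h' =>
          obtain ⟨z, hz, rfl⟩ := h'
          obtain ⟨b, rfl⟩ := h.surjective a
          refine ⟨b • z, Submodule.smul_mem _ b hz, ?_⟩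
          rw [base_smul]
          rfl
      -- `z` is a combination of the `σ i` which agrees with `x` over `A`, so `x = z - F - t c`
      obtain ⟨z, hz, hzx⟩ := key (Ideal.Quotient.mk J₀ (base R φ x)) (hsp₀ ▸ trivial)
      rw [Ideal.Quotient.eq, ← hb, ← map_sub,
        Ideal.mem_map_iff_of_surjective _ (base_surjective h.surjective)] at hzx
      obtain ⟨F, hF, e⟩ := hzx
      obtain ⟨c, hc⟩ := h.exists_tmul (x := z - x - F) (by rw [map_sub, e, sub_self])
      -- the class of `t c` modulo `J` depends only on the class of `c` in `R / I`, which is a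
      -- combination of the basis
      have hc' : ∀ w ∈ Submodule.span k (Set.range b), ∀ c : R, Ideal.Quotient.mk I c = w →
          Ideal.Quotient.mk J (t ⊗ₜ[k] c) ∈ Submodule.span B (Set.range v) := by
        have hwd : ∀ c c' : R, Ideal.Quotient.mk I c = Ideal.Quotient.mk I c' →
            Ideal.Quotient.mk J (t ⊗ₜ[k] c) = Ideal.Quotient.mk J (t ⊗ₜ[k] c') := by
          intro c c' hcc
          rw [Ideal.Quotient.eq, ← TensorProduct.tmul_sub]
          exact htm _ (Ideal.Quotient.eq.mp hcc)
        intro w hw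
        induction hw using Submodule.span_induction with
        | mem w hw =>
          obtain ⟨i, rfl⟩ := hw
          intro c hc
          rw [hwd c (σ i) (hc.trans (hσ i).symm)]
          have : t ⊗ₜ[k] σ i = t • ((1 : B) ⊗ₜ[k] σ i) := by
            rw [TensorProduct.smul_tmul', smul_eq_mul, mul_one]
          rw [this]
          have hv : v i ∈ Submodule.span B (Set.range v) := Submodule.subset_span ⟨i, rfl⟩
          exact Submodule.smul_mem _ t hv
        | zero =>
          intro c hc
          rw [hwd c 0 (hc.trans (map_zero _).symm), TensorProduct.tmul_zero, map_zero]
          exact zero_mem _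
        | add w w' _ _ h h' =>
          intro c hc
          obtain ⟨d, rfl⟩ := Ideal.Quotient.mk_surjective w
          obtain ⟨d', rfl⟩ := Ideal.Quotient.mk_surjective w'
          rw [hwd c (d + d') (hc.trans (map_add _ _ _).symm), TensorProduct.tmul_add, map_add]
          exact add_mem (h d rfl) (h' d' rfl)
        | smul a w _ h =>
          intro c hc
          obtain ⟨d, rfl⟩ := Ideal.Quotient.mk_surjective w
          rw [hwd c (a • d) (hc.trans rfl), ← TensorProduct.smul_tmul, ← algebraMap_smul B a t,
            ← TensorProduct.smul_tmul']
          exact Submodule.smul_mem _ _ (h d rfl)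
      have e : Ideal.Quotient.mk J x =
          Ideal.Quotient.mk J z - Ideal.Quotient.mk J (t ⊗ₜ[k] c) := by
        rw [← map_sub, Ideal.Quotient.eq, ← hc]
        convert! neg_mem hF using 1
        abel
      rw [e]
      exact sub_mem hz (hc' _ (b.span_eq ▸ trivial) c rfl)
    have := Module.Free.of_basis (Module.Basis.mk hli hsp)
    infer_instance
  map_base := hb

/-- A lifting contained in another one is equal to it. -/
theorem eq_of_le (h₀ : IsDeformation ε I J₀) (hJ : IsLift φ J₀ J) (hJ' : IsLift φ J₀ J')
    (hle : J ≤ J') : J = J' := by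
  refine le_antisymm hle fun F hF => ?_
  obtain ⟨F', hF', c, rfl⟩ := hJ.exists_eq_add h (hJ'.base_mem hF)
  have h1 : t ⊗ₜ[k] c ∈ J' := by simpa using sub_mem hF (hle hF')
  exact add_mem hF' (hJ.tmul_mem h h₀ (hJ'.mem_of_tmul_mem h h₀ h1))

end IsLift

end Lift

end FlatLift
end

/-! ### Poisson brackets and the comparison of liftings -/

noncomputable section

namespace FlatLift

section Bracket

variable {k : Type u} [Field k] {R : Type u} [CommRing R] [Algebra k R]
  {A B : Type u} [CommRing A] [Algebra k A] [CommRing B] [Algebra k B]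

/-- The axioms of a Poisson bracket on a `k`-algebra. -/
structure IsPoissonBracket (β : R →ₗ[k] R →ₗ[k] R) : Prop where
  self (a : R) : β a a = 0
  leibniz (a b c : R) : β a (b * c) = b * β a c + c * β a b
  jacobi (a b c : R) : β a (β b c) = β (β a b) c + β b (β a c)

theorem IsPoissonBracket.skew {β : R →ₗ[k] R →ₗ[k] R} (hβ : IsPoissonBracket β) (a b : R) :
    β a b = -β b a := by
  have h := hβ.self (a + b)
  simp only [map_add, LinearMap.add_apply, hβ.self, zero_add, add_zero] at h
  exact eq_neg_of_add_eq_zero_right h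

/-- The derivation `{-, a}` of `B ⊗ R`, for an element `a` of `R`. -/
def bracketWith (B : Type u) [CommRing B] [Algebra k B] (β : R →ₗ[k] R →ₗ[k] R) (a : R) :
    B ⊗[k] R →ₗ[B] B ⊗[k] R :=
  (LinearMap.BilinMap.baseChange B β).flip (1 ⊗ₜ a)

variable {β : R →ₗ[k] R →ₗ[k] R}

@[simp]
theorem bracketWith_tmul (a r : R) (b : B) : bracketWith B β a (b ⊗ₜ r) = b ⊗ₜ β r a := by
  simp [bracketWith]

theorem bracketWith_add (a a' : R) (F : B ⊗[k] R) :
    bracketWith B β (a + a') F = bracketWith B β a F + bracketWith B β a' F := by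
  simp [bracketWith, TensorProduct.tmul_add]

theorem bracketWith_smul (r : k) (a : R) (F : B ⊗[k] R) :
    bracketWith B β (r • a) F = r • bracketWith B β a F := by
  induction F with
  | zero => simp
  | tmul b x => simp
  | add x y hx hy => simp [hx, hy]

theorem bracketWith_mul (hβ : IsPoissonBracket β) (a a' : R) (F : B ⊗[k] R) :
    bracketWith B β (a * a') F =
      1 ⊗ₜ a * bracketWith B β a' F + 1 ⊗ₜ a' * bracketWith B β a F := by
  induction F with
  | zero => simp
  | tmul b x => simp [hβ.leibniz, TensorProduct.tmul_add]
  | add x y hx hy => rw [map_add, hx, hy, map_add, map_add]; ring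

theorem bracketWith_mul_right (hβ : IsPoissonBracket β) (a r : R) (F : B ⊗[k] R) :
    bracketWith B β a (1 ⊗ₜ r * F) =
      1 ⊗ₜ r * bracketWith B β a F + 1 ⊗ₜ β r a * F := by
  induction F with
  | zero => simp
  | tmul b x =>
    rw [Algebra.TensorProduct.tmul_mul_tmul, one_mul, bracketWith_tmul, bracketWith_tmul,
      Algebra.TensorProduct.tmul_mul_tmul, Algebra.TensorProduct.tmul_mul_tmul, one_mul,
      ← TensorProduct.tmul_add, hβ.skew (r * x), hβ.leibniz, hβ.skew r a, hβ.skew x a]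
    congr 1
    ring
  | add x y hx hy => rw [mul_add, map_add, hx, hy, map_add]; ring

/-- The Jacobi identity for two elements of `R` and one of `B ⊗ R`. -/
theorem bracketWith_bracket (hβ : IsPoissonBracket β) (a b : R) (F : B ⊗[k] R) :
    bracketWith B β (β a b) F =
      bracketWith B β b (bracketWith B β a F) - bracketWith B β a (bracketWith B β b F) := by
  induction F with
  | zero => simp
  | tmul c x =>
    simp only [bracketWith_tmul]
    rw [← TensorProduct.tmul_sub, hβ.jacobi x a b, hβ.skew a (β x b), sub_eq_add_neg]
  | add x y hx hy => simp only [map_add, hx, hy]; abel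

theorem reduce_bracketWith (ε : B →ₐ[k] k) (a : R) (F : B ⊗[k] R) :
    reduce R ε (bracketWith B β a F) = β (reduce R ε F) a := by
  induction F with
  | zero => simp
  | tmul b x => simp
  | add x y hx hy => simp [hx, hy]

theorem base_bracketWith (φ : B →ₐ[k] A) (a : R) (F : B ⊗[k] R) :
    base R φ (bracketWith B β a F) = bracketWith A β a (base R φ F) := by
  induction F with
  | zero => simp
  | tmul b x => simp
  | add x y hx hy => simp [hx, hy]

/-- Stability under all brackets amounts to stability under brackets with elements of `R`. -/
theorem baseChange_mem_iff (hβ : IsPoissonBracket β) (J : Ideal (B ⊗[k] R)) :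
    (∀ F H, F ∈ J → LinearMap.BilinMap.baseChange B β H F ∈ J) ↔
      ∀ a, ∀ F ∈ J, bracketWith B β a F ∈ J := by
  have e : ∀ a (F : B ⊗[k] R),
      LinearMap.BilinMap.baseChange B β (1 ⊗ₜ a) F = - bracketWith B β a F := by
    intro a F
    induction F with
    | zero => simp
    | tmul b x =>
      rw [bracketWith_tmul, LinearMap.BilinMap.baseChange_tmul, one_mul, hβ.skew a x,
        TensorProduct.tmul_neg]
    | add x y hx hy => rw [map_add, map_add, hx, hy]; abel
  constructor
  · intro h a F hF
    rw [← neg_mem_iff, ← e]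
    exact h F _ hF
  · intro h F H hF
    induction H with
    | zero => simp
    | tmul b x =>
      have : (b ⊗ₜ[k] x : B ⊗[k] R) = b • ((1 : B) ⊗ₜ x) := by
        rw [TensorProduct.smul_tmul', smul_eq_mul, mul_one]
      rw [this, map_smul, LinearMap.smul_apply, e, Algebra.smul_def]
      exact Ideal.mul_mem_left _ _ (neg_mem (h x F hF))
    | add x y hx hy =>
      rw [map_add, LinearMap.add_apply]
      exact add_mem hx hy

end Bracket

section Comparison

variable {k : Type u} [Field k] {R : Type u} [CommRing R] [Algebra k R]
  {A B : Type u} [CommRing A] [Algebra k A] [CommRing B] [Algebra k B]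

/-- `ψ` measures the difference of the liftings `J` and `J'`: if `F ∈ J` reduces to `f` and
`F = F' + t c` with `F' ∈ J'`, then `ψ f` is the class of `c`. -/
def IsDifference (ε : B →ₐ[k] k) (t : B) {I : Ideal R} (J J' : Ideal (B ⊗[k] R))
    (ψ : I → R ⧸ I) : Prop :=
  ∀ (f : I) (F F' : B ⊗[k] R) (c : R), F ∈ J → F' ∈ J' → reduce R ε F = f →
    F = F' + t ⊗ₜ c → ψ f = Ideal.Quotient.mk I c

/-- `G` measures the failure of `J` to be Poisson: if `F ∈ J` reduces to `f` and
`{F, a} = K + t c` with `K ∈ J`, then `G f a` is the class of `c`. -/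
def IsDefect (β : R →ₗ[k] R →ₗ[k] R) (ε : B →ₐ[k] k) (t : B) {I : Ideal R}
    (J : Ideal (B ⊗[k] R)) (G : I → R → R ⧸ I) : Prop :=
  ∀ (f : I) (F K : B ⊗[k] R) (a c : R), F ∈ J → K ∈ J → reduce R ε F = f →
    bracketWith B β a F = K + t ⊗ₜ c → G f a = Ideal.Quotient.mk I c

variable {ε : A →ₐ[k] k} {φ : B →ₐ[k] A} {t : B} {I : Ideal R} {J₀ : Ideal (A ⊗[k] R)}
  {J J' J'' : Ideal (B ⊗[k] R)} (h : IsSmall ε φ t) (h₀ : IsDeformation ε I J₀)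

include h h₀

omit h in
theorem IsLift.reduce_mem (hJ : IsLift φ J₀ J) {F : B ⊗[k] R} (hF : F ∈ J) :
    reduce R (ε.comp φ) F ∈ I :=
  (hJ.isDeformation h₀).reduce_mem hF

/-- Two liftings share their elements of reduction zero: these lie in `𝔪 J`, and `𝔪` annihilates the
multiples of `t` by which elements of `J` differ from elements of `J'`. -/
theorem IsLift.mem_of_reduce_eq_zero (hJ : IsLift φ J₀ J) (hJ' : IsLift φ J₀ J')
    {F : B ⊗[k] R} (hF : F ∈ J) (hr : reduce R (ε.comp φ) F = 0) : F ∈ J' := by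
  refine Submodule.smul_induction_on (p := fun F => F ∈ J')
    ((hJ.isDeformation h₀).mem_smul_of_reduce_eq_zero hF hr) ?_ fun x y hx hy => add_mem hx hy
  intro m hm G hG
  obtain ⟨G', hG', d, rfl⟩ := hJ'.exists_eq_add h (hJ.base_mem hG)
  rw [smul_add, TensorProduct.smul_tmul', smul_eq_mul, h.annihilated m hm,
    TensorProduct.zero_tmul, add_zero, Algebra.smul_def]
  exact Ideal.mul_mem_left _ _ hG'

/-- The class of `c` in `F = F' + t c` depends only on the reduction of `F`. -/
theorem IsLift.mem_of_eq_add (hJ : IsLift φ J₀ J) (hJ' : IsLift φ J₀ J') {F F' : B ⊗[k] R}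
    {c : R} (hF : F ∈ J) (hF' : F' ∈ J') (hr : reduce R (ε.comp φ) F = 0)
    (e : F = F' + t ⊗ₜ c) : c ∈ I := by
  refine hJ'.mem_of_tmul_mem h h₀ ?_
  have : t ⊗ₜ c = F - F' := by rw [e]; abel
  rw [this]
  exact sub_mem (hJ.mem_of_reduce_eq_zero h h₀ hJ' hF hr) hF'

/-- Every element of `I` lifts to `J`, and there it differs from an element of `J'` by a multiple of
`t`. -/
theorem IsLift.exists_lifts (hJ : IsLift φ J₀ J) (hJ' : IsLift φ J₀ J') (f : I) :
    ∃ F ∈ J, ∃ F' ∈ J', ∃ c : R, reduce R (ε.comp φ) F = f ∧ F = F' + t ⊗ₜ c := by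
  obtain ⟨F, hF, e⟩ := (hJ.isDeformation h₀).exists_reduce_eq f.2
  obtain ⟨F', hF', c, hc⟩ := hJ'.exists_eq_add h (hJ.base_mem hF)
  exact ⟨F, hF, F', hF', c, e, hc⟩

theorem exists_isDifference (hJ : IsLift φ J₀ J) (hJ' : IsLift φ J₀ J') :
    ∃ ψ : I → R ⧸ I, IsDifference (ε.comp φ) t J J' ψ := by
  choose F hF F' hF' c hr e using hJ.exists_lifts h h₀ hJ'
  refine ⟨fun f => Ideal.Quotient.mk I (c f), fun f G G' d hG hG' hGr hGe => ?_⟩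
  rw [Ideal.Quotient.eq]
  refine hJ.mem_of_eq_add h h₀ hJ' (sub_mem (hF f) hG) (sub_mem (hF' f) hG')
    (by rw [map_sub, hr, hGr, sub_self]) ?_
  rw [e, hGe, TensorProduct.tmul_sub]
  abel

namespace IsDifference

variable {ψ ψ' : I → R ⧸ I} (hψ : IsDifference (ε.comp φ) t J J' ψ)
include hψ

theorem map_add (hJ : IsLift φ J₀ J) (hJ' : IsLift φ J₀ J') (f g : I) :
    ψ (f + g) = ψ f + ψ g := by
  obtain ⟨F, hF, F', hF', c, hr, e⟩ := hJ.exists_lifts h h₀ hJ' f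
  obtain ⟨G, hG, G', hG', d, hs, e'⟩ := hJ.exists_lifts h h₀ hJ' g
  rw [hψ f F F' c hF hF' hr e, hψ g G G' d hG hG' hs e', ← _root_.map_add]
  refine hψ _ (F + G) (F' + G') _ (add_mem hF hG) (add_mem hF' hG') ?_ ?_
  · rw [_root_.map_add, hr, hs]; rfl
  · rw [e, e', TensorProduct.tmul_add]; abel

theorem map_smul (hJ : IsLift φ J₀ J) (hJ' : IsLift φ J₀ J') (r : R) (f : I) :
    ψ (r • f) = r • ψ f := by
  obtain ⟨F, hF, F', hF', c, hr, e⟩ := hJ.exists_lifts h h₀ hJ' f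
  rw [hψ f F F' c hF hF' hr e]
  refine hψ _ (1 ⊗ₜ r * F) (1 ⊗ₜ r * F') (r * c) (Ideal.mul_mem_left _ _ hF)
    (Ideal.mul_mem_left _ _ hF') ?_ ?_
  · rw [map_mul, reduce_tmul, map_one, one_smul, hr]; rfl
  · rw [e, mul_add, Algebra.TensorProduct.tmul_mul_tmul, one_mul]

theorem unique (hJ : IsLift φ J₀ J) (hJ' : IsLift φ J₀ J')
    (hψ' : IsDifference (ε.comp φ) t J J' ψ') : ψ = ψ' := by
  funext f
  obtain ⟨F, hF, F', hF', c, hr, e⟩ := hJ.exists_lifts h h₀ hJ' f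
  rw [hψ f F F' c hF hF' hr e, hψ' f F F' c hF hF' hr e]

omit h₀ in
theorem trans (hJ : IsLift φ J₀ J) (hJ' : IsLift φ J₀ J')
    (hψ' : IsDifference (ε.comp φ) t J' J'' ψ') :
    IsDifference (ε.comp φ) t J J'' (ψ + ψ') := by
  intro f F F'' c hF hF'' hr e
  obtain ⟨F', hF', d, e'⟩ := hJ'.exists_eq_add h (hJ.base_mem hF)
  have hr' : reduce R (ε.comp φ) F' = f := by
    rw [← hr, e', _root_.map_add, h.reduce_tmul, add_zero]
  rw [Pi.add_apply, hψ f F F' d hF hF' hr e', hψ' f F' F'' (c - d) hF' hF'' hr' ?_,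
    ← _root_.map_add]
  · congr 1; ring
  · rw [TensorProduct.tmul_sub, eq_sub_of_add_eq e'.symm, e]
    abel

/-- Liftings of difference zero are equal. -/
theorem eq_of_eq_zero (hJ : IsLift φ J₀ J) (hJ' : IsLift φ J₀ J') (h0 : ∀ f, ψ f = 0) :
    J = J' := by
  refine IsLift.eq_of_le h h₀ hJ hJ' fun F hF => ?_
  obtain ⟨F', hF', c, e⟩ := hJ'.exists_eq_add h (hJ.base_mem hF)
  have := hψ ⟨_, hJ.reduce_mem h₀ hF⟩ F F' c hF hF' rfl e
  rw [h0, eq_comm, Ideal.Quotient.eq_zero_iff_mem] at this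
  rw [e]
  exact add_mem hF' (hJ'.tmul_mem h h₀ this)

end IsDifference

theorem isDifference_self (hJ : IsLift φ J₀ J) :
    IsDifference (ε.comp φ) t J J (fun _ : I => 0) := by
  intro f F F' c hF hF' _ e
  refine (Ideal.Quotient.eq_zero_iff_mem.mpr (hJ.mem_of_tmul_mem h h₀ ?_)).symm
  have : t ⊗ₜ c = F - F' := by rw [e]; abel
  rw [this]
  exact sub_mem hF hF'

section Defect

variable {β : R →ₗ[k] R →ₗ[k] R} (hβ : IsPoissonBracket β)
  (hP : ∀ a, ∀ F ∈ J₀, bracketWith A β a F ∈ J₀)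
include hP

omit h₀ in
theorem IsLift.exists_bracketWith (hJ : IsLift φ J₀ J) (a : R) {F : B ⊗[k] R} (hF : F ∈ J) :
    ∃ K ∈ J, ∃ c : R, bracketWith B β a F = K + t ⊗ₜ c :=
  hJ.exists_eq_add h (by rw [base_bracketWith]; exact hP a _ (hJ.base_mem hF))

theorem IsLift.exists_bracket_lifts (hJ : IsLift φ J₀ J) (f : I) (a : R) :
    ∃ F ∈ J, ∃ K ∈ J, ∃ c : R, reduce R (ε.comp φ) F = f ∧
      bracketWith B β a F = K + t ⊗ₜ c := by
  obtain ⟨F, hF, e⟩ := (hJ.isDeformation h₀).exists_reduce_eq f.2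
  obtain ⟨K, hK, c, hc⟩ := hJ.exists_bracketWith h hP a hF
  exact ⟨F, hF, K, hK, c, e, hc⟩

/-- The class of `c` in `{F, a} = K + t c` depends only on the reduction of `F`. -/
theorem IsLift.bracketWith_mem_of_reduce_eq_zero (hJ : IsLift φ J₀ J) (a : R) {F : B ⊗[k] R}
    (hF : F ∈ J) (hr : reduce R (ε.comp φ) F = 0) : bracketWith B β a F ∈ J := by
  refine Submodule.smul_induction_on (p := fun F => bracketWith B β a F ∈ J)
    ((hJ.isDeformation h₀).mem_smul_of_reduce_eq_zero hF hr) ?_ ?_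
  · intro m hm G hG
    obtain ⟨K, hK, d, e⟩ := hJ.exists_bracketWith h hP a hG
    rw [_root_.map_smul, e, smul_add, TensorProduct.smul_tmul', smul_eq_mul, h.annihilated m hm,
      TensorProduct.zero_tmul, add_zero, Algebra.smul_def]
    exact Ideal.mul_mem_left _ _ hK
  · intro x y hx hy
    rw [_root_.map_add]
    exact add_mem hx hy

theorem exists_isDefect (hJ : IsLift φ J₀ J) :
    ∃ G : I → R → R ⧸ I, IsDefect β (ε.comp φ) t J G := by
  choose F hF K hK c hr e using fun (f : I) (a : R) => hJ.exists_bracket_lifts h h₀ hP f a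
  refine ⟨fun f a => Ideal.Quotient.mk I (c f a), fun f F' K' a d hF' hK' hr' e' => ?_⟩
  rw [Ideal.Quotient.eq]
  refine hJ.mem_of_tmul_mem h h₀ ?_
  have h1 := hJ.bracketWith_mem_of_reduce_eq_zero h h₀ hP a (sub_mem (hF f a) hF')
    (by rw [map_sub, hr, hr', sub_self])
  have h2 : t ⊗ₜ[k] (c f a - d) =
      bracketWith B β a (F f a - F') - (K f a - K') := by
    rw [map_sub, e, e', TensorProduct.tmul_sub]; abel
  rw [h2]
  exact sub_mem h1 (sub_mem (hK f a) hK')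

namespace IsDefect

variable {G G' : I → R → R ⧸ I} (hG : IsDefect β (ε.comp φ) t J G)
include hG

theorem unique (hJ : IsLift φ J₀ J) (hG' : IsDefect β (ε.comp φ) t J G') : G = G' := by
  funext f a
  obtain ⟨F, hF, K, hK, c, hr, e⟩ := hJ.exists_bracket_lifts h h₀ hP f a
  rw [hG f F K a c hF hK hr e, hG' f F K a c hF hK hr e]

theorem map_add (hJ : IsLift φ J₀ J) (f g : I) (a : R) : G (f + g) a = G f a + G g a := by
  obtain ⟨F, hF, K, hK, c, hr, e⟩ := hJ.exists_bracket_lifts h h₀ hP f a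
  obtain ⟨F', hF', K', hK', c', hr', e'⟩ := hJ.exists_bracket_lifts h h₀ hP g a
  rw [hG f F K a c hF hK hr e, hG g F' K' a c' hF' hK' hr' e', ← _root_.map_add]
  refine hG _ (F + F') (K + K') a _ (add_mem hF hF') (add_mem hK hK') ?_ ?_
  · rw [_root_.map_add, hr, hr']; rfl
  · rw [_root_.map_add, e, e', TensorProduct.tmul_add]; abel

include hβ in
theorem map_smul (hJ : IsLift φ J₀ J) (r : R) (f : I) (a : R) : G (r • f) a = r • G f a := by
  obtain ⟨F, hF, K, hK, c, hr, e⟩ := hJ.exists_bracket_lifts h h₀ hP f a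
  rw [hG f F K a c hF hK hr e]
  -- `{r F, a} = r {F, a} + {r, a} F`, and the second term lies in `J`
  refine hG _ (1 ⊗ₜ r * F) (1 ⊗ₜ r * K + 1 ⊗ₜ β r a * F) a (r * c) (Ideal.mul_mem_left _ _ hF)
    (add_mem (Ideal.mul_mem_left _ _ hK) (Ideal.mul_mem_left _ _ hF)) ?_ ?_
  · rw [map_mul, reduce_tmul, map_one, one_smul, hr]; rfl
  · rw [bracketWith_mul_right hβ, e, mul_add, Algebra.TensorProduct.tmul_mul_tmul, one_mul]; abel

theorem add_right (hJ : IsLift φ J₀ J) (f : I) (a b : R) : G f (a + b) = G f a + G f b := by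
  obtain ⟨F, hF, hr⟩ := (hJ.isDeformation h₀).exists_reduce_eq f.2
  obtain ⟨K, hK, c, e⟩ := hJ.exists_bracketWith h hP a hF
  obtain ⟨L, hL, d, e'⟩ := hJ.exists_bracketWith h hP b hF
  rw [hG f F K a c hF hK hr e, hG f F L b d hF hL hr e', ← _root_.map_add]
  refine hG _ F (K + L) _ _ hF (add_mem hK hL) hr ?_
  rw [bracketWith_add, e, e', TensorProduct.tmul_add]; abel

theorem smul_right (hJ : IsLift φ J₀ J) (f : I) (r : k) (a : R) : G f (r • a) = r • G f a := by
  obtain ⟨F, hF, hr⟩ := (hJ.isDeformation h₀).exists_reduce_eq f.2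
  obtain ⟨K, hK, c, e⟩ := hJ.exists_bracketWith h hP a hF
  rw [hG f F K a c hF hK hr e]
  refine hG _ F (r • K) _ (r • c) hF (J.smul_of_tower_mem r hK) hr ?_
  rw [bracketWith_smul, e, smul_add, TensorProduct.tmul_smul]

include hβ in
theorem mul_right (hJ : IsLift φ J₀ J) (f : I) (a b : R) :
    G f (a * b) = a • G f b + b • G f a := by
  obtain ⟨F, hF, hr⟩ := (hJ.isDeformation h₀).exists_reduce_eq f.2
  obtain ⟨K, hK, c, e⟩ := hJ.exists_bracketWith h hP a hF
  obtain ⟨L, hL, d, e'⟩ := hJ.exists_bracketWith h hP b hF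
  rw [hG f F K a c hF hK hr e, hG f F L b d hF hL hr e']
  refine hG _ F (1 ⊗ₜ a * L + 1 ⊗ₜ b * K) _ (a * d + b * c) hF
    (add_mem (Ideal.mul_mem_left _ _ hL) (Ideal.mul_mem_left _ _ hK)) hr ?_
  rw [bracketWith_mul hβ, e, e', TensorProduct.tmul_add, mul_add, mul_add,
    Algebra.TensorProduct.tmul_mul_tmul, Algebra.TensorProduct.tmul_mul_tmul, one_mul]
  abel

include hβ in
/-- The equation `∇ G = 0`: the Jacobi identity applied to a lifting of `f`. The operators
`{a, -}` on `R / I` enter through representatives `c` and `d` of the values of `G`. -/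
theorem bracket_right (hI : ∀ (a : R), ∀ f ∈ I, β a f ∈ I) (hJ : IsLift φ J₀ J) (f : I)
    (a b c d : R) (hc : G f a = Ideal.Quotient.mk I c) (hd : G f b = Ideal.Quotient.mk I d) :
    (Ideal.Quotient.mk I (β a d) - G ⟨β a f, hI a f f.2⟩ b)
      - (Ideal.Quotient.mk I (β b c) - G ⟨β b f, hI b f f.2⟩ a) - G f (β a b) = 0 := by
  obtain ⟨F, hF, hr⟩ := (hJ.isDeformation h₀).exists_reduce_eq f.2
  -- since `{F, a} = K + t c` reduces to `{f, a}`, the element `-K` of `J` lifts `{a, f}`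
  have key : ∀ (a b : R), ∃ K ∈ J, ∃ c, G f a = Ideal.Quotient.mk I c ∧
      bracketWith B β a F = K + t ⊗ₜ c ∧ ∃ L ∈ J, ∃ e,
      bracketWith B β b K = L + t ⊗ₜ e ∧ G ⟨β a f, hI a f f.2⟩ b = - Ideal.Quotient.mk I e := by
    intro a b
    obtain ⟨K, hK, c, e⟩ := hJ.exists_bracketWith h hP a hF
    obtain ⟨L, hL, d, e'⟩ := hJ.exists_bracketWith h hP b hK
    refine ⟨K, hK, c, hG f F K a c hF hK hr e, e, L, hL, d, e', ?_⟩
    rw [← map_neg]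
    refine hG _ (-K) (-L) b (-d) (neg_mem hK) (neg_mem hL) ?_ ?_
    · have h1 := congrArg (reduce R (ε.comp φ)) e
      rw [reduce_bracketWith, _root_.map_add, h.reduce_tmul, add_zero, hr] at h1
      rw [map_neg, ← h1]
      exact (hβ.skew a f).symm
    · rw [map_neg, e', TensorProduct.tmul_neg]; abel
  obtain ⟨K, hK, c', hc', e, L, hL, x, hx, hGx⟩ := key a b
  obtain ⟨K', hK', d', hd', e', L', hL', x', hx', hGx'⟩ := key b a
  have h1 : G f (β a b) = Ideal.Quotient.mk I ((x + β c' b) - (x' + β d' a)) := by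
    refine hG f F (L - L') (β a b) _ hF (sub_mem hL hL') hr ?_
    rw [bracketWith_bracket hβ, e, e', _root_.map_add, _root_.map_add, hx, hx', bracketWith_tmul,
      bracketWith_tmul, TensorProduct.tmul_sub, TensorProduct.tmul_add, TensorProduct.tmul_add]
    abel
  have h2 : Ideal.Quotient.mk I (β a d) = Ideal.Quotient.mk I (β a d') := by
    rw [hd, Ideal.Quotient.eq] at hd'
    rw [Ideal.Quotient.eq, ← map_sub]
    exact hI a _ hd'
  have h3 : Ideal.Quotient.mk I (β b c) = Ideal.Quotient.mk I (β b c') := by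
    rw [hc, Ideal.Quotient.eq] at hc'
    rw [Ideal.Quotient.eq, ← map_sub]
    exact hI b _ hc'
  rw [h2, h3, hGx, hGx', h1, hβ.skew c' b, hβ.skew d' a]
  simp only [_root_.map_add, map_sub, map_neg]
  abel

/-- A lifting of defect zero is Poisson. -/
theorem bracketWith_mem (hJ : IsLift φ J₀ J) (h0 : ∀ f a, G f a = 0) (a : R) {F : B ⊗[k] R}
    (hF : F ∈ J) : bracketWith B β a F ∈ J := by
  obtain ⟨K, hK, c, e⟩ := hJ.exists_bracketWith h hP a hF
  have h1 := hG ⟨_, hJ.reduce_mem h₀ hF⟩ F K a c hF hK rfl e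
  rw [h0, eq_comm, Ideal.Quotient.eq_zero_iff_mem] at h1
  rw [e]
  exact add_mem hK (hJ.tmul_mem h h₀ h1)

end IsDefect

omit hP in
theorem isDefect_zero (hJ : IsLift φ J₀ J) (hPJ : ∀ a, ∀ F ∈ J, bracketWith B β a F ∈ J) :
    IsDefect β (ε.comp φ) t J (fun (_ : I) _ => 0) := by
  intro f F K a c hF hK _ e
  refine (Ideal.Quotient.eq_zero_iff_mem.mpr (hJ.mem_of_tmul_mem h h₀ ?_)).symm
  have : t ⊗ₜ c = bracketWith B β a F - K := by rw [e]; abel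
  rw [this]
  exact sub_mem (hPJ a F hF) hK

include hβ in
/-- `∇` of the difference of two liftings is the difference of their Poisson defects. -/
theorem IsDifference.nabla_eq (hI : ∀ (a : R), ∀ f ∈ I, β a f ∈ I) (hJ : IsLift φ J₀ J)
    (hJ' : IsLift φ J₀ J') {ψ : I → R ⧸ I} {G G' : I → R → R ⧸ I}
    (hψ : IsDifference (ε.comp φ) t J J' ψ) (hG : IsDefect β (ε.comp φ) t J G)
    (hG' : IsDefect β (ε.comp φ) t J' G') (f : I) (a c : R)
    (hc : ψ f = Ideal.Quotient.mk I c) :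
    Ideal.Quotient.mk I (β a c) - ψ ⟨β a f, hI a f f.2⟩ = G' f a - G f a := by
  obtain ⟨F, hF, F', hF', d, hr, e⟩ := hJ.exists_lifts h h₀ hJ' f
  have hr' : reduce R (ε.comp φ) F' = f := by
    rw [← hr, e, _root_.map_add, h.reduce_tmul, add_zero]
  obtain ⟨K, hK, x, hx⟩ := hJ.exists_bracketWith h hP a hF
  obtain ⟨K', hK', x', hx'⟩ := hJ'.exists_bracketWith h hP a hF'
  have h1 : ψ ⟨β a f, hI a f f.2⟩ = Ideal.Quotient.mk I (x - x' - β d a) := by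
    refine hψ _ (-K) (-K') _ (neg_mem hK) (neg_mem hK') ?_ ?_
    · have h1 := congrArg (reduce R (ε.comp φ)) hx
      rw [reduce_bracketWith, _root_.map_add, h.reduce_tmul, add_zero, hr] at h1
      rw [map_neg, ← h1]
      exact (hβ.skew a f).symm
    · have h2 := hx
      rw [e, _root_.map_add, hx', bracketWith_tmul] at h2
      have h3 : K = K' + t ⊗ₜ x' + t ⊗ₜ (β d) a - t ⊗ₜ x := eq_sub_of_add_eq h2.symm
      rw [h3, TensorProduct.tmul_sub, TensorProduct.tmul_sub]
      abel
  have h2 : Ideal.Quotient.mk I (β a c) = Ideal.Quotient.mk I (β a d) := by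
    have := hψ f F F' d hF hF' hr e
    rw [hc, Ideal.Quotient.eq] at this
    rw [Ideal.Quotient.eq, ← map_sub]
    exact hI a _ this
  rw [h1, h2, hG f F K a x hF hK hr hx, hG' f F' K' a x' hF' hK' hr' hx', hβ.skew d a]
  simp only [map_sub, map_neg]
  abel

end Defect

end Comparison

section Twist

variable {k : Type u} [Field k] {R : Type u} [CommRing R] [Algebra k R]
  {A B : Type u} [CommRing A] [Algebra k A] [CommRing B] [Algebra k B]
  {ε : A →ₐ[k] k} {φ : B →ₐ[k] A} {t : B} {I : Ideal R} {J₀ : Ideal (A ⊗[k] R)}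
  {J : Ideal (B ⊗[k] R)}

/-- The lifting `J` moved by a homomorphism `ψ : I → R / I`. It consists of the elements `F - t c`
where `F ∈ J` and `c` represents the value of `ψ` at the reduction of `F`. -/
def twist (h : IsSmall ε φ t) (J : Ideal (B ⊗[k] R)) (ψ : I →ₗ[R] R ⧸ I) :
    Ideal (B ⊗[k] R) where
  carrier := {F' | ∃ F ∈ J, ∃ (f : I) (c : R), reduce R (ε.comp φ) F = f ∧
    ψ f = Ideal.Quotient.mk I c ∧ F = F' + t ⊗ₜ c}
  zero_mem' := ⟨0, zero_mem _, 0, 0, by simp, by simp, by simp⟩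
  add_mem' := by
    rintro F' G' ⟨F, hF, f, c, hr, hc, e⟩ ⟨G, hG, g, d, hs, hd, e'⟩
    exact ⟨F + G, add_mem hF hG, f + g, c + d, by rw [map_add, hr, hs]; rfl,
      by rw [map_add, hc, hd, map_add], by rw [e, e', TensorProduct.tmul_add]; abel⟩
  smul_mem' := by
    rintro x F' ⟨F, hF, f, c, hr, hc, e⟩
    refine ⟨x * F, Ideal.mul_mem_left _ _ hF, reduce R (ε.comp φ) x • f,
      reduce R (ε.comp φ) x * c, by rw [map_mul, hr]; rfl, ?_, ?_⟩
    · rw [map_smul, hc]; rfl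
    · rw [e, mul_add, h.mul_tmul]; rfl

theorem isLift_twist [IsLocalRing A] (h : IsSmall ε φ t) (h₀ : IsDeformation ε I J₀)
    (hJ : IsLift φ J₀ J) (ψ : I →ₗ[R] R ⧸ I) : IsLift φ J₀ (twist h J ψ) := by
  refine IsLift.of_mem_of_tmul_mem h h₀ (le_antisymm ?_ ?_) ?_
  · rw [Ideal.map_le_iff_le_comap]
    rintro F' ⟨F, hF, f, c, hr, hc, e⟩
    have h1 := hJ.base_mem hF
    rwa [e, map_add, h.base_tmul, add_zero] at h1
  · rw [← hJ.map_base, Ideal.map_le_iff_le_comap]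
    intro F hF
    obtain ⟨c, hc⟩ := Ideal.Quotient.mk_surjective (ψ ⟨_, hJ.reduce_mem h₀ hF⟩)
    rw [Ideal.mem_comap]
    have : base R φ F = base R φ (F - t ⊗ₜ c) := by rw [map_sub, h.base_tmul, sub_zero]
    rw [this]
    exact Ideal.mem_map_of_mem _ ⟨F, hF, _, c, rfl, hc.symm, by abel⟩
  · rintro c ⟨F, hF, f, d, hr, hd, e⟩
    have hf : f = 0 := by
      rw [e, map_add, h.reduce_tmul, h.reduce_tmul, add_zero] at hr
      exact Subtype.ext hr.symm
    rw [hf, map_zero, eq_comm, Ideal.Quotient.eq_zero_iff_mem] at hd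
    rw [e, ← TensorProduct.tmul_add] at hF
    simpa using sub_mem (hJ.mem_of_tmul_mem h h₀ hF) hd

theorem isDifference_twist [IsLocalRing A] (h : IsSmall ε φ t) (h₀ : IsDeformation ε I J₀)
    (hJ : IsLift φ J₀ J) (ψ : I →ₗ[R] R ⧸ I) :
    IsDifference (ε.comp φ) t J (twist h J ψ) ψ := by
  rintro f G F' d hG ⟨F, hF, g, c, hr, hc, e⟩ hs e'
  have h1 : f = g := by
    apply Subtype.ext
    rw [← hs, ← hr, e, e', map_add, map_add, h.reduce_tmul, h.reduce_tmul]
  subst h1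
  rw [hc, Ideal.Quotient.eq]
  refine hJ.mem_of_eq_add h h₀ hJ (sub_mem hF hG) (zero_mem J)
    (by rw [map_sub, hr, hs, sub_self]) ?_
  rw [e, e', TensorProduct.tmul_sub]
  abel

end Twist

end FlatLift
end

/-! ### Functions and ideals on the product of an affine open with a spectrum -/

noncomputable section

theorem AlgebraicGeometry.Scheme.Hom.appTop_eq_appLE {X Y : Scheme.{u}} (f : X ⟶ Y) :
    f.appTop = f.appLE ⊤ ⊤ le_top := by
  rw [Scheme.Hom.appTop, Scheme.Hom.app_eq_appLE]
  rfl

theorem AlgebraicGeometry.Scheme.Hom.appTop_map_eq_appLE {X Y : Scheme.{u}} (f : X ⟶ Y)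
    (W : X.Opens) : f.appTop ≫ X.presheaf.map (homOfLE (le_top : W ≤ ⊤)).op =
      f.appLE ⊤ W le_top := rfl

theorem AlgebraicGeometry.Scheme.Hom.appTop_map_appLE {X Y Z : Scheme.{u}} (f : X ⟶ Y)
    (g : Z ⟶ X) (W : X.Opens) (V : Z.Opens) (e : V ≤ g ⁻¹ᵁ W) :
    (f.appTop ≫ X.presheaf.map (homOfLE (le_top : W ≤ ⊤)).op) ≫ g.appLE W V e =
      (g ≫ f).appTop ≫ Z.presheaf.map (homOfLE (le_top : V ≤ ⊤)).op := by
  rw [Category.assoc, Scheme.Hom.map_appLE, Scheme.Hom.comp_appTop, Category.assoc]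
  rfl

namespace NonsingularVariety
variable {k : Type u} [Field k] (Y : NonsingularVariety k)

@[simp]
theorem prodSections_tmul (A : Type u) [CommRing A] [Algebra k A] (U : Y.scheme.Opens) (a : A)
    (r : Γ(Y.scheme, U)) : Y.prodSections A U (a ⊗ₜ r) =
      ((Scheme.ΓSpecIso (CommRingCat.of A)).inv ≫
        (Y.prodSnd A).appTop ≫ (Y.prodSpec A).presheaf.map (homOfLE le_top).op).hom a *
      ((Y.prodFst A).app U).hom r := rfl

/-- The coordinate ring of `U × Spec A` is the pushout of those of `U` and `Spec A`. -/
theorem isPushout_prodSpec (A : Type u) [CommRing A] [Algebra k A] (U : Y.scheme.affineOpens) :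
    IsPushout (CommRingCat.ofHom (algebraMap k A))
      (CommRingCat.ofHom (algebraMap k Γ(Y.scheme, U.1)))
      ((Scheme.ΓSpecIso (CommRingCat.of A)).inv ≫
        (Y.prodSnd A).appTop ≫ (Y.prodSpec A).presheaf.map
          (homOfLE (le_top : Y.prodFst A ⁻¹ᵁ U.1 ≤ ⊤)).op)
      ((Y.prodFst A).app U.1) := by
  have H := IsPullback.of_hasPullback Y.str (Spec.map (CommRingCat.ofHom (algebraMap k A)))
  have h1 := (isIso_pushoutSection_iff H (US := ⊤) (UT := ⊤) (UX := U.1)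
    (UY := Y.prodFst A ⁻¹ᵁ U.1) le_top le_top (by simp)).mp
    (isIso_pushoutSection_of_isAffineOpen H le_top le_top (by simp) (isAffineOpen_top _)
      (isAffineOpen_top _) U.2)
  refine IsPushout.of_iso h1.flip (Scheme.ΓSpecIso (CommRingCat.of k))
    (Scheme.ΓSpecIso (CommRingCat.of A)) (Iso.refl _) (Iso.refl _) ?_ ?_ ?_ ?_
  · rw [← Scheme.Hom.appTop_eq_appLE, Scheme.ΓSpecIso_naturality]
  · have h2 : CommRingCat.ofHom (algebraMap k Γ(Y.scheme, U.1)) =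
        (Scheme.ΓSpecIso (CommRingCat.of k)).inv ≫ Y.str.appLE ⊤ U.1 le_top := rfl
    rw [h2, Iso.hom_inv_id_assoc, Iso.refl_hom, Category.comp_id]
  · rw [Scheme.Hom.appTop_map_eq_appLE, Iso.hom_inv_id_assoc, Iso.refl_hom, Category.comp_id]
  · rw [Iso.refl_hom, Iso.refl_hom, Category.comp_id, Category.id_comp, Scheme.Hom.app_eq_appLE]

/-- Over an affine open `U` of `Y`, the functions on `U × Spec A` are `A ⊗ Γ(U)`. -/
theorem prodSections_bijective (A : Type u) [CommRing A] [Algebra k A]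
    (U : Y.scheme.affineOpens) : Function.Bijective (Y.prodSections A U.1) := by
  have h1 := CommRingCat.isPushout_tensorProduct k A Γ(Y.scheme, U.1)
  have h2 := Y.isPushout_prodSpec A U
  have e : (h1.isoIsPushout _ _ h2).hom = CommRingCat.ofHom (Y.prodSections A U.1) := by
    refine h1.hom_ext ?_ ?_
    · rw [IsPushout.inl_isoIsPushout_hom]
      ext a
      simp
    · rw [IsPushout.inr_isoIsPushout_hom]
      ext a
      simp
  have h3 := ConcreteCategory.bijective_of_isIso (h1.isoIsPushout _ _ h2).hom
  rw [e] at h3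
  exact h3

theorem prodSections_res (A : Type u) [CommRing A] [Algebra k A] {U V : Y.scheme.Opens}
    (h : V ≤ U) (x : A ⊗[k] Γ(Y.scheme, U)) :
    ((Y.prodSpec A).presheaf.map (homOfLE ((Y.prodFst A).preimage_mono h)).op).hom
      (Y.prodSections A U x) = Y.prodSections A V (Y.tensorRes A h x) := by
  induction x with
  | zero => simp
  | tmul a r =>
    have h1 : Y.tensorRes A h (a ⊗ₜ r) =
      a ⊗ₜ (Y.scheme.presheaf.map (homOfLE h).op).hom r := rfl
    rw [h1, prodSections_tmul, prodSections_tmul, map_mul, ← CommRingCat.comp_apply,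
      ← CommRingCat.comp_apply, ← CommRingCat.comp_apply, Scheme.Hom.naturality]
    congr 2
    simp only [Category.assoc, ← Functor.map_comp, ← op_comp, homOfLE_comp]
  | add x y hx hy => simp only [map_add, hx, hy]

theorem prodMap_preimage {A B : Type u} [CommRing A] [Algebra k A] [CommRing B] [Algebra k B]
    (φ : A →ₐ[k] B) (U : Y.scheme.Opens) :
    Y.prodMap φ ⁻¹ᵁ (Y.prodFst A ⁻¹ᵁ U) = Y.prodFst B ⁻¹ᵁ U := by
  rw [← Scheme.Hom.comp_preimage, prodMap, pullback.lift_fst]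

theorem prodSections_base {A B : Type u} [CommRing A] [Algebra k A] [CommRing B] [Algebra k B]
    (φ : A →ₐ[k] B) (U : Y.scheme.Opens) (x : A ⊗[k] Γ(Y.scheme, U)) :
    ((Y.prodMap φ).appLE (Y.prodFst A ⁻¹ᵁ U) (Y.prodFst B ⁻¹ᵁ U)
      (Y.prodMap_preimage φ U).ge).hom (Y.prodSections A U x) =
      Y.prodSections B U (Y.tensorBase φ U x) := by
  induction x with
  | zero => simp
  | tmul a r =>
    have h1 : Y.tensorBase φ U (a ⊗ₜ r) = φ a ⊗ₜ r := rfl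
    have h2 : Y.prodMap φ ≫ Y.prodSnd A =
        Y.prodSnd B ≫ Spec.map (CommRingCat.ofHom φ.toRingHom) := pullback.lift_snd _ _ _
    have h3 : Y.prodMap φ ≫ Y.prodFst A = Y.prodFst B := pullback.lift_fst _ _ _
    rw [h1, prodSections_tmul, prodSections_tmul, map_mul, ← CommRingCat.comp_apply,
      ← CommRingCat.comp_apply]
    congr 1
    · have h4 := Scheme.ΓSpecIso_inv_naturality (CommRingCat.ofHom φ.toRingHom)
      have h5 : φ a = (CommRingCat.ofHom φ.toRingHom).hom a := rfl
      rw [h5, ← CommRingCat.comp_apply, reassoc_of% h4, Category.assoc,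
        Scheme.Hom.appTop_map_appLE, h2, Scheme.Hom.comp_appTop, Category.assoc]
    · congr 1
      simp only [Scheme.Hom.app_eq_appLE, Scheme.Hom.appLE_comp_appLE, h3]
  | add x y hx hy => simp only [map_add, hx, hy]

theorem closedFibre_preimage {A : Type u} [CommRing A] [Algebra k A] (ε : A →ₐ[k] k)
    (U : Y.scheme.Opens) : Y.closedFibre ε ⁻¹ᵁ (Y.prodFst A ⁻¹ᵁ U) = U := by
  rw [← Scheme.Hom.comp_preimage, closedFibre, pullback.lift_fst]
  rfl

theorem prodSections_reduce {A : Type u} [CommRing A] [Algebra k A] (ε : A →ₐ[k] k)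
    (U : Y.scheme.Opens) (x : A ⊗[k] Γ(Y.scheme, U)) :
    ((Y.closedFibre ε).appLE (Y.prodFst A ⁻¹ᵁ U) U (Y.closedFibre_preimage ε U).ge).hom
      (Y.prodSections A U x) = Y.tensorReduce ε U x := by
  induction x with
  | zero => simp
  | tmul a r =>
    have h1 : Y.tensorReduce ε U (a ⊗ₜ r) = ε a • r := by
      simp [tensorReduce, tensorBase]
    have h2 : Y.closedFibre ε ≫ Y.prodSnd A =
        Y.str ≫ Spec.map (CommRingCat.ofHom ε.toRingHom) := pullback.lift_snd _ _ _
    have h3 : Y.closedFibre ε ≫ Y.prodFst A = 𝟙 _ := pullback.lift_fst _ _ _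
    rw [h1, Algebra.smul_def, prodSections_tmul, map_mul, ← CommRingCat.comp_apply,
      ← CommRingCat.comp_apply]
    congr 1
    · have h4 := Scheme.ΓSpecIso_inv_naturality (CommRingCat.ofHom ε.toRingHom)
      have h5 : algebraMap k Γ(Y.scheme, U) (ε a) =
        (CommRingCat.ofHom ε.toRingHom ≫ (Scheme.ΓSpecIso (CommRingCat.of k)).inv ≫
          Y.str.appTop ≫ Y.scheme.presheaf.map (homOfLE le_top).op).hom a := rfl
      rw [h5, reassoc_of% h4, Category.assoc, Scheme.Hom.appTop_map_appLE, h2,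
        Scheme.Hom.comp_appTop, Category.assoc]
    · simp only [Scheme.Hom.app_eq_appLE, Scheme.Hom.appLE_comp_appLE, h3]
      simp only [Scheme.Hom.appLE, Scheme.Hom.id_app]
      exact congrArg (fun g => g.hom r) ((Category.id_comp _).trans (Y.scheme.presheaf.map_id _))
  | add x y hx hy => simp only [map_add, hx, hy]

end NonsingularVariety

/-- The inverse image of an ideal sheaf is, on affine opens, the extension of ideals. -/
theorem AlgebraicGeometry.Scheme.IdealSheafData.ideal_comap_eq_map {X Y : Scheme.{u}}
    (J : Y.IdealSheafData) (f : X ⟶ Y) (U : Y.affineOpens) (W : X.affineOpens)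
    (e : W.1 ≤ f ⁻¹ᵁ U.1) :
    (J.comap f).ideal W = (J.ideal U).map (f.appLE U.1 W.1 e).hom := by
  have H := IsPullback.of_hasPullback f J.subschemeι
  have hW : pullback.fst f J.subschemeι ⁻¹ᵁ W.1 = pullback.fst f J.subschemeι ⁻¹ᵁ W.1 ⊓
      pullback.snd f J.subschemeι ⁻¹ᵁ (J.subschemeι ⁻¹ᵁ U.1) := by
    rw [left_eq_inf, ← Scheme.Hom.comp_preimage, ← pullback.condition, Scheme.Hom.comp_preimage]
    exact Scheme.Hom.preimage_mono _ e
  have h1 := (isIso_pushoutSection_iff H (US := U.1) (UT := J.subschemeι ⁻¹ᵁ U.1) (UX := W.1)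
    le_rfl e hW).mp (isIso_pushoutSection_of_isAffineOpen H le_rfl e hW U.2
      (U.2.preimage J.subschemeι) W.2)
  apply le_antisymm
  -- the fibre product being a pushout of rings, the quotient by the extended ideal factors
  -- through its ring of functions
  · intro x hx
    let Q := CommRingCat.of (Γ(X, W.1) ⧸ (J.ideal U).map (f.appLE U.1 W.1 e).hom)
    let q : Γ(X, W.1) ⟶ Q := CommRingCat.ofHom (Ideal.Quotient.mk _)
    have hs : Function.Surjective (J.subschemeι.app U.1).hom := J.subschemeι_app_surjective U
    have hk : RingHom.ker (J.subschemeι.app U.1).hom ≤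
        RingHom.ker (f.appLE U.1 W.1 e ≫ q).hom := by
      rw [J.ker_subschemeι_app]
      intro y hy
      exact Ideal.Quotient.eq_zero_iff_mem.mpr (Ideal.mem_map_of_mem _ hy)
    let r : Γ(J.subscheme, J.subschemeι ⁻¹ᵁ U.1) ⟶ Q := CommRingCat.ofHom
      (RingHom.liftOfSurjective (J.subschemeι.app U.1).hom hs ⟨(f.appLE U.1 W.1 e ≫ q).hom, hk⟩)
    have hw : f.appLE U.1 W.1 e ≫ q = J.subschemeι.appLE U.1 _ le_rfl ≫ r := by
      ext y
      rw [← Scheme.Hom.app_eq_appLE]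
      exact (RingHom.liftOfRightInverse_comp_apply (J.subschemeι.app U.1).hom
        (Function.surjInv hs) (Function.rightInverse_surjInv hs)
        ⟨(f.appLE U.1 W.1 e ≫ q).hom, hk⟩ y).symm
    have h2 : (pullback.fst f J.subschemeι).app W.1 ≫ h1.desc q r hw = q := by
      rw [Scheme.Hom.app_eq_appLE]
      exact h1.inl_desc _ _ _
    have hx' : ((pullback.fst f J.subschemeι).app W.1).hom x = 0 := by
      rw [Scheme.IdealSheafData.comap, Scheme.Hom.ker_apply] at hx
      exact hx
    have h3 : q.hom x = 0 := by
      rw [← h2, CommRingCat.comp_apply]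
      exact (congrArg _ hx').trans (map_zero _)
    exact Ideal.Quotient.eq_zero_iff_mem.mp h3
  · rw [Ideal.map_le_iff_le_comap]
    intro x hx
    rw [Ideal.mem_comap, Scheme.IdealSheafData.comap, Scheme.Hom.ker_apply, RingHom.mem_ker]
    have h2 := h1.w
    have h3 : (J.subschemeι.appLE U.1 (J.subschemeι ⁻¹ᵁ U.1) le_rfl).hom x = 0 := by
      rw [← Scheme.Hom.app_eq_appLE]
      rw [← J.ker_subschemeι_app] at hx
      exact hx
    have h4 := congrArg (fun g => g.hom x) h2
    rw [Scheme.Hom.app_eq_appLE]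
    refine h4.trans ?_
    exact (congrArg ((pullback.snd f J.subschemeι).appLE (J.subschemeι ⁻¹ᵁ U.1)
      (pullback.fst f J.subschemeι ⁻¹ᵁ W.1) (hW.le.trans inf_le_right)).hom h3).trans (map_zero _)

end

/-! ### Ideal sheaves on the product in terms of ideals over affine opens -/

noncomputable section

theorem Ideal.map_comap_eq_comap_map_of_bijective {R S R' S' : Type*} [CommRing R] [CommRing S]
    [CommRing R'] [CommRing S'] {e : R →+* S} {e' : R' →+* S'} {f : R →+* R'} {g : S →+* S'}
    (h : ∀ x, g (e x) = e' (f x)) (he : Function.Bijective e) (he' : Function.Bijective e')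
    (K : Ideal S) : (K.comap e).map f = (K.map g).comap e' := by
  have hc : g.comp e = e'.comp f := RingHom.ext h
  conv_rhs => rw [← Ideal.map_comap_of_surjective e he.2 K, Ideal.map_map, hc, ← Ideal.map_map]
  exact (Ideal.comap_map_of_bijective e' he').symm

theorem Module.flat_quotient_iff_flat_comp {A S T : Type*} [CommRing A] [CommRing S] [CommRing T]
    [Algebra A S] (q : S →+* T) (hq : Function.Surjective q) (J : Ideal S)
    (hJ : RingHom.ker q = J) : Module.Flat A (S ⧸ J) ↔ (q.comp (algebraMap A S)).Flat := by
  subst hJ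
  let _ := (q.comp (algebraMap A S)).toAlgebra
  let q' : S →ₐ[A] T := { q with commutes' := fun _ => rfl }
  exact Module.Flat.equiv_iff (Ideal.quotientKerAlgEquivOfSurjective (f := q') hq).toLinearEquiv

namespace NonsingularVariety
variable {k : Type u} [Field k] (Y : NonsingularVariety k)

section

variable {A B : Type u} [CommRing A] [Algebra k A] [CommRing B] [Algebra k B]

theorem mem_pulledIdeal {J : (Y.prodSpec A).IdealSheafData} {U : Y.scheme.affineOpens}
    {F : A ⊗[k] Γ(Y.scheme, U.1)} : F ∈ Y.pulledIdeal J U ↔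
      Y.prodSections A U.1 F ∈ J.ideal ⟨Y.prodFst A ⁻¹ᵁ U.1, U.2.preimage (Y.prodFst A)⟩ :=
  Iff.rfl

theorem pulledIdeal_map_res (J : (Y.prodSpec A).IdealSheafData) {U V : Y.scheme.affineOpens}
    (h : V.1 ≤ U.1) :
    (Y.pulledIdeal J U).map (Y.tensorRes A h) = Y.pulledIdeal J V := by
  refine (Ideal.map_comap_eq_comap_map_of_bijective (f := (Y.tensorRes A h).toRingHom)
    (Y.prodSections_res A h) (Y.prodSections_bijective A U) (Y.prodSections_bijective A V)
    _).trans ?_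
  rw [pulledIdeal]
  congr 1
  exact J.map_ideal (U := ⟨Y.prodFst A ⁻¹ᵁ V.1, V.2.preimage (Y.prodFst A)⟩)
    (V := ⟨Y.prodFst A ⁻¹ᵁ U.1, U.2.preimage (Y.prodFst A)⟩) _

/-- Inverse image along a base change of `Spec A` extends ideals along `A ⊗ Γ(U) → B ⊗ Γ(U)`. -/
theorem pulledIdeal_map_base (φ : A →ₐ[k] B) (J : (Y.prodSpec A).IdealSheafData)
    (U : Y.scheme.affineOpens) :
    (Y.pulledIdeal J U).map (Y.tensorBase φ U.1) = Y.pulledIdeal (J.comap (Y.prodMap φ)) U := by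
  refine (Ideal.map_comap_eq_comap_map_of_bijective (f := (Y.tensorBase φ U.1).toRingHom)
    (Y.prodSections_base φ U.1) (Y.prodSections_bijective A U) (Y.prodSections_bijective B U)
    _).trans ?_
  rw [pulledIdeal]
  congr 1
  exact (J.ideal_comap_eq_map (Y.prodMap φ) ⟨Y.prodFst A ⁻¹ᵁ U.1, U.2.preimage (Y.prodFst A)⟩
    ⟨Y.prodFst B ⁻¹ᵁ U.1, U.2.preimage (Y.prodFst B)⟩ _).symm

/-- The fibre over the closed point is given by the reductions of the ideals. -/
theorem pulledIdeal_map_reduce (ε : A →ₐ[k] k) (J : (Y.prodSpec A).IdealSheafData)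
    (U : Y.scheme.affineOpens) :
    (Y.pulledIdeal J U).map (Y.tensorReduce ε U.1) = (J.comap (Y.closedFibre ε)).ideal U := by
  refine (Ideal.map_comap_eq_comap_map_of_bijective (f := (Y.tensorReduce ε U.1).toRingHom)
    (e' := RingHom.id _)
    (Y.prodSections_reduce ε U.1) (Y.prodSections_bijective A U) Function.bijective_id
    _).trans ?_
  rw [Ideal.comap_id]
  exact (J.ideal_comap_eq_map (Y.closedFibre ε)
    ⟨Y.prodFst A ⁻¹ᵁ U.1, U.2.preimage (Y.prodFst A)⟩ U _).symm

theorem idealSheaf_ext {J J' : (Y.prodSpec A).IdealSheafData} {ι : Type*}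
    (U : ι → Y.scheme.affineOpens) (hU : ⨆ i, (U i).1 = ⊤)
    (h : ∀ i, Y.pulledIdeal J (U i) = Y.pulledIdeal J' (U i)) : J = J' := by
  refine Scheme.IdealSheafData.ext_of_iSup_eq_top
    (fun i => ⟨Y.prodFst A ⁻¹ᵁ (U i).1, (U i).2.preimage (Y.prodFst A)⟩) ?_ fun i => ?_
  · rw [← Scheme.Hom.preimage_iSup, hU]; rfl
  · exact Ideal.comap_injective_of_surjective _ (Y.prodSections_bijective A (U i)).2 (h i)

/-- Flatness over `Spec A` of the part of the subscheme over `U`, in terms of modules. -/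
theorem flat_pulledIdeal_iff (J : (Y.prodSpec A).IdealSheafData) (U : Y.scheme.affineOpens) :
    Module.Flat A ((A ⊗[k] Γ(Y.scheme, U.1)) ⧸ Y.pulledIdeal J U) ↔
      ((J.subschemeι ≫ Y.prodSnd A).appLE ⊤ (J.subschemeι ⁻¹ᵁ (Y.prodFst A ⁻¹ᵁ U.1))
        le_top).hom.Flat := by
  let W : (Y.prodSpec A).affineOpens := ⟨Y.prodFst A ⁻¹ᵁ U.1, U.2.preimage (Y.prodFst A)⟩
  let q := (J.subschemeι.app W.1).hom.comp (Y.prodSections A U.1)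
  have hq : Function.Surjective q :=
    (J.subschemeι_app_surjective W).comp (Y.prodSections_bijective A U).2
  have hk : RingHom.ker q = Y.pulledIdeal J U := by
    rw [← RingHom.comap_ker, J.ker_subschemeι_app]; rfl
  rw [Module.flat_quotient_iff_flat_comp q hq _ hk]
  have h1 : q.comp (algebraMap A _) = ((Scheme.ΓSpecIso (CommRingCat.of A)).inv ≫
      (J.subschemeι ≫ Y.prodSnd A).appLE ⊤ (J.subschemeι ⁻¹ᵁ (Y.prodFst A ⁻¹ᵁ U.1))
        le_top).hom := by
    have h2 := Scheme.Hom.appTop_map_appLE (Y.prodSnd A) J.subschemeι W.1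
      (J.subschemeι ⁻¹ᵁ W.1) le_rfl
    ext a
    have h3 : Y.prodSections A U.1 (algebraMap A _ a) =
        ((Scheme.ΓSpecIso (CommRingCat.of A)).inv ≫ (Y.prodSnd A).appTop ≫
          (Y.prodSpec A).presheaf.map (homOfLE (le_top : W.1 ≤ ⊤)).op).hom a := by
      rw [Algebra.TensorProduct.algebraMap_apply, prodSections_tmul, map_one, mul_one]
      rfl
    have h4 : q (algebraMap A _ a) = ((J.subschemeι.app W.1).hom
      (Y.prodSections A U.1 (algebraMap A _ a))) := rfl
    rw [RingHom.comp_apply, h4, h3, ← CommRingCat.comp_apply, Category.assoc,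
      Scheme.Hom.app_eq_appLE, h2]
    rfl
  rw [h1]
  exact RingHom.Flat.respectsIso.cancel_left_isIso _ _

theorem flat_pulledIdeal {J : (Y.prodSpec A).IdealSheafData}
    (h : Flat (J.subschemeι ≫ Y.prodSnd A)) (U : Y.scheme.affineOpens) :
    Module.Flat A ((A ⊗[k] Γ(Y.scheme, U.1)) ⧸ Y.pulledIdeal J U) := by
  rw [flat_pulledIdeal_iff]
  exact HasRingHomProperty.appLE @Flat _ h ⟨⊤, isAffineOpen_top _⟩
    ⟨_, (U.2.preimage (Y.prodFst A)).preimage J.subschemeι⟩ _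

theorem flat_of_flat_pulledIdeal {J : (Y.prodSpec A).IdealSheafData} {ι : Type*}
    (U : ι → Y.scheme.affineOpens) (hU : ⨆ i, (U i).1 = ⊤)
    (h : ∀ i, Module.Flat A ((A ⊗[k] Γ(Y.scheme, (U i).1)) ⧸ Y.pulledIdeal J (U i))) :
    Flat (J.subschemeι ≫ Y.prodSnd A) := by
  refine HasRingHomProperty.of_iSup_eq_top (P := @Flat)
    (fun i => ⟨_, ((U i).2.preimage (Y.prodFst A)).preimage J.subschemeι⟩) ?_ fun i => ?_
  · change ⨆ i, J.subschemeι ⁻¹ᵁ (Y.prodFst A ⁻¹ᵁ (U i).1) = ⊤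
    rw [← Scheme.Hom.preimage_iSup, ← Scheme.Hom.preimage_iSup, hU]; rfl
  · exact (Y.flat_pulledIdeal_iff J (U i)).mp (h i)

end

end NonsingularVariety
end

/-! ### Intersections of extended ideal sheaves -/

noncomputable section

namespace AlgebraicGeometry.Scheme

variable {Z : Scheme.{u}}

/-- The ideal sheaf of functions whose restriction to the affine open `U` lies in the ideal `J`. -/
def extendIdeal (U : Z.affineOpens) (J : Ideal Γ(Z, U.1)) : Z.IdealSheafData :=
  (IdealSheafData.ofIdealTop (X := U.1) (J.map (Z.presheaf.map
    (homOfLE (le_of_eq U.1.ι_image_top : U.1.ι ''ᵁ ⊤ ≤ U.1)).op).hom)).map U.1.ι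

/-- On a separated scheme `U ∩ V` is affine and the inclusion of `U` is an affine morphism, so that
the sections over `V` are described by extending `J` to `U ∩ V`. -/
theorem mem_extendIdeal [Z.IsSeparated] (U : Z.affineOpens)
    (J : Ideal Γ(Z, U.1)) (V : Z.affineOpens) (x : Γ(Z, V.1)) :
    x ∈ (extendIdeal U J).ideal V ↔
      (Z.presheaf.map (homOfLE (inf_le_right : U.1 ⊓ V.1 ≤ V.1)).op).hom x ∈
        J.map (Z.presheaf.map (homOfLE (inf_le_left : U.1 ⊓ V.1 ≤ U.1)).op).hom := by
  -- the direct image is computed on the image under `U.ι` of the inverse image of `V`, an open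
  -- which equals `U ⊓ V`, though not by definition
  have key : ∀ (W : Z.Opens) (hW : W = U.1 ⊓ V.1) (h1 : W ≤ V.1) (h2 : W ≤ U.1),
      (Z.presheaf.map (homOfLE h1).op).hom x ∈ J.map (Z.presheaf.map (homOfLE h2).op).hom ↔
      (Z.presheaf.map (homOfLE (inf_le_right : U.1 ⊓ V.1 ≤ V.1)).op).hom x ∈
        J.map (Z.presheaf.map (homOfLE (inf_le_left : U.1 ⊓ V.1 ≤ U.1)).op).hom := by
    rintro W rfl h1 h2
    rfl
  rw [← key (U.1.ι ''ᵁ U.1.ι ⁻¹ᵁ V.1) (by simp [Scheme.Hom.image_preimage_eq_opensRange_inf])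
    (Scheme.Hom.image_preimage_le _ _) ((U.1.ι.image_mono le_top).trans_eq U.1.ι_image_top)]
  have : IsAffine U.1 := U.2
  have hf : IsAffineHom U.1.ι := by
    refine ⟨fun V hV => ?_⟩
    rw [← Scheme.Hom.isAffineOpen_iff_of_isOpenImmersion U.1.ι,
      Scheme.Hom.image_preimage_eq_opensRange_inf, Scheme.Opens.opensRange_ι]
    exact IsAffineOpen.inf U.2 hV
  have e : ∀ {W₁ W₂ W₃ : Z.Opens} (h : W₂ ≤ W₁) (h' : W₃ ≤ W₂),
      (Z.presheaf.map (homOfLE h').op).hom.comp (Z.presheaf.map (homOfLE h).op).hom =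
        (Z.presheaf.map (homOfLE (h'.trans h)).op).hom := by
    intro W₁ W₂ W₃ h h'
    rw [← CommRingCat.hom_comp, ← Functor.map_comp, ← op_comp, homOfLE_comp]
  rw [← e (le_of_eq U.1.ι_image_top : U.1.ι ''ᵁ ⊤ ≤ U.1)
    (U.1.ι.image_mono (le_top : U.1.ι ⁻¹ᵁ V.1 ≤ ⊤)), ← Ideal.map_map, extendIdeal,
    IdealSheafData.ideal_map_of_isAffineHom]
  rfl

end AlgebraicGeometry.Scheme

namespace NonsingularVariety
variable {k : Type u} [Field k] (Y : NonsingularVariety k)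

instance : Y.scheme.IsSeparated := by
  rw [Scheme.isSeparated_iff, terminal.comp_from Y.str |>.symm]
  infer_instance

instance (B : Type u) [CommRing B] [Algebra k B] : (Y.prodSpec B).IsSeparated := by
  rw [Scheme.isSeparated_iff, terminal.comp_from (Y.prodSnd B) |>.symm]
  infer_instance

variable {B : Type u} [CommRing B] [Algebra k B] {ι : Type*} (U : ι → Y.scheme.affineOpens)
  (J : ∀ i, Ideal (B ⊗[k] Γ(Y.scheme, (U i).1)))

/-- The ideal sheaf of functions on `Y × Spec B` whose restrictions to the opens `Uᵢ × Spec B` lie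
in the given ideals. -/
def glue : (Y.prodSpec B).IdealSheafData :=
  ⨅ i, Scheme.extendIdeal ⟨Y.prodFst B ⁻¹ᵁ (U i).1, (U i).2.preimage (Y.prodFst B)⟩
    ((J i).map (Y.prodSections B (U i).1))

/-- A finite intersection of ideal sheaves is computed on affine opens; this is where only finitely
many opens are allowed. -/
theorem mem_pulledIdeal_glue [Finite ι] {V : Y.scheme.affineOpens} {F : B ⊗[k] Γ(Y.scheme, V.1)} :
    F ∈ Y.pulledIdeal (Y.glue U J) V ↔ ∀ i, Y.tensorRes B (inf_le_right : (U i).1 ⊓ V.1 ≤ V.1) F ∈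
      (J i).map (Y.tensorRes B (inf_le_left : (U i).1 ⊓ V.1 ≤ (U i).1)) := by
  rw [mem_pulledIdeal, glue, Scheme.IdealSheafData.ideal_iInf, iInf_apply, Ideal.mem_iInf]
  refine forall_congr' fun i => ?_
  rw [Scheme.mem_extendIdeal]
  let W : Y.scheme.affineOpens := ⟨(U i).1 ⊓ V.1, (U i).2.inf V.2⟩
  have h1 := Y.prodSections_res B (inf_le_right : W.1 ≤ V.1) F
  have h2 : (Ideal.map (Y.prodSections B (U i).1) (J i)).map ((Y.prodSpec B).presheaf.map
      (homOfLE ((Y.prodFst B).preimage_mono (inf_le_left : W.1 ≤ (U i).1))).op).hom =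
      ((J i).map (Y.tensorRes B (inf_le_left : W.1 ≤ (U i).1))).map (Y.prodSections B W.1) := by
    refine (Ideal.map_map _ _).trans (Eq.trans ?_ (Ideal.map_map
      (Y.tensorRes B (inf_le_left : W.1 ≤ (U i).1)).toRingHom _).symm)
    congr 1
    exact RingHom.ext (Y.prodSections_res B (inf_le_left : W.1 ≤ (U i).1))
  refine (iff_of_eq (congrArg₂ (fun x K => x ∈ K) h1 h2)).trans ?_
  rw [← Ideal.mem_comap, Ideal.comap_map_of_bijective _ (Y.prodSections_bijective B W)]

end NonsingularVariety
end

/-! ### Restriction to smaller opens and gluing of ideals -/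

noncomputable section

namespace NonsingularVariety
variable {k : Type u} [Field k] (Y : NonsingularVariety k)

variable {B : Type u} [CommRing B] [Algebra k B]

theorem res_res {U V W : Y.scheme.Opens} (h : V ≤ U) (h' : W ≤ V) (f : Γ(Y.scheme, U)) :
    Y.res h' (Y.res h f) = Y.res (h'.trans h) f := by
  have e : Y.scheme.presheaf.map (homOfLE h).op ≫ Y.scheme.presheaf.map (homOfLE h').op =
      Y.scheme.presheaf.map (homOfLE (h'.trans h)).op := by
    rw [← Functor.map_comp, ← op_comp, homOfLE_comp]
  exact congrArg (fun g => g.hom f) e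

theorem res_self {U : Y.scheme.Opens} (h : U ≤ U) (f : Γ(Y.scheme, U)) : Y.res h f = f :=
  congrArg (fun g => g.hom f) (Y.scheme.presheaf.map_id _)

@[simp]
theorem tensorRes_tmul {U V : Y.scheme.Opens} (h : V ≤ U) (b : B) (f : Γ(Y.scheme, U)) :
    Y.tensorRes B h (b ⊗ₜ f) = b ⊗ₜ Y.res h f := rfl

theorem tensorRes_tensorRes {U V W : Y.scheme.Opens} (h : V ≤ U) (h' : W ≤ V)
    (F : B ⊗[k] Γ(Y.scheme, U)) :
    Y.tensorRes B h' (Y.tensorRes B h F) = Y.tensorRes B (h'.trans h) F := by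
  induction F with
  | zero => simp
  | tmul b f => simp only [tensorRes_tmul, res_res]
  | add F G hF hG => simp only [map_add, hF, hG]

theorem tensorRes_self {U : Y.scheme.Opens} (h : U ≤ U) (F : B ⊗[k] Γ(Y.scheme, U)) :
    Y.tensorRes B h F = F := by
  induction F with
  | zero => simp
  | tmul b f => simp only [tensorRes_tmul, res_self]
  | add F G hF hG => simp only [map_add, hF, hG]

theorem map_tensorRes_map_tensorRes {U V W : Y.scheme.Opens} (h : V ≤ U) (h' : W ≤ V)
    (J : Ideal (B ⊗[k] Γ(Y.scheme, U))) :
    (J.map (Y.tensorRes B h)).map (Y.tensorRes B h') = J.map (Y.tensorRes B (h'.trans h)) := by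
  refine (Ideal.map_map (Y.tensorRes B h).toRingHom (Y.tensorRes B h').toRingHom).trans ?_
  exact congrArg (fun g => J.map g) (RingHom.ext (f := (Y.tensorRes B h').toRingHom.comp
    (Y.tensorRes B h).toRingHom) (g := (Y.tensorRes B (h'.trans h)).toRingHom)
    (Y.tensorRes_tensorRes h h'))

theorem map_tensorRes_self {U : Y.scheme.Opens} (h : U ≤ U) (J : Ideal (B ⊗[k] Γ(Y.scheme, U))) :
    J.map (Y.tensorRes B h) = J := by
  refine (congrArg (fun g => J.map g) (RingHom.ext (f := (Y.tensorRes B h).toRingHom)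
    (g := RingHom.id _) (Y.tensorRes_self h))).trans J.map_id

theorem tensorReduce_tensorRes (ε : B →ₐ[k] k) {U V : Y.scheme.Opens} (h : V ≤ U)
    (F : B ⊗[k] Γ(Y.scheme, U)) :
    Y.tensorReduce ε V (Y.tensorRes B h F) = Y.res h (Y.tensorReduce ε U F) := by
  induction F with
  | zero => simp
  | tmul b f =>
    rw [tensorRes_tmul]
    change ε b • Y.res h f = Y.res h (ε b • f)
    rw [map_smul]
  | add F G hF hG => simp only [map_add, hF, hG]

theorem tensorBase_tensorRes {A : Type u} [CommRing A] [Algebra k A] (φ : B →ₐ[k] A)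
    {U V : Y.scheme.Opens} (h : V ≤ U) (F : B ⊗[k] Γ(Y.scheme, U)) :
    Y.tensorBase φ V (Y.tensorRes B h F) = Y.tensorRes A h (Y.tensorBase φ U F) := by
  induction F with
  | zero => simp
  | tmul b f => rfl
  | add F G hF hG => simp only [map_add, hF, hG]

theorem map_tensorRes_map_tensorBase {A : Type u} [CommRing A] [Algebra k A] (φ : B →ₐ[k] A)
    {U V : Y.scheme.Opens} (h : V ≤ U) (J : Ideal (B ⊗[k] Γ(Y.scheme, U))) :
    (J.map (Y.tensorRes B h)).map (Y.tensorBase φ V) =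
      (J.map (Y.tensorBase φ U)).map (Y.tensorRes A h) := by
  refine (Ideal.map_map (Y.tensorRes B h).toRingHom (Y.tensorBase φ V).toRingHom).trans
    (Eq.trans ?_ (Ideal.map_map (Y.tensorBase φ U).toRingHom (Y.tensorRes A h).toRingHom).symm)
  exact congrArg (fun g => J.map g) (RingHom.ext (f := (Y.tensorBase φ V).toRingHom.comp
    (Y.tensorRes B h).toRingHom) (g := (Y.tensorRes A h).toRingHom.comp
    (Y.tensorBase φ U).toRingHom) (Y.tensorBase_tensorRes φ h))

section Glue

variable {ι : Type*} [Finite ι] {U : ι → Y.scheme.affineOpens}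
  {J : ∀ i, Ideal (B ⊗[k] Γ(Y.scheme, (U i).1))}

/-- Ideals which agree on overlaps are the restrictions of the ideal sheaf glued from them. -/
theorem pulledIdeal_glue_of_le
    (hJ : ∀ i j, (J i).map (Y.tensorRes B (inf_le_left : (U i).1 ⊓ (U j).1 ≤ (U i).1)) =
      (J j).map (Y.tensorRes B (inf_le_right : (U i).1 ⊓ (U j).1 ≤ (U j).1)))
    {V : Y.scheme.affineOpens} {i : ι} (h : V.1 ≤ (U i).1) :
    Y.pulledIdeal (Y.glue U J) V = (J i).map (Y.tensorRes B h) := by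
  refine le_antisymm (fun F hF => ?_) ?_
  · rw [mem_pulledIdeal_glue] at hF
    -- membership in the `i`-th ideal over `Uᵢ ⊓ V`, which is `V`, already suffices
    have key : ∀ (W : Y.scheme.Opens) (_ : W = V.1) (h1 : W ≤ V.1) (h2 : W ≤ (U i).1),
        Y.tensorRes B h1 F ∈ (J i).map (Y.tensorRes B h2) → F ∈ (J i).map (Y.tensorRes B h) := by
      rintro W rfl h1 h2 H
      rwa [tensorRes_self] at H
    exact key _ (inf_eq_right.mpr h) _ _ (hF i)
  · rw [Ideal.map_le_iff_le_comap]
    intro F hF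
    rw [Ideal.mem_comap, mem_pulledIdeal_glue]
    intro j
    have h1 : (U j).1 ⊓ V.1 ≤ (U i).1 ⊓ (U j).1 := le_inf (inf_le_right.trans h) inf_le_left
    -- over `Uⱼ ⊓ V ⊆ Uᵢ ⊓ Uⱼ` the `i`-th and the `j`-th ideal agree
    rw [tensorRes_tensorRes, ← Y.map_tensorRes_map_tensorRes inf_le_right h1, ← hJ i j,
      map_tensorRes_map_tensorRes]
    exact Ideal.mem_map_of_mem (Y.tensorRes B (h1.trans inf_le_left)) hF

theorem pulledIdeal_glue_eq_top {V : Y.scheme.affineOpens}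
    (h : ∀ i, (J i).map (Y.tensorRes B (inf_le_left : (U i).1 ⊓ V.1 ≤ (U i).1)) = ⊤) :
    Y.pulledIdeal (Y.glue U J) V = ⊤ := by
  refine eq_top_iff.mpr fun F _ => ?_
  rw [mem_pulledIdeal_glue]
  intro i
  rw [h i]
  trivial

end Glue

/-- Restriction to a smaller affine open preserves flatness of a family. -/
theorem flat_map_tensorRes {U V : Y.scheme.affineOpens} (h : V.1 ≤ U.1)
    {J : Ideal (B ⊗[k] Γ(Y.scheme, U.1))} (hJ : Module.Flat B ((B ⊗[k] Γ(Y.scheme, U.1)) ⧸ J)) :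
    Module.Flat B ((B ⊗[k] Γ(Y.scheme, V.1)) ⧸ J.map (Y.tensorRes B h)) := by
  -- the ideal defines a subscheme over `U`, and restriction to an open of the latter is flat
  let 𝒥 := Y.glue (fun _ : Unit => U) (fun _ => J)
  have hg : ∀ {V : Y.scheme.affineOpens} (h : V.1 ≤ U.1),
    Y.pulledIdeal 𝒥 V = J.map (Y.tensorRes B h) := fun h =>
      Y.pulledIdeal_glue_of_le (U := fun _ : Unit => U) (J := fun _ => J) (fun _ _ => rfl)
        (i := ()) h
  have hU : Y.pulledIdeal 𝒥 U = J := (hg le_rfl).trans (Y.map_tensorRes_self _ _)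
  rw [← hU, flat_pulledIdeal_iff] at hJ
  rw [← hg h, flat_pulledIdeal_iff]
  let SU : 𝒥.subscheme.affineOpens :=
    ⟨_, (U.2.preimage (Y.prodFst B)).preimage 𝒥.subschemeι⟩
  let SV : 𝒥.subscheme.affineOpens :=
    ⟨_, (V.2.preimage (Y.prodFst B)).preimage 𝒥.subschemeι⟩
  have hle : SV.1 ≤ SU.1 := 𝒥.subschemeι.preimage_mono ((Y.prodFst B).preimage_mono h)
  have h1 := HasRingHomProperty.appLE @Flat (𝟙 𝒥.subscheme) inferInstance SU SV hle
  have e1 : (𝟙 𝒥.subscheme : 𝒥.subscheme ⟶ 𝒥.subscheme).appLE SU.1 SV.1 hle =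
      𝒥.subscheme.presheaf.map (homOfLE hle).op := by
    change (𝟙 𝒥.subscheme : 𝒥.subscheme ⟶ 𝒥.subscheme).app SU.1 ≫ _ = _
    rw [Scheme.Hom.id_app]
    exact Category.id_comp _
  rw [e1] at h1
  have h2 := hJ.comp h1
  rw [← CommRingCat.hom_comp] at h2
  exact (congrArg (fun g => g.hom.Flat) (Scheme.Hom.appLE_map (𝒥.subschemeι ≫ Y.prodSnd B)
    (U := ⊤) le_top (homOfLE hle).op)).mp h2

end NonsingularVariety
end

/-! ### Liftings over an open: difference, defect and twist -/

noncomputable section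

open FlatLift PoissonSubscheme

variable {k : Type u} [Field k] {Y : NonsingularVariety k}
  {P : PoissonStructure Y} {X : PoissonSubscheme P}
  {A B : Type u} [CommRing A] [Algebra k A] [CommRing B] [Algebra k B] {ε : A →ₐ[k] k}
  {φ : B →ₐ[k] A} {t : B}

theorem PoissonStructure.isPoissonBracket (P : PoissonStructure Y) (U : Y.scheme.Opens) :
    IsPoissonBracket (P.bracket U) :=
  ⟨P.bracket_self U, P.leibniz U, P.jacobi U⟩

theorem PoissonStructure.bracketWith_tensorRes (P : PoissonStructure Y) {U V : Y.scheme.Opens}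
    (h : V ≤ U) (a : Γ(Y.scheme, U)) (F : B ⊗[k] Γ(Y.scheme, U)) :
    bracketWith B (P.bracket V) (Y.res h a) (Y.tensorRes B h F) =
      Y.tensorRes B h (bracketWith B (P.bracket U) a F) := by
  induction F with
  | zero => simp
  | tmul b f =>
    rw [NonsingularVariety.tensorRes_tmul, bracketWith_tmul, bracketWith_tmul,
      NonsingularVariety.tensorRes_tmul, P.bracket_res]
  | add F G hF hG => simp only [map_add, hF, hG]

namespace InfDeformation

variable (η : InfDeformation X A ε)

theorem isDeformation (V : Y.scheme.affineOpens) :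
    IsDeformation ε (X.ideal.ideal V) (Y.pulledIdeal η.ideal V) where
  flat := Y.flat_pulledIdeal η.flat V
  map_reduce := (Y.pulledIdeal_map_reduce ε η.ideal V).trans (by rw [η.fibre])

theorem bracketWith_mem (V : Y.scheme.affineOpens) (a : Γ(Y.scheme, V.1)) :
    ∀ F ∈ Y.pulledIdeal η.ideal V,
      bracketWith A (P.bracket V.1) a F ∈ Y.pulledIdeal η.ideal V :=
  (baseChange_mem_iff (P.isPoissonBracket V.1) _).mp (η.poisson V) a

end InfDeformation

/-- A flat lifting to `B`, over the open `U` of `Y`, of the deformation `η`; it need not be Poisson.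
It is given by its ideals over the affine opens contained in `U`. -/
@[ext]
structure FlatLifting (η : InfDeformation X A ε) (φ : B →ₐ[k] A) (U : Y.scheme.Opens) where
  /-- the ideal over an affine open contained in `U` -/
  ideal (V : X.AffineIn U) : Ideal (B ⊗[k] Γ(Y.scheme, V.1.1))
  isLift (V : X.AffineIn U) : IsLift φ (Y.pulledIdeal η.ideal V.1) (ideal V)
  tensorRes_mem {V W : X.AffineIn U} (h : W.1 ≤ V.1) {F : B ⊗[k] Γ(Y.scheme, V.1.1)}
    (hF : F ∈ ideal V) : Y.tensorRes B h F ∈ ideal W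

namespace FlatLifting

variable {η : InfDeformation X A ε} {U W : Y.scheme.Opens}

/-- Restriction of a lifting to a smaller open. -/
def restrict (L : FlatLifting η φ U) (h : W ≤ U) : FlatLifting η φ W where
  ideal V := L.ideal ⟨V.1, V.2.trans h⟩
  isLift V := L.isLift ⟨V.1, V.2.trans h⟩
  tensorRes_mem {V V'} := L.tensorRes_mem (V := ⟨V.1, V.2.trans h⟩) (W := ⟨V'.1, V'.2.trans h⟩)

/-- The section `ψ` of the normal sheaf is the difference of two liftings. -/
def IsDiff (t : B) (L L' : FlatLifting η φ U) (ψ : X.Cochain 0 U) : Prop :=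
  ∀ V : X.AffineIn U, IsDifference (ε.comp φ) t (L.ideal V) (L'.ideal V) fun f => ψ V f ![]

/-- The section `G` of `N ⊗ T_Y|_X` measures the failure of a lifting to be Poisson. -/
def IsDef (t : B) (L : FlatLifting η φ U) (G : X.Cochain 1 U) : Prop :=
  ∀ V : X.AffineIn U, IsDefect (P.bracket V.1.1) (ε.comp φ) t (L.ideal V) fun f a => G V f ![a]

variable (h : IsSmall ε φ t) (L L' L'' : FlatLifting η φ U)

include h in
theorem exists_isDiff : ∃ ψ : X.sections 0 U, IsDiff t L L' ψ.1 := by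
  choose ψ hψ using fun V : X.AffineIn U =>
    exists_isDifference h (η.isDeformation V.1) (L.isLift V) (L'.isLift V)
  -- the conditions on the `0` arguments of a cochain of degree `0` are void
  suffices hs : X.IsSection 0 U fun V f _ => ψ V f from ⟨⟨_, hs⟩, hψ⟩
  constructor
  · exact fun V f g _ => (hψ V).map_add h (η.isDeformation V.1) (L.isLift V) (L'.isLift V) f g
  · exact fun V b f _ => (hψ V).map_smul h (η.isDeformation V.1) (L.isLift V) (L'.isLift V) b f
  · exact fun V f a i => i.elim0
  · exact fun V f a i => i.elim0
  · exact fun V f a i => i.elim0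
  · exact fun V f a i => i.elim0
  · intro V W hWV f a
    obtain ⟨F, hF, F', hF', c, hr, e⟩ :=
      (L.isLift V).exists_lifts h (η.isDeformation V.1) (L'.isLift V) f
    rw [hψ V f F F' c hF hF' hr e]
    refine (hψ W (X.resIdeal hWV f) (Y.tensorRes B hWV F) (Y.tensorRes B hWV F') (Y.res hWV c)
      (L.tensorRes_mem hWV hF) (L'.tensorRes_mem hWV hF') ?_ ?_).symm
    · exact (Y.tensorReduce_tensorRes (ε.comp φ) hWV F).trans (congrArg (Y.res hWV) hr)
    · rw [e, map_add, NonsingularVariety.tensorRes_tmul]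

/-- The difference of two liftings. -/
def diff : X.sections 0 U := (exists_isDiff h L L').choose

theorem isDiff_diff : IsDiff t L L' (diff h L L').1 := (exists_isDiff h L L').choose_spec

variable {L L' L''} in
include h in
theorem IsDiff.unique {ψ ψ' : X.Cochain 0 U} (hψ : IsDiff t L L' ψ) (hψ' : IsDiff t L L' ψ') :
    ψ = ψ' := by
  funext V f a
  rw [Subsingleton.elim a ![]]
  exact congrFun ((hψ V).unique h (η.isDeformation V.1) (L.isLift V) (L'.isLift V) (hψ' V)) f

/-- The additivity of differences, which is the Čech cocycle condition on the components `h`. -/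
theorem diff_add_diff : diff h L L' + diff h L' L'' = diff h L L'' := by
  refine Subtype.ext (IsDiff.unique h (fun V => ?_) (isDiff_diff h L L''))
  exact (isDiff_diff h L L' V).trans h (L.isLift V) (L'.isLift V) (isDiff_diff h L' L'' V)

theorem resSection_diff (hW : W ≤ U) :
    X.resSection 0 hW (diff h L L') = diff h (L.restrict hW) (L'.restrict hW) :=
  Subtype.ext (IsDiff.unique h (fun V => isDiff_diff h L L' ⟨V.1, V.2.trans hW⟩)
    (isDiff_diff h (L.restrict hW) (L'.restrict hW)))

theorem diff_self : diff h L L = 0 :=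
  Subtype.ext (IsDiff.unique h (isDiff_diff h L L)
    fun V => isDifference_self h (η.isDeformation V.1) (L.isLift V))

variable {L L'} in
theorem ideal_eq_of_diff_eq_zero (h0 : diff h L L' = 0) (V : X.AffineIn U) :
    L.ideal V = L'.ideal V :=
  (isDiff_diff h L L' V).eq_of_eq_zero h (η.isDeformation V.1) (L.isLift V) (L'.isLift V)
    fun f => by rw [h0]; rfl

theorem _root_.Fin.update_fin_one {α : Type*} (a : Fin 1 → α) (i : Fin 1) (b : α) :
    Function.update a i b = ![b] := by
  funext j
  rw [Subsingleton.elim i 0, Subsingleton.elim j 0, Function.update_self]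
  rfl

include h in
theorem exists_isDef : ∃ G : X.sections 1 U, IsDef t L G.1 := by
  have hP := fun V : X.AffineIn U => η.bracketWith_mem V.1
  have hβ := fun V : X.AffineIn U => P.isPoissonBracket V.1.1
  choose G hG using fun V : X.AffineIn U =>
    exists_isDefect h (η.isDeformation V.1) (hP V) (L.isLift V)
  refine ⟨⟨fun V f a => G V f (a 0), ?_⟩, hG⟩
  constructor
  · exact fun V f g a => (hG V).map_add h (η.isDeformation V.1) (hP V) (L.isLift V) f g (a 0)
  · exact fun V b f a =>
      (hG V).map_smul h (η.isDeformation V.1) (hβ V) (hP V) (L.isLift V) b f (a 0)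
  · intro V f a i b c
    simp only [Fin.update_fin_one, Matrix.cons_val_zero]
    exact (hG V).add_right h (η.isDeformation V.1) (hP V) (L.isLift V) f b c
  · intro V f a i r b
    simp only [Fin.update_fin_one, Matrix.cons_val_zero]
    exact (hG V).smul_right h (η.isDeformation V.1) (hP V) (L.isLift V) f r b
  · intro V f a i b c
    simp only [Fin.update_fin_one, Matrix.cons_val_zero]
    exact (hG V).mul_right h (η.isDeformation V.1) (hβ V) (hP V) (L.isLift V) f b c
  · exact fun V f a i j hij => absurd (Subsingleton.elim i j) hij
  · intro V W hWV f a
    obtain ⟨F, hF, K, hK, c, hr, e⟩ :=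
      (L.isLift V).exists_bracket_lifts h (η.isDeformation V.1) (hP V) f (a 0)
    rw [hG V f F K (a 0) c hF hK hr e]
    refine (hG W (X.resIdeal hWV f) (Y.tensorRes B hWV F) (Y.tensorRes B hWV K)
      (Y.res hWV (a 0)) (Y.res hWV c)
      (L.tensorRes_mem hWV hF) (L.tensorRes_mem hWV hK) ?_ ?_).symm
    · exact (Y.tensorReduce_tensorRes (ε.comp φ) hWV F).trans (congrArg (Y.res hWV) hr)
    · rw [P.bracketWith_tensorRes, e, map_add, NonsingularVariety.tensorRes_tmul]

/-- The failure of a lifting to be Poisson. -/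
def defect : X.sections 1 U := (exists_isDef h L).choose

theorem isDef_defect : IsDef t L (defect h L).1 := (exists_isDef h L).choose_spec

variable {L} in
include h in
theorem IsDef.unique {G G' : X.Cochain 1 U} (hG : IsDef t L G) (hG' : IsDef t L G') : G = G' := by
  funext V f a
  have ha : a = ![a 0] := by ext i; fin_cases i; rfl
  rw [ha]
  exact congrFun (congrFun ((hG V).unique h (η.isDeformation V.1)
    (η.bracketWith_mem V.1) (L.isLift V) (hG' V)) f) (a 0)

theorem resSection_defect (hW : W ≤ U) :
    X.resSection 1 hW (defect h L) = defect h (L.restrict hW) :=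
  Subtype.ext (IsDef.unique h (fun V => isDef_defect h L ⟨V.1, V.2.trans hW⟩)
    (isDef_defect h (L.restrict hW)))

/-- The defect is closed, by the Jacobi identity. -/
theorem nabla_defect : X.nabla 1 U (defect h L).1 = 0 := by
  funext V f a
  have ha : a = ![a 0, a 1] := by ext i; fin_cases i <;> rfl
  rw [ha, X.nabla_one_apply]
  obtain ⟨c, hc⟩ := Ideal.Quotient.mk_surjective ((defect h L).1 V f ![a 0])
  obtain ⟨d, hd⟩ := Ideal.Quotient.mk_surjective ((defect h L).1 V f ![a 1])
  rw [← hc, ← hd, ham_mk, ham_mk]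
  exact (isDef_defect h L V).bracket_right h (η.isDeformation V.1) (P.isPoissonBracket V.1.1)
    (η.bracketWith_mem V.1) (fun a f hf => X.bracket_mem V.1 a f hf) (L.isLift V) f (a 0) (a 1) c d
    hc.symm hd.symm

/-- The differential of a difference of liftings is the difference of their defects. -/
theorem nablaZero_diff : X.nablaZero U (diff h L L') = defect h L' - defect h L := by
  refine Subtype.ext ?_
  funext V f a
  have ha : a = ![a 0] := by ext i; fin_cases i; rfl
  change X.nabla 0 U (diff h L L').1 V f a = (defect h L').1 V f a - (defect h L).1 V f a
  rw [X.nabla_zero_apply, ha]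
  obtain ⟨c, hc⟩ := Ideal.Quotient.mk_surjective ((diff h L L').1 V f ![])
  rw [← hc]
  exact (isDiff_diff h L L' V).nabla_eq h (η.isDeformation V.1) (P.isPoissonBracket V.1.1)
    (η.bracketWith_mem V.1) (fun a f hf => X.bracket_mem V.1 a f hf) (L.isLift V) (L'.isLift V)
    (isDef_defect h L V) (isDef_defect h L' V) f (a 0) c hc.symm

variable {L} in
theorem bracketWith_mem_of_defect_eq_zero (h0 : defect h L = 0) (V : X.AffineIn U)
    (a : Γ(Y.scheme, V.1.1)) :
    ∀ F ∈ L.ideal V, bracketWith B (P.bracket V.1.1) a F ∈ L.ideal V :=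
  fun _ hF => (isDef_defect h L V).bracketWith_mem h (η.isDeformation V.1)
    (η.bracketWith_mem V.1) (L.isLift V) (fun f a => by rw [h0]; rfl) a hF

variable {L} in
theorem defect_eq_zero (hL : ∀ (V : X.AffineIn U) (a : Γ(Y.scheme, V.1.1)),
    ∀ F ∈ L.ideal V, bracketWith B (P.bracket V.1.1) a F ∈ L.ideal V) : defect h L = 0 :=
  Subtype.ext (IsDef.unique h (isDef_defect h L) fun V =>
    isDefect_zero h (η.isDeformation V.1) (L.isLift V) (hL V))

section Twist

variable [IsLocalRing A] (ψ : X.sections 0 U)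

/-- A section of the normal sheaf, as a linear map on the ideal of `X` over an affine open. -/
def _root_.PoissonSubscheme.sectionLinearMap (V : X.AffineIn U) :
    X.ideal.ideal V.1 →ₗ[Γ(Y.scheme, V.1.1)] X.Fun V.1 where
  toFun f := ψ.1 V f ![]
  map_add' f g := ψ.2.map_add V f g ![]
  map_smul' b f := ψ.2.map_smul V b f ![]

/-- The lifting obtained from `L` by moving it along the section `ψ` of the normal sheaf. -/
def twist : FlatLifting η φ U where
  ideal V := FlatLift.twist h (L.ideal V) (sectionLinearMap ψ V)
  isLift V := isLift_twist h (η.isDeformation V.1) (L.isLift V) _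
  tensorRes_mem := by
    rintro V W hWV F' ⟨F, hF, f, c, hr, hc, e⟩
    refine ⟨Y.tensorRes B hWV F, L.tensorRes_mem hWV hF, X.resIdeal hWV f, Y.res hWV c, ?_, ?_, ?_⟩
    · exact (Y.tensorReduce_tensorRes (ε.comp φ) hWV F).trans (congrArg (Y.res hWV) hr)
    · have h1 := ψ.2.compatible V W hWV f ![]
      rw [show ψ.1 V f ![] = _ from hc] at h1
      refine Eq.trans ?_ h1.symm
      exact congrArg (ψ.1 W (X.resIdeal hWV f)) (Subsingleton.elim _ _)
    · rw [e, map_add, NonsingularVariety.tensorRes_tmul]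

/-- Every section of the normal sheaf is a difference of liftings. -/
theorem diff_twist : diff h L (L.twist h ψ) = ψ :=
  Subtype.ext (IsDiff.unique h (isDiff_diff h L _) fun V =>
    isDifference_twist h (η.isDeformation V.1) (L.isLift V) (sectionLinearMap ψ V))

end Twist

end FlatLifting
end

/-! ### Gluing liftings to a deformation -/

noncomputable section

open FlatLift PoissonSubscheme

variable {k : Type u} [Field k] {Y : NonsingularVariety k}
  {P : PoissonStructure Y} {X : PoissonSubscheme P}
  {A B : Type u} [CommRing A] [Algebra k A] [CommRing B] [Algebra k B] {ε : A →ₐ[k] k}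
  {φ : B →ₐ[k] A} {t : B}

theorem AlgebraicGeometry.Scheme.IdealSheafData.ideal_eq_top_of_disjoint {Z : Scheme.{u}}
    (I : Z.IdealSheafData) (U : Z.affineOpens) (h : ∀ x ∈ U.1, x ∉ I.support) :
    I.ideal U = ⊤ := by
  have h1 := U.2.fromSpec_image_zeroLocus (I.ideal U)
  rw [← I.coe_support_inter U, Set.eq_empty_of_forall_notMem (s := (I.support : Set Z) ∩ U.1)
    fun x hx => h x hx.2 hx.1] at h1
  exact PrimeSpectrum.zeroLocus_empty_iff_eq_top.mp (Set.image_eq_empty.mp h1)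

namespace FlatLift

/-- A lifting of the empty family is empty. -/
theorem IsLift.eq_top {R : Type u} [CommRing R] [Algebra k R] {I : Ideal R}
    {J₀ : Ideal (A ⊗[k] R)} {J : Ideal (B ⊗[k] R)} (h : IsSmall ε φ t)
    (h₀ : IsDeformation ε I J₀) (hJ : IsLift φ J₀ J) (hI : I = ⊤) : J = ⊤ := by
  have h1 : IsDeformation ε I (⊤ : Ideal (A ⊗[k] R)) :=
    ⟨inferInstance, by rw [hI, Ideal.map_top]⟩
  have h2 : J₀ = ⊤ := h1.eq_of_le h.isNilpotent h₀.map_reduce le_top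
  have h3 : IsLift φ J₀ (⊤ : Ideal (B ⊗[k] R)) := ⟨inferInstance, by rw [h2, Ideal.map_top]⟩
  exact IsLift.eq_of_le h h₀ hJ h3 le_top

end FlatLift

namespace FlatLift.IsLift

variable {η : InfDeformation X A ε}

theorem map_tensorRes {V W : Y.scheme.affineOpens} (hWV : W ≤ V)
    {J : Ideal (B ⊗[k] Γ(Y.scheme, V.1))} (hJ : IsLift φ (Y.pulledIdeal η.ideal V) J) :
    IsLift φ (Y.pulledIdeal η.ideal W) (J.map (Y.tensorRes B hWV)) where
  flat := Y.flat_map_tensorRes hWV hJ.flat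
  map_base := (Y.map_tensorRes_map_tensorBase φ hWV J).trans
    ((congrArg (fun K => Ideal.map (Y.tensorRes A hWV) K) hJ.map_base).trans
      (Y.pulledIdeal_map_res η.ideal hWV))

end FlatLift.IsLift

namespace FlatLifting

variable {η : InfDeformation X A ε} {U : Y.scheme.Opens}

/-- The lifting over an affine open defined by an ideal. -/
def ofIdeal (V : Y.scheme.affineOpens) (J : Ideal (B ⊗[k] Γ(Y.scheme, V.1)))
    (hJ : IsLift φ (Y.pulledIdeal η.ideal V) J) : FlatLifting η φ V.1 where
  ideal W := J.map (Y.tensorRes B W.2)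
  isLift W := hJ.map_tensorRes W.2
  tensorRes_mem {W W'} h F hF := by
    have h1 := Ideal.mem_map_of_mem (Y.tensorRes B h) hF
    rwa [Y.map_tensorRes_map_tensorRes] at h1

/-- The restriction of a lifting of `η`. -/
def ofInfDeformation (η' : InfDeformation X B (ε.comp φ)) (h : η'.IsLifting φ η)
    (U : Y.scheme.Opens) : FlatLifting η φ U where
  ideal V := Y.pulledIdeal η'.ideal V.1
  isLift V := ⟨Y.flat_pulledIdeal η'.flat V.1,
    (Y.pulledIdeal_map_base φ η'.ideal V.1).trans (by rw [h])⟩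
  tensorRes_mem {V W} h F hF := by
    rw [← Y.pulledIdeal_map_res η'.ideal h]
    exact Ideal.mem_map_of_mem _ hF

/-- The ideals of a lifting are quasi-coherent: restriction to a smaller affine open extends them,
because a lifting contained in another one is equal to it. -/
theorem map_tensorRes (h : IsSmall ε φ t) (L : FlatLifting η φ U) {V W : X.AffineIn U}
    (hWV : W.1 ≤ V.1) : (L.ideal V).map (Y.tensorRes B hWV) = L.ideal W :=
  IsLift.eq_of_le h (η.isDeformation W.1) ((L.isLift V).map_tensorRes hWV) (L.isLift W)
    (Ideal.map_le_iff_le_comap.mpr fun _ hF => L.tensorRes_mem hWV hF)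

end FlatLifting

instance : CompactSpace Y.scheme :=
  (quasiCompact_iff_compactSpace Y.str).mp inferInstance

/-- Finitely many liftings over affine opens which agree on overlaps define an ideal sheaf; away
from `X` it is the unit ideal. -/
theorem exists_idealSheafData (h : IsSmall ε φ t) {η : InfDeformation X A ε} {ι : Type*} [Finite ι]
    (U : ι → Y.scheme.affineOpens) (L : ∀ i, FlatLifting η φ (U i).1)
    (hL : ∀ i j (V : Y.scheme.affineOpens) (hi : V.1 ≤ (U i).1) (hj : V.1 ≤ (U j).1),
      (L i).ideal ⟨V, hi⟩ = (L j).ideal ⟨V, hj⟩) :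
    ∃ 𝒥 : (Y.prodSpec B).IdealSheafData,
      (∀ (W : Y.scheme.affineOpens) (F : B ⊗[k] Γ(Y.scheme, W.1)),
        F ∈ Y.pulledIdeal 𝒥 W ↔ ∀ i, Y.tensorRes B (inf_le_right : (U i).1 ⊓ W.1 ≤ W.1) F ∈
          (L i).ideal ⟨⟨(U i).1 ⊓ W.1, (U i).2.inf W.2⟩, inf_le_left⟩) ∧
      (∀ i (W : X.AffineIn (U i).1), Y.pulledIdeal 𝒥 W.1 = (L i).ideal W) ∧
      ∀ W : Y.scheme.affineOpens, X.ideal.ideal W = ⊤ → Y.pulledIdeal 𝒥 W = ⊤ := by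
  let J : ∀ i, Ideal (B ⊗[k] Γ(Y.scheme, (U i).1)) := fun i => (L i).ideal ⟨U i, le_rfl⟩
  have hJm : ∀ i (W : X.AffineIn (U i).1), (J i).map (Y.tensorRes B W.2) = (L i).ideal W :=
    fun i W => (L i).map_tensorRes h (V := ⟨U i, le_rfl⟩) W.2
  have hinf : ∀ i (W : Y.scheme.affineOpens), IsAffineOpen ((U i).1 ⊓ W.1) :=
    fun i W => (U i).2.inf W.2
  have hJ : ∀ i j, (J i).map (Y.tensorRes B (inf_le_left : (U i).1 ⊓ (U j).1 ≤ (U i).1)) =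
      (J j).map (Y.tensorRes B (inf_le_right : (U i).1 ⊓ (U j).1 ≤ (U j).1)) := fun i j =>
    (hJm i ⟨⟨_, hinf i (U j)⟩, inf_le_left⟩).trans
      ((hL i j _ _ _).trans (hJm j ⟨⟨_, hinf i (U j)⟩, inf_le_right⟩).symm)
  refine ⟨Y.glue U J, fun W F => ?_, fun i W => ?_, fun W hW => ?_⟩
  · rw [Y.mem_pulledIdeal_glue]
    exact forall_congr' fun i => iff_of_eq (congrArg (fun K => Y.tensorRes B _ F ∈ K)
      (hJm i ⟨⟨_, hinf i W⟩, inf_le_left⟩))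
  · exact (Y.pulledIdeal_glue_of_le hJ W.2).trans (hJm i W)
  · refine Y.pulledIdeal_glue_eq_top fun i => (hJm i ⟨⟨_, hinf i W⟩, inf_le_left⟩).trans ?_
    refine ((L i).isLift _).eq_top h (η.isDeformation _) ?_
    have hle : (⟨_, hinf i W⟩ : Y.scheme.affineOpens) ≤ W := inf_le_right (a := (U i).1)
    exact (X.ideal.map_ideal hle).symm.trans (by rw [hW, Ideal.map_top])

/-- Poisson liftings on the members of a covering of `X` which agree on overlaps come from a
deformation: by compactness, finitely many of them over affine opens determine it. -/
theorem exists_infDeformation (h : IsSmall ε φ t) {η : InfDeformation X A ε} (𝒱 : X.Covering)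
    (L : ∀ x, FlatLifting η φ (𝒱.opens x))
    (hL : ∀ x y (V : Y.scheme.affineOpens) (hx : V.1 ≤ 𝒱.opens x) (hy : V.1 ≤ 𝒱.opens y),
      (L x).ideal ⟨V, hx⟩ = (L y).ideal ⟨V, hy⟩)
    (hP : ∀ x (V : X.AffineIn (𝒱.opens x)) (a : Γ(Y.scheme, V.1.1)),
      ∀ F ∈ (L x).ideal V, bracketWith B (P.bracket V.1.1) a F ∈ (L x).ideal V) :
    ∃ η' : InfDeformation X B (ε.comp φ), η'.IsLifting φ η ∧
      ∀ x (V : X.AffineIn (𝒱.opens x)), Y.pulledIdeal η'.ideal V.1 = (L x).ideal V := by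
  have hex : ∀ x : X.ideal.support, ∃ V : Y.scheme.affineOpens, x.1 ∈ V.1 ∧ V.1 ≤ 𝒱.opens x := by
    intro x
    obtain ⟨_, ⟨V, hV, rfl⟩, hxV, hle⟩ :=
      Y.scheme.isBasis_affineOpens.exists_subset_of_mem_open (𝒱.mem x) (𝒱.opens x).2
    exact ⟨⟨V, hV⟩, hxV, hle⟩
  choose V hxV hV using hex
  -- ideal sheaves can be intersected only finitely many at a time
  have hc : IsCompact (X.ideal.support : Set Y.scheme) := X.ideal.support.isClosed.isCompact
  obtain ⟨s, hs⟩ := hc.elim_finite_subcover (fun x : X.ideal.support => ((V x).1 : Set Y.scheme))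
    (fun x => (V x).1.2) (fun y hy => Set.mem_iUnion.mpr ⟨⟨y, hy⟩, hxV ⟨y, hy⟩⟩)
  obtain ⟨𝒥, hmem, hle, htop⟩ := exists_idealSheafData h (fun i : s => V i)
    (fun i => (L i).restrict (hV i)) (fun i j W hi hj => hL _ _ _ _ _)
  -- the affine opens over which the glued ideal is visibly a lifting
  let T := {W : Y.scheme.affineOpens // (∃ i : s, W.1 ≤ (V i).1) ∨ X.ideal.ideal W = ⊤}
  have hT : ⨆ W : T, W.1.1 = (⊤ : Y.scheme.Opens) := by
    refine eq_top_iff.mpr fun y _ => ?_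
    rw [Opens.mem_iSup]
    by_cases hy : y ∈ X.ideal.support
    · obtain ⟨i, hi, hyi⟩ := Set.mem_iUnion₂.mp (hs hy)
      exact ⟨⟨V i, Or.inl ⟨⟨i, hi⟩, le_rfl⟩⟩, hyi⟩
    · obtain ⟨_, ⟨W, hW, rfl⟩, hyW, hle⟩ :=
        Y.scheme.isBasis_affineOpens.exists_subset_of_mem_open (u := (X.ideal.support : Set _)ᶜ) hy
          X.ideal.support.isClosed.isOpen_compl
      exact ⟨⟨⟨W, hW⟩, Or.inr (X.ideal.ideal_eq_top_of_disjoint ⟨W, hW⟩ fun x hx => hle hx)⟩, hyW⟩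
  have hlift : ∀ W : T, IsLift φ (Y.pulledIdeal η.ideal W.1) (Y.pulledIdeal 𝒥 W.1) := by
    rintro ⟨W, ⟨i, hW⟩ | hW⟩
    · exact (congrArg (IsLift φ _) (hle i ⟨W, hW⟩)).mpr
        (((L i).restrict (hV i)).isLift ⟨W, hW⟩)
    -- off `X` the deformation and the glued ideal are both the unit ideal
    · have h0 : Y.pulledIdeal η.ideal W = ⊤ := by
        have h1 : IsDeformation ε (X.ideal.ideal W) (⊤ : Ideal (A ⊗[k] Γ(Y.scheme, W.1))) :=
          ⟨inferInstance, by rw [hW, Ideal.map_top]⟩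
        exact h1.eq_of_le h.isNilpotent (η.isDeformation W).map_reduce le_top
      exact (congrArg₂ (IsLift φ) h0 (htop W hW)).mpr ⟨inferInstance, Ideal.map_top _⟩
  have hflat : Flat (𝒥.subschemeι ≫ Y.prodSnd B) :=
    Y.flat_of_flat_pulledIdeal (fun W : T => W.1) hT fun W => (hlift W).flat
  have hbase : 𝒥.comap (Y.prodMap φ) = η.ideal := Y.idealSheaf_ext (fun W : T => W.1) hT fun W =>
    (Y.pulledIdeal_map_base φ 𝒥 W.1).symm.trans (hlift W).map_base
  refine ⟨⟨𝒥, hflat, ?_, fun W F H hF => ?_⟩, hbase, fun x W => ?_⟩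
  · refine Scheme.IdealSheafData.ext_of_iSup_eq_top (fun W : T => W.1) hT fun W => ?_
    exact (Y.pulledIdeal_map_reduce (ε.comp φ) 𝒥 W.1).symm.trans
      ((hlift W).isDeformation (η.isDeformation W.1)).map_reduce
  -- membership in the glued ideal is tested in the Poisson ideals over the opens `V i ⊓ W`
  · refine (baseChange_mem_iff (P.isPoissonBracket W.1) _).mpr (fun a F hF => ?_) F H hF
    rw [hmem] at hF ⊢
    intro i
    rw [← P.bracketWith_tensorRes]
    exact hP _ _ _ _ (hF i)
  -- over an open of the covering which is not in the finite subfamily, both are liftings of `η`,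
  -- and one of them contains the other
  · refine (IsLift.eq_of_le h (η.isDeformation W.1) ((L x).isLift W)
      ⟨Y.flat_pulledIdeal hflat W.1, (Y.pulledIdeal_map_base φ 𝒥 W.1).trans (by rw [hbase])⟩
      fun F hF => ?_).symm
    rw [hmem]
    intro i
    have hi : IsAffineOpen ((V i).1 ⊓ W.1.1) := (V i).2.inf W.1.2
    refine (hL x i ⟨_, hi⟩ (inf_le_right.trans W.2) (inf_le_left.trans (hV i))).le ?_
    exact (L x).tensorRes_mem (V := W) (W := ⟨⟨_, hi⟩, inf_le_right.trans W.2⟩)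
      (inf_le_right : (V i).1 ⊓ W.1.1 ≤ W.1.1) hF
end

/-! ### The Čech cocycle of a family of local liftings -/

noncomputable section

namespace PoissonSubscheme

section Colimit

variable {k : Type u} [Field k] {Y : NonsingularVariety k}
  {P : PoissonStructure Y} {X : PoissonSubscheme P}

/-- The common refinement of two coverings by pairwise intersections. -/
def Covering.inf (𝒰 𝒱 : X.Covering) : X.Covering where
  opens x := 𝒰.opens x ⊓ 𝒱.opens x
  mem x := ⟨𝒰.mem x, 𝒱.mem x⟩

theorem Covering.inf_le_left (𝒰 𝒱 : X.Covering) : 𝒰.inf 𝒱 ≤ 𝒰 := fun _ => _root_.inf_le_left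

theorem Covering.inf_le_right (𝒰 𝒱 : X.Covering) : 𝒰.inf 𝒱 ≤ 𝒱 := fun _ => _root_.inf_le_right

instance : IsDirectedOrder X.Coveringᵒᵈ where
  directed 𝒰 𝒱 := ⟨OrderDual.toDual ((OrderDual.ofDual 𝒰).inf (OrderDual.ofDual 𝒱)),
    Covering.inf_le_left _ _, Covering.inf_le_right _ _⟩

instance : DirectedSystem
    (fun 𝒰 : X.Coveringᵒᵈ => Z1 (OrderDual.ofDual 𝒰) ⧸ B1 (OrderDual.ofDual 𝒰))
    fun _ _ h => refineH (OrderDual.ofDual_le_ofDual.mpr h) where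
  map_self 𝒰 z := by
    obtain ⟨z, rfl⟩ := Submodule.mkQ_surjective _ z
    rfl
  map_map 𝒰 𝒱 𝒲 h h' z := by
    obtain ⟨z, rfl⟩ := Submodule.mkQ_surjective _ z
    rfl

theorem classH1_refineZ {𝒰 𝒱 : X.Covering} (h : 𝒱 ≤ 𝒰) (z : Z1 𝒰) :
    classH1 𝒱 (refineZ h z) = classH1 𝒰 z := by
  classical
  exact Module.DirectLimit.of_f (R := k) (ι := X.Coveringᵒᵈ)
    (G := fun 𝒰 => Z1 (OrderDual.ofDual 𝒰) ⧸ B1 (OrderDual.ofDual 𝒰))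
    (f := fun _ _ h => refineH (OrderDual.ofDual_le_ofDual.mpr h))
    (i := OrderDual.toDual 𝒰) (j := OrderDual.toDual 𝒱) (hij := h) (x := (B1 𝒰).mkQ z)

/-- The coverings being directed under refinement, a class which vanishes in the colimit is already
a coboundary on some refinement. -/
theorem exists_refineZ_mem_of_classH1_eq_zero {𝒰 : X.Covering} {z : Z1 𝒰}
    (hz : classH1 𝒰 z = 0) : ∃ (𝒱 : X.Covering) (h : 𝒱 ≤ 𝒰), refineZ h z ∈ B1 𝒱 := by
  classical
  obtain ⟨𝒱, h, hz⟩ := Module.DirectLimit.of.zero_exact (R := k) (ι := X.Coveringᵒᵈ)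
    (G := fun 𝒰 => Z1 (OrderDual.ofDual 𝒰) ⧸ B1 (OrderDual.ofDual 𝒰))
    (f := fun _ _ h => refineH (OrderDual.ofDual_le_ofDual.mpr h))
    (i := OrderDual.toDual 𝒰) (x := (B1 𝒰).mkQ z) hz
  exact ⟨OrderDual.ofDual 𝒱, h, (Submodule.Quotient.mk_eq_zero _).mp hz⟩

theorem classH1_eq_zero_of_mem {𝒰 : X.Covering} {z : Z1 𝒰} (hz : z ∈ B1 𝒰) :
    classH1 𝒰 z = 0 := by
  classical
  have h : (B1 𝒰).mkQ z = (B1 𝒰).mkQ 0 := (Submodule.Quotient.eq _).mpr (by rwa [sub_zero])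
  exact (congrArg (Module.DirectLimit.of k X.Coveringᵒᵈ
    (fun 𝒰 => Z1 (OrderDual.ofDual 𝒰) ⧸ B1 (OrderDual.ofDual 𝒰))
    (fun _ _ h => refineH (OrderDual.ofDual_le_ofDual.mpr h)) (OrderDual.toDual 𝒰)) h).trans
    (map_zero (classH1 𝒰))

end Colimit

end PoissonSubscheme

open FlatLift PoissonSubscheme

namespace FlatLifting

variable {k : Type u} [Field k] {Y : NonsingularVariety k}
  {P : PoissonStructure Y} {X : PoissonSubscheme P}
  {A B : Type u} [CommRing A] [Algebra k A] [CommRing B] [Algebra k B] {ε : A →ₐ[k] k}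
  {φ : B →ₐ[k] A} {t : B} {η : InfDeformation X A ε} (h : IsSmall ε φ t)

/-- The cochain `(-G, h)` of a family of liftings on the members of a covering. -/
def cochain (𝒰 : X.Covering) (L : ∀ x, FlatLifting η φ (𝒰.opens x)) : C1 𝒰 :=
  (fun x => -defect h (L x),
    fun x y => diff h ((L x).restrict inf_le_left) ((L y).restrict inf_le_right))

/-- The three components of the cocycle condition are `∇ G = 0`, `∇ h = G_y - G_x` and the
additivity of differences. -/
theorem cochain_mem_Z1 (𝒰 : X.Covering) (L : ∀ x, FlatLifting η φ (𝒰.opens x)) :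
    cochain h 𝒰 L ∈ Z1 𝒰 := by
  rw [mem_Z1]
  refine ⟨fun x => ?_, fun x y => ?_, fun x y w => ?_⟩
  · change X.nabla 1 _ (-(defect h (L x)).1) = 0
    rw [map_neg, nabla_defect, neg_zero]
  · have h1 := congrArg Subtype.val (nablaZero_diff h ((L x).restrict
      (inf_le_left : 𝒰.opens x ⊓ 𝒰.opens y ≤ _)) ((L y).restrict inf_le_right))
    rw [← resSection_defect, ← resSection_defect] at h1
    change X.restrict 1 inf_le_right (-(defect h (L y)).1) -
      X.restrict 1 inf_le_left (-(defect h (L x)).1) + X.nabla 0 _ _ = 0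
    refine (congrArg _ h1).trans ?_
    change _ + (X.restrict 1 inf_le_right (defect h (L y)).1 -
      X.restrict 1 inf_le_left (defect h (L x)).1) = 0
    rw [map_neg, map_neg]
    abel
  · have hle : 𝒰.opens x ⊓ 𝒰.opens y ⊓ 𝒰.opens w ≤ 𝒰.opens x := inf_le_left.trans inf_le_left
    have hle' : 𝒰.opens x ⊓ 𝒰.opens y ⊓ 𝒰.opens w ≤ 𝒰.opens y := inf_le_left.trans inf_le_right
    have h1 := diff_add_diff h ((L x).restrict hle) ((L y).restrict hle')
      ((L w).restrict inf_le_right)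
    have h2 := resSection_diff h ((L y).restrict (inf_le_left : 𝒰.opens y ⊓ 𝒰.opens w ≤ _))
      ((L w).restrict inf_le_right)
      (le_inf hle' inf_le_right : 𝒰.opens x ⊓ 𝒰.opens y ⊓ 𝒰.opens w ≤ _)
    have h3 := resSection_diff h ((L x).restrict (inf_le_left : 𝒰.opens x ⊓ 𝒰.opens w ≤ _))
      ((L w).restrict inf_le_right)
      (le_inf hle inf_le_right : 𝒰.opens x ⊓ 𝒰.opens y ⊓ 𝒰.opens w ≤ _)
    have h4 := resSection_diff h ((L x).restrict (inf_le_left : 𝒰.opens x ⊓ 𝒰.opens y ≤ _))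
      ((L y).restrict inf_le_right)
      (inf_le_left : 𝒰.opens x ⊓ 𝒰.opens y ⊓ 𝒰.opens w ≤ _)
    have e : ∀ {a b c : X.sections 0 (𝒰.opens x ⊓ 𝒰.opens y ⊓ 𝒰.opens w)}, a + b = c →
        b - c + a = 0 := by
      rintro a b c rfl
      abel
    exact congrArg Subtype.val ((congrArg₂ (· + ·) (congrArg₂ (· - ·) h2 h3) h4).trans (e h1))

/-- The Čech cocycle `(-G, h)` of a family of liftings on the members of a covering. -/
def cocycle (𝒰 : X.Covering) (L : ∀ x, FlatLifting η φ (𝒰.opens x)) : Z1 𝒰 :=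
  ⟨cochain h 𝒰 L, cochain_mem_Z1 h 𝒰 L⟩

theorem refineZ_cocycle {𝒰 𝒱 : X.Covering} (hle : 𝒱 ≤ 𝒰) (L : ∀ x, FlatLifting η φ (𝒰.opens x)) :
    refineZ hle (cocycle h 𝒰 L) = cocycle h 𝒱 fun x => (L x).restrict (hle x) := by
  refine Subtype.ext (Prod.ext (funext fun x => ?_) (funext fun x => funext fun y => ?_))
  · exact congrArg Neg.neg (resSection_defect h (L x) (hle x))
  · exact resSection_diff h _ _ (inf_le_inf (hle x) (hle y))

/-- Changing the local liftings changes the cocycle by a coboundary. -/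
theorem cocycle_sub_cocycle (𝒰 : X.Covering) (L L' : ∀ x, FlatLifting η φ (𝒰.opens x)) :
    (cocycle h 𝒰 L).1 - (cocycle h 𝒰 L').1 = d0 𝒰 fun x => diff h (L x) (L' x) := by
  refine Prod.ext (funext fun x => ?_) (funext fun x => funext fun y => ?_)
  · refine Eq.trans ?_ (nablaZero_diff h (L x) (L' x)).symm
    exact neg_sub_neg _ _
  · have h1 := diff_add_diff h ((L x).restrict (inf_le_left : 𝒰.opens x ⊓ 𝒰.opens y ≤ _))
      ((L' x).restrict inf_le_left) ((L' y).restrict inf_le_right)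
    have h2 := diff_add_diff h ((L x).restrict (inf_le_left : 𝒰.opens x ⊓ 𝒰.opens y ≤ _))
      ((L y).restrict inf_le_right) ((L' y).restrict inf_le_right)
    have h3 := resSection_diff h (L x) (L' x) (inf_le_left : 𝒰.opens x ⊓ 𝒰.opens y ≤ _)
    have h4 := resSection_diff h (L y) (L' y) (inf_le_right : 𝒰.opens x ⊓ 𝒰.opens y ≤ _)
    refine Eq.trans ?_ (congrArg₂ (· - ·) h3 h4).symm
    exact sub_eq_sub_iff_add_eq_add.mpr (h2.trans h1.symm)

/-- The class of the cocycle depends neither on the covering nor on the local liftings. -/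
theorem classH1_cocycle_eq (𝒰 𝒰' : X.Covering) (L : ∀ x, FlatLifting η φ (𝒰.opens x))
    (L' : ∀ x, FlatLifting η φ (𝒰'.opens x)) :
    classH1 𝒰 (cocycle h 𝒰 L) = classH1 𝒰' (cocycle h 𝒰' L') := by
  rw [← classH1_refineZ (𝒰.inf_le_left 𝒰'), ← classH1_refineZ (𝒰.inf_le_right 𝒰'), ← sub_eq_zero,
    ← map_sub, refineZ_cocycle, refineZ_cocycle]
  exact classH1_eq_zero_of_mem ⟨_, Subtype.ext (cocycle_sub_cocycle h _ _ _).symm⟩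

/-- The obstruction class vanishes if and only if the deformation lifts: a trivialization of the
cocycle on a refinement moves the local liftings to Poisson liftings which agree on overlaps. -/
theorem classH1_cocycle_eq_zero_iff [IsLocalRing A] (𝒰 : X.Covering)
    (L : ∀ x, FlatLifting η φ (𝒰.opens x)) :
    classH1 𝒰 (cocycle h 𝒰 L) = 0 ↔ ∃ η' : InfDeformation X B (ε.comp φ), η'.IsLifting φ η := by
  constructor
  · intro hz
    obtain ⟨𝒱, hle, A, hA⟩ := exists_refineZ_mem_of_classH1_eq_zero hz
    rw [refineZ_cocycle] at hA
    let L' : ∀ x, FlatLifting η φ (𝒱.opens x) := fun x => ((L x).restrict (hle x)).twist h (A x)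
    -- the cocycle of the moved liftings `L'` is zero
    have h1 := cocycle_sub_cocycle h 𝒱 (fun x => (L x).restrict (hle x)) L'
    have h2 : (cocycle h 𝒱 fun x => (L x).restrict (hle x)).1 = d0 𝒱 A :=
      (congrArg Subtype.val hA).symm
    have h3 : (fun x => diff h ((L x).restrict (hle x)) (L' x)) = A :=
      funext fun x => diff_twist h _ (A x)
    rw [h3, h2, sub_eq_self] at h1
    have h4 : ∀ x, defect h (L' x) = 0 := fun x =>
      neg_eq_zero.mp (congrFun (congrArg Prod.fst h1) x)
    have h5 : ∀ x y, diff h ((L' x).restrict inf_le_left) ((L' y).restrict inf_le_right) = 0 :=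
      fun x y => congrFun (congrFun (congrArg Prod.snd h1) x) y
    obtain ⟨η', hη', -⟩ := exists_infDeformation h 𝒱 L'
      (fun x y V hx hy => ideal_eq_of_diff_eq_zero h (h5 x y) ⟨V, le_inf hx hy⟩)
      (fun x V a => bracketWith_mem_of_defect_eq_zero h (h4 x) V a)
    exact ⟨η', hη'⟩
  · rintro ⟨η', hη'⟩
    rw [classH1_cocycle_eq h 𝒰 𝒰 L fun x => ofInfDeformation η' hη' _]
    refine (congrArg (classH1 𝒰) (Subtype.ext (Prod.ext (funext fun x => ?_)
      (funext fun x => funext fun y => ?_)))).trans (map_zero (classH1 𝒰))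
    · exact neg_eq_zero.mpr (defect_eq_zero h fun V a F hF =>
        (baseChange_mem_iff (P.isPoissonBracket V.1.1) _).mp (η'.poisson V.1) a F hF)
    · exact diff_self h _

end FlatLifting

namespace LocalLiftings

variable {k : Type u} [Field k] {Y : NonsingularVariety k}
  {P : PoissonStructure Y} {X : PoissonSubscheme P}
  {A B : Type u} [CommRing A] [Algebra k A] [CommRing B] [Algebra k B] {ε : A →ₐ[k] k}
  {φ : B →ₐ[k] A} {t : B} {η : InfDeformation X A ε} (h : IsSmall ε φ t)
  (D : LocalLiftings η φ)

/-- The local lifting over `U_x`. -/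
def lifting (x : X.ideal.support) : FlatLifting η φ (D.cover.opens x) :=
  FlatLifting.ofIdeal ⟨_, D.isAffineOpen x⟩ (D.ideal x) ⟨D.flat x, D.lifts x⟩

/-- The conditions on `(-G, h)` say that `G` and `h` are the defects and the differences of the
local liftings, so they determine the cocycle and are satisfied by exactly one. -/
theorem represents_iff (z : Z1 D.cover) :
    D.Represents t z ↔ z = FlatLifting.cocycle h D.cover D.lifting := by
  constructor
  · intro hz
    refine Subtype.ext (Prod.ext (funext fun x => ?_) (funext fun x => funext fun y => ?_))
    · refine neg_eq_iff_eq_neg.mp (Subtype.ext (FlatLifting.IsDef.unique h (L := D.lifting x) ?_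
        (FlatLifting.isDef_defect h (D.lifting x))))
      intro V f F K a c hF hK hr e
      exact neg_eq_iff_eq_neg.mpr (hz.1 x V f F K a c hF hK hr e)
    · refine Subtype.ext (FlatLifting.IsDiff.unique h ?_ (FlatLifting.isDiff_diff h
        ((D.lifting x).restrict inf_le_left) ((D.lifting y).restrict inf_le_right)))
      intro V f F F' c hF hF' hr e
      exact hz.2 x y V f F F' c hF hF' hr e
  · rintro rfl
    refine ⟨fun x V f F K a c hF hK hr e => ?_, fun x y V f F F' c hF hF' hr e => ?_⟩
    · exact congrArg Neg.neg
        (FlatLifting.isDef_defect h (D.lifting x) V f F K a c hF hK hr e)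
    · exact FlatLifting.isDiff_diff h ((D.lifting x).restrict inf_le_left)
        ((D.lifting y).restrict inf_le_right) V f F F' c hF hF' hr e

end LocalLiftings
end

/-! ### Small extensions, local existence and constant families -/

noncomputable section

namespace FlatLift

variable {k : Type u} [Field k] {R : Type u} [CommRing R] [Algebra k R]
  {A B : Type u} [CommRing A] [Algebra k A] [CommRing B] [Algebra k B]

/-- The augmentation ideal is contained in the maximal ideal, which is nilpotent. -/
theorem isNilpotent_ker [IsLocalRing A] [IsArtinianRing A] (ε : A →ₐ[k] k) :
    IsNilpotent (RingHom.ker ε) := by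
  obtain ⟨n, hn⟩ := IsArtinianRing.isNilpotent_jacobson_bot (R := A)
  refine ⟨n, le_bot_iff.mp (le_trans ?_ hn.le)⟩
  rw [IsLocalRing.jacobson_eq_maximalIdeal ⊥ bot_ne_top]
  exact Ideal.pow_right_mono (IsLocalRing.le_maximalIdeal (RingHom.ker_ne_top _)) n

theorem _root_.IsSmallExtension.isSmall [IsLocalRing A] [IsArtinianRing A] [IsLocalRing B]
    {φ : B →ₐ[k] A} {t : B} (h : IsSmallExtension φ t) (ε : A →ₐ[k] k) : IsSmall ε φ t where
  surjective := h.surjective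
  ne_zero := h.ne_zero
  ker := h.ker
  annihilated m hm :=
    h.annihilated m (IsLocalRing.le_maximalIdeal (RingHom.ker_ne_top (ε.comp φ)) hm)
  isNilpotent := isNilpotent_ker ε

/-- Over the dual numbers, `ε` spans the kernel of the augmentation. -/
theorem isSmall_dualNumber :
    IsSmall (AlgHom.id k k) (TrivSqZeroExt.fstHom k k k) (DualNumber.eps : DualNumber k) where
  surjective r := ⟨TrivSqZeroExt.inl r, rfl⟩
  ne_zero h := one_ne_zero (congrArg TrivSqZeroExt.snd h)
  ker := by
    ext x
    rw [RingHom.mem_ker, Ideal.mem_span_singleton']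
    constructor
    · intro hx
      refine ⟨TrivSqZeroExt.inl x.snd, TrivSqZeroExt.ext ?_ ?_⟩
      · simpa using hx.symm
      · simp
    · rintro ⟨a, rfl⟩
      rw [map_mul]
      exact mul_zero _
  annihilated m hm := by
    have hm : m.fst = 0 := hm
    refine TrivSqZeroExt.ext ?_ ?_ <;> simp [hm]
  isNilpotent := ⟨1, by
    rw [pow_one]
    exact (RingHom.injective_iff_ker_eq_bot _).mp fun _ _ h => h⟩

/-- Equations of `I` lift first to equations of its deformation over `A`, then to `B ⊗ R`. -/
theorem exists_map_reduce_eq {ε : A →ₐ[k] k} {φ : B →ₐ[k] A} (hφ : Function.Surjective φ)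
    {I : Ideal R} {J₀ : Ideal (A ⊗[k] R)} (h₀ : IsDeformation ε I J₀) (fs : List R)
    (hfs : ∀ f ∈ fs, f ∈ I) : ∃ Fs : List (B ⊗[k] R), Fs.map (reduce R (ε.comp φ)) = fs ∧
      ∀ F ∈ Fs, base R φ F ∈ J₀ := by
  induction fs with
  | nil => exact ⟨[], rfl, by simp⟩
  | cons f fs ih =>
    obtain ⟨Fs, h1, h2⟩ := ih fun g hg => hfs g (List.mem_cons_of_mem _ hg)
    obtain ⟨F, hF, e⟩ := h₀.exists_reduce_eq (hfs f List.mem_cons_self)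
    obtain ⟨G, rfl⟩ := base_surjective hφ F
    refine ⟨G :: Fs, ?_, ?_⟩
    · rw [List.map_cons, h1, ← e, reduce_base]
    · rintro H (_ | ⟨_, hH⟩)
      · exact hF
      · exact h2 H hH

/-- A deformation of a regular sequence lifts, because any lifting of the equations is flat. -/
theorem exists_isLift [IsLocalRing B] {ε : A →ₐ[k] k} {φ : B →ₐ[k] A}
    (hφ : Function.Surjective φ) (hA : IsNilpotent (RingHom.ker ε))
    (hB : IsNilpotent (RingHom.ker (ε.comp φ))) {I : Ideal R} {J₀ : Ideal (A ⊗[k] R)}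
    (h₀ : IsDeformation ε I J₀) {fs : List R} (hfs : RingTheory.Sequence.IsWeaklyRegular R fs)
    (hI : I = Ideal.ofList fs) : ∃ J : Ideal (B ⊗[k] R), IsLift φ J₀ J := by
  obtain ⟨Fs, h1, h2⟩ := exists_map_reduce_eq hφ h₀ fs
    fun f hf => hI ▸ Ideal.subset_span hf
  subst h1
  have h3 := isDeformation_ofList hB Fs hfs
  rw [← hI] at h3
  -- over `A` the lifted equations define an ideal contained in `J₀` with the same reduction
  refine ⟨Ideal.ofList Fs, h3.flat, h₀.eq_of_le hA ?_ ?_⟩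
  · have e : (reduce R (ε.comp φ) : B ⊗[k] R →+* R) =
        (reduce R ε : A ⊗[k] R →+* R).comp (base R φ : B ⊗[k] R →+* A ⊗[k] R) :=
      RingHom.ext fun x => (reduce_base ε φ x).symm
    have h4 := Ideal.map_map (I := Ideal.ofList Fs) (base R φ : B ⊗[k] R →+* A ⊗[k] R)
      (reduce R ε : A ⊗[k] R →+* R)
    rw [← e] at h4
    exact h4.trans h3.map_reduce
  · rw [Ideal.map_le_iff_le_comap]
    exact Ideal.span_le.mpr h2

/-- The constant family is a deformation, with quotient `A ⊗ (R / I)`. -/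
theorem isDeformation_map_includeRight (ε : A →ₐ[k] k) (I : Ideal R) :
    IsDeformation ε I (I.map (Algebra.TensorProduct.includeRight : R →ₐ[k] A ⊗[k] R)) where
  flat := by
    let q : A ⊗[k] R →ₐ[A] A ⊗[k] (R ⧸ I) :=
      Algebra.TensorProduct.map (AlgHom.id A A) (Ideal.Quotient.mkₐ k I)
    have hq : Function.Surjective q := by
      intro y
      induction y with
      | zero => exact ⟨0, map_zero q⟩
      | tmul a r =>
        obtain ⟨r, rfl⟩ := Ideal.Quotient.mk_surjective r
        exact ⟨a ⊗ₜ r, Algebra.TensorProduct.map_tmul _ _ _ _⟩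
      | add x y hx hy =>
        obtain ⟨⟨x, rfl⟩, ⟨y, rfl⟩⟩ := And.intro hx hy
        exact ⟨x + y, map_add q x y⟩
    have hk : RingHom.ker q =
        I.map (Algebra.TensorProduct.includeRight : R →ₐ[k] A ⊗[k] R) := by
      have h := Algebra.TensorProduct.lTensor_ker (A := A) (Ideal.Quotient.mkₐ k I)
        Ideal.Quotient.mk_surjective
      have h' : RingHom.ker (Ideal.Quotient.mkₐ k I) = I := Ideal.Quotient.mkₐ_ker k I
      rw [h'] at h
      exact h
    rw [← hk]
    exact Module.Flat.of_linearEquiv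
      (Ideal.quotientKerAlgEquivOfSurjective (f := q) hq).toLinearEquiv
  map_reduce := by
    have e : (reduce R ε : A ⊗[k] R →+* R).comp
        (Algebra.TensorProduct.includeRight : R →ₐ[k] A ⊗[k] R) = RingHom.id R :=
      RingHom.ext fun r => by simp
    have h := Ideal.map_map (I := I) ((Algebra.TensorProduct.includeRight : R →ₐ[k] A ⊗[k] R) :
      R →+* A ⊗[k] R) (reduce R ε : A ⊗[k] R →+* R)
    rw [e, Ideal.map_id] at h
    exact h

theorem bracketWith_mem_map_includeRight {β : R →ₗ[k] R →ₗ[k] R} {I : Ideal R}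
    (hI : ∀ a, ∀ f ∈ I, β f a ∈ I) (a : R) :
    ∀ F ∈ I.map (Algebra.TensorProduct.includeRight : R →ₐ[k] A ⊗[k] R),
      bracketWith A β a F ∈ I.map (Algebra.TensorProduct.includeRight : R →ₐ[k] A ⊗[k] R) := by
  intro F hF
  obtain ⟨y, rfl⟩ := (Ideal.map_includeRight_eq (R := k) (A := A) I).le hF
  induction y with
  | zero => simp
  | tmul b f =>
    have h1 := Ideal.mul_mem_left _ (b ⊗ₜ[k] (1 : R)) (Ideal.mem_map_of_mem
      (Algebra.TensorProduct.includeRight : R →ₐ[k] A ⊗[k] R) (hI a f f.2))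
    rw [Algebra.TensorProduct.includeRight_apply, Algebra.TensorProduct.tmul_mul_tmul, one_mul,
      mul_one] at h1
    change bracketWith A β a (b ⊗ₜ (f : R)) ∈ _
    rwa [bracketWith_tmul]
  | add x y hx hy =>
    rw [map_add, map_add]
    refine add_mem (hx ?_) (hy ?_)
    · exact (Ideal.map_includeRight_eq (R := k) (A := A) I).ge ⟨x, rfl⟩
    · exact (Ideal.map_includeRight_eq (R := k) (A := A) I).ge ⟨y, rfl⟩

end FlatLift
end

/-! ### The trivial deformation and first-order deformations -/

noncomputable section

open FlatLift PoissonSubscheme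

variable {k : Type u} [Field k] {Y : NonsingularVariety k}
  {P : PoissonStructure Y} {X : PoissonSubscheme P}
  {A B : Type u} [CommRing A] [Algebra k A] [CommRing B] [Algebra k B]

/-- Local liftings exist: near each point of `X` the ideal is generated by a regular sequence. -/
theorem nonempty_localLiftings [IsLocalRing A] [IsArtinianRing A] [IsLocalRing B]
    [IsArtinianRing B] (hX : X.IsRegularEmbedding) {ε : A →ₐ[k] k} {φ : B →ₐ[k] A}
    (hφ : Function.Surjective φ) (η : InfDeformation X A ε) : Nonempty (LocalLiftings η φ) := by
  choose U hU fs hfs hI using fun x : X.ideal.support => hX x.1 x.2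
  choose J hJ using fun x => exists_isLift hφ (isNilpotent_ker ε) (isNilpotent_ker (ε.comp φ))
    (η.isDeformation (U x)) (hfs x).toIsWeaklyRegular (hI x)
  exact ⟨⟨⟨fun x => (U x).1, hU⟩, fun x => (U x).2, J, fun x => (hJ x).flat,
    fun x => (hJ x).map_base⟩⟩

theorem NonsingularVariety.pulledIdeal_comap_prodFst (I : Y.scheme.IdealSheafData)
    (U : Y.scheme.affineOpens) : Y.pulledIdeal (I.comap (Y.prodFst A)) U =
      (I.ideal U).map (Algebra.TensorProduct.includeRight :
        Γ(Y.scheme, U.1) →ₐ[k] A ⊗[k] Γ(Y.scheme, U.1)) := by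
  have h1 := I.ideal_comap_eq_map (Y.prodFst A) U
    ⟨Y.prodFst A ⁻¹ᵁ U.1, U.2.preimage (Y.prodFst A)⟩ le_rfl
  rw [← Scheme.Hom.app_eq_appLE] at h1
  have e : ((Y.prodFst A).app U.1).hom = (Y.prodSections A U.1).comp
      (Algebra.TensorProduct.includeRight :
        Γ(Y.scheme, U.1) →ₐ[k] A ⊗[k] Γ(Y.scheme, U.1)).toRingHom := by
    ext r
    refine Eq.trans ?_ (Y.prodSections_tmul A U.1 1 r).symm
    rw [map_one, one_mul]
  rw [e, ← Ideal.map_map] at h1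
  rw [pulledIdeal, h1]
  exact Ideal.comap_map_of_bijective _ (Y.prodSections_bijective A U)

/-- The trivial deformation `X × Spec A`. -/
def PoissonSubscheme.trivialDeformation (X : PoissonSubscheme P) (ε : A →ₐ[k] k) :
    InfDeformation X A ε where
  ideal := X.ideal.comap (Y.prodFst A)
  flat := Y.flat_of_flat_pulledIdeal (fun U : Y.scheme.affineOpens => U)
    (iSup_affineOpens_eq_top _) fun U => by
      rw [Y.pulledIdeal_comap_prodFst]
      exact (isDeformation_map_includeRight ε (X.ideal.ideal U)).flat
  fibre := by
    rw [← Scheme.IdealSheafData.comap_comp, NonsingularVariety.closedFibre, pullback.lift_fst,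
      Scheme.IdealSheafData.comap_id]
  poisson U F H hF := by
    rw [Y.pulledIdeal_comap_prodFst] at hF ⊢
    refine (baseChange_mem_iff (P.isPoissonBracket U.1) _).mpr (fun a F hF =>
      bracketWith_mem_map_includeRight (fun a f hf => ?_) a F hF) F H hF
    rw [(P.isPoissonBracket U.1).skew]
    exact neg_mem (X.bracket_mem U a f hf)

namespace InfDeformation

/-- An ideal sheaf on `Y × Spec k` is determined by its restriction to the closed fibre. -/
theorem eq_of_comap_closedFibre_id {J J' : (Y.prodSpec k).IdealSheafData}
    (h : J.comap (Y.closedFibre (AlgHom.id k k)) = J'.comap (Y.closedFibre (AlgHom.id k k))) :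
    J = J' := by
  refine Y.idealSheaf_ext (fun U : Y.scheme.affineOpens => U) (iSup_affineOpens_eq_top _)
    fun U => ?_
  -- over `k` the reduction is an isomorphism
  have e : ∀ x : k ⊗[k] Γ(Y.scheme, U.1), x = 1 ⊗ₜ reduce _ (AlgHom.id k k) x := by
    intro x
    induction x with
    | zero => simp
    | tmul a r => rw [reduce_tmul, AlgHom.id_apply, ← TensorProduct.smul_tmul, smul_eq_mul, mul_one]
    | add x y hx hy => rw [map_add, TensorProduct.tmul_add, ← hx, ← hy]
  have hb : Function.Bijective
      (reduce Γ(Y.scheme, U.1) (AlgHom.id k k) : k ⊗[k] Γ(Y.scheme, U.1) →+* Γ(Y.scheme, U.1)) :=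
    ⟨fun x y h => by rw [e x, e y]; exact congrArg _ h, reduce_surjective _⟩
  rw [← Ideal.comap_map_of_bijective _ hb (I := Y.pulledIdeal J U),
    ← Ideal.comap_map_of_bijective _ hb (I := Y.pulledIdeal J' U)]
  exact congrArg (Ideal.comap _) ((Y.pulledIdeal_map_reduce (AlgHom.id k k) J U).trans
    ((congrArg (fun K => K.ideal U) h).trans
      (Y.pulledIdeal_map_reduce (AlgHom.id k k) J' U).symm))

theorem _root_.NonsingularVariety.closedFibre_prodMap (ε : A →ₐ[k] k) (φ : B →ₐ[k] A) :
    Y.closedFibre ε ≫ Y.prodMap φ = Y.closedFibre (ε.comp φ) := by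
  refine pullback.hom_ext ?_ ?_
  · rw [NonsingularVariety.closedFibre, NonsingularVariety.prodMap, Category.assoc,
      pullback.lift_fst, pullback.lift_fst, NonsingularVariety.closedFibre, pullback.lift_fst]
  · rw [NonsingularVariety.closedFibre, NonsingularVariety.prodMap, Category.assoc,
      pullback.lift_snd, pullback.lift_snd_assoc, NonsingularVariety.closedFibre,
      pullback.lift_snd, Category.assoc, ← Spec.map_comp, ← CommRingCat.ofHom_comp]
    rfl

/-- A deformation over an augmented algebra `B` is a lifting of the trivial deformation over `k`. -/
theorem isLifting_trivialDeformation {ε : B →ₐ[k] k}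
    (η : InfDeformation X B ((AlgHom.id k k).comp ε)) :
    η.IsLifting ε (X.trivialDeformation (AlgHom.id k k)) := by
  refine eq_of_comap_closedFibre_id ?_
  rw [← Scheme.IdealSheafData.comap_comp, NonsingularVariety.closedFibre_prodMap, η.fibre]
  exact (X.trivialDeformation (AlgHom.id k k)).fibre.symm

end InfDeformation

namespace FlatLifting

variable {ε : A →ₐ[k] k} {φ : B →ₐ[k] A} {t : B} {η : InfDeformation X A ε}

theorem diff_swap (h : IsSmall ε φ t) {U : Y.scheme.Opens} (L L' : FlatLifting η φ U) :
    diff h L L' = -diff h L' L := by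
  rw [eq_neg_iff_add_eq_zero, diff_add_diff, diff_self]

theorem eq_of_ideal_ofInfDeformation_eq {η₁ η₂ : InfDeformation X B (ε.comp φ)}
    (h₁ : η₁.IsLifting φ η) (h₂ : η₂.IsLifting φ η)
    (h : (ofInfDeformation η₁ h₁ ⊤).ideal = (ofInfDeformation η₂ h₂ ⊤).ideal) : η₁ = η₂ :=
  InfDeformation.ext (Y.idealSheaf_ext (fun U : Y.scheme.affineOpens => U)
    (iSup_affineOpens_eq_top _) fun U => congrFun h ⟨U, le_top⟩)

theorem defect_ofInfDeformation (h : IsSmall ε φ t) (η' : InfDeformation X B (ε.comp φ))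
    (h' : η'.IsLifting φ η) (U : Y.scheme.Opens) : defect h (ofInfDeformation η' h' U) = 0 :=
  defect_eq_zero h fun V => η'.bracketWith_mem V.1

/-- A global Poisson lifting is a deformation. -/
theorem exists_ofInfDeformation_eq (h : IsSmall ε φ t) (L : FlatLifting η φ ⊤)
    (hL : defect h L = 0) : ∃ (η' : InfDeformation X B (ε.comp φ)) (h' : η'.IsLifting φ η),
      ofInfDeformation η' h' ⊤ = L := by
  obtain ⟨η', h', e⟩ := exists_infDeformation h ⟨fun _ => ⊤, fun _ => trivial⟩ (fun _ => L)
    (fun _ _ _ _ _ => rfl) fun _ => bracketWith_mem_of_defect_eq_zero h hL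
  refine ⟨η', h', FlatLifting.ext (funext fun V => ?_)⟩
  -- a covering is indexed by the points of `X`, so it is empty if `X` is; then all ideals are
  -- trivial
  rcases isEmpty_or_nonempty X.ideal.support with hX | ⟨⟨x⟩⟩
  · have hI : X.ideal.ideal V.1 = ⊤ :=
      X.ideal.ideal_eq_top_of_disjoint V.1 fun x _ hx => hX.false ⟨x, hx⟩
    exact (((ofInfDeformation η' h' ⊤).isLift V).eq_top h (η.isDeformation V.1) hI).trans
      ((L.isLift V).eq_top h (η.isDeformation V.1) hI).symm
  · exact e x V

/-- Both deformations are Poisson, so their difference `ψ` satisfies `∇ ψ = 0`. -/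
theorem diff_ofInfDeformation_mem_H0 (h : IsSmall ε φ t) {η₁ η₂ : InfDeformation X B (ε.comp φ)}
    (h₁ : η₁.IsLifting φ η) (h₂ : η₂.IsLifting φ η) :
    (diff h (ofInfDeformation η₁ h₁ ⊤) (ofInfDeformation η₂ h₂ ⊤)).1 ∈ X.H0 := by
  refine ⟨Subtype.prop _, ?_⟩
  have e := nablaZero_diff h (ofInfDeformation η₁ h₁ ⊤) (ofInfDeformation η₂ h₂ ⊤)
  rw [defect_ofInfDeformation, defect_ofInfDeformation, sub_zero] at e
  exact congrArg Subtype.val e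

/-- Moving the lifting `η₀` by a section `χ` with `∇ χ = 0` keeps it Poisson. -/
theorem exists_diff_ofInfDeformation_eq [IsLocalRing A] (h : IsSmall ε φ t)
    {η₀ : InfDeformation X B (ε.comp φ)} (h₀ : η₀.IsLifting φ η)
    (χ : X.sections 0 (⊤ : Y.scheme.Opens)) (hχ : X.nablaZero ⊤ χ = 0) :
    ∃ (η' : InfDeformation X B (ε.comp φ)) (h' : η'.IsLifting φ η),
      diff h (ofInfDeformation η' h' ⊤) (ofInfDeformation η₀ h₀ ⊤) = χ := by
  have h1 := diff_twist h (ofInfDeformation η₀ h₀ ⊤) (-χ)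
  have h2 : defect h ((ofInfDeformation η₀ h₀ ⊤).twist h (-χ)) = 0 := by
    have e := nablaZero_diff h (ofInfDeformation η₀ h₀ ⊤) ((ofInfDeformation η₀ h₀ ⊤).twist h (-χ))
    rw [h1, defect_ofInfDeformation, sub_zero] at e
    exact e.symm.trans ((LinearMap.map_neg (X.nablaZero ⊤) χ).trans (neg_eq_zero.mpr hχ))
  obtain ⟨η', h', e⟩ := exists_ofInfDeformation_eq h
    ((ofInfDeformation η₀ h₀ ⊤).twist h (-χ)) h2
  refine ⟨η', h', ?_⟩
  rw [e, diff_swap, h1, neg_neg]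

/-- Deformations lifting `η` correspond to the horizontal sections of the normal sheaf, once one of
them, `η₀`, is chosen as the origin. -/
def equivH0 [IsLocalRing A] (h : IsSmall ε φ t) (η₀ : InfDeformation X B (ε.comp φ))
    (h₀ : η₀.IsLifting φ η) : {η' : InfDeformation X B (ε.comp φ) // η'.IsLifting φ η} ≃ X.H0 :=
  Equiv.ofBijective (fun η' => ⟨_, diff_ofInfDeformation_mem_H0 h η'.2 h₀⟩) (by
    constructor
    · intro η₁ η₂ e
      have e' : diff h (ofInfDeformation η₁.1 η₁.2 ⊤) (ofInfDeformation η₀ h₀ ⊤) =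
          diff h (ofInfDeformation η₂.1 η₂.2 ⊤) (ofInfDeformation η₀ h₀ ⊤) :=
        Subtype.ext (congrArg (fun x : X.H0 => x.1) e)
      rw [← diff_add_diff h _ (ofInfDeformation η₂.1 η₂.2 ⊤), add_eq_right] at e'
      exact Subtype.ext (eq_of_ideal_ofInfDeformation_eq η₁.2 η₂.2
        (funext fun V => ideal_eq_of_diff_eq_zero h e' V))
    · rintro ⟨ψ, hψ, hψ'⟩
      obtain ⟨η', h', e⟩ := exists_diff_ofInfDeformation_eq h h₀ ⟨ψ, hψ⟩ (Subtype.ext hψ')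
      have e' : (diff h (ofInfDeformation η' h' ⊤) (ofInfDeformation η₀ h₀ ⊤)).1 = ψ :=
        congrArg Subtype.val e
      exact ⟨⟨η', h'⟩, Subtype.ext e'⟩)

theorem equivH0_apply [IsLocalRing A] (h : IsSmall ε φ t) (η₀ : InfDeformation X B (ε.comp φ))
    (h₀ : η₀.IsLifting φ η) (η' : {η' : InfDeformation X B (ε.comp φ) // η'.IsLifting φ η}) :
    IsDiff t (ofInfDeformation η'.1 η'.2 ⊤) (ofInfDeformation η₀ h₀ ⊤) (equivH0 h η₀ h₀ η').1 :=
  isDiff_diff h _ _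

end FlatLifting

open FlatLifting in
/-- If `t` spans the kernel of the augmentation of `B`, then all deformations over `B` are liftings
of the trivial deformation over `k`; the trivial deformation over `B` serves as the origin. -/
theorem exists_equiv_H0 (X : PoissonSubscheme P) {φ ε : B →ₐ[k] k} {t : B}
    (h : IsSmall (AlgHom.id k k) φ t) (hε : (AlgHom.id k k).comp φ = ε) :
    ∃ Φ : InfDeformation X B ε ≃ X.H0,
      ∀ (η : InfDeformation X B ε) (V : X.AffineIn ⊤) (f : X.ideal.ideal V.1)
        (g : Γ(Y.scheme, V.1.1)),
        (1 : B) ⊗ₜ[k] (f : Γ(Y.scheme, V.1.1)) + t ⊗ₜ[k] g ∈ Y.pulledIdeal η.ideal V.1 →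
          (Φ η).1 V f ![] = Ideal.Quotient.mk _ g := by
  subst hε
  let η₀ := X.trivialDeformation ((AlgHom.id k k).comp φ)
  refine ⟨(Equiv.subtypeUnivEquiv fun η => η.isLifting_trivialDeformation).symm.trans
    (equivH0 h η₀ η₀.isLifting_trivialDeformation), fun η V f g hF => ?_⟩
  -- `1 ⊗ f` lies in the trivial deformation, so `g` computes the difference at `f`
  refine equivH0_apply h η₀ η₀.isLifting_trivialDeformation
    ⟨η, η.isLifting_trivialDeformation⟩ V f _ (1 ⊗ₜ f) g hF ?_ ?_ rfl
  · refine (Y.pulledIdeal_comap_prodFst X.ideal V.1).ge ?_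
    exact Ideal.mem_map_of_mem (Algebra.TensorProduct.includeRight :
      Γ(Y.scheme, V.1.1) →ₐ[k] B ⊗[k] Γ(Y.scheme, V.1.1)) f.2
  · rw [map_add, h.reduce_tmul, FlatLift.reduce_tmul, map_one, one_smul, add_zero]

end

theorem propositionB15 {k : Type u} [Field k] [IsAlgClosed k] [CharZero k]
    (Y : NonsingularVariety k) (P : PoissonStructure Y) (X : PoissonSubscheme P)
    (hX : X.IsRegularEmbedding) :
    -- (1) first order deformations
    (∃ Φ : InfDeformation X (DualNumber k) (TrivSqZeroExt.fstHom k k k) ≃ X.H0,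
      ∀ (η : InfDeformation X (DualNumber k) (TrivSqZeroExt.fstHom k k k))
        (V : X.AffineIn ⊤) (f : X.ideal.ideal V.1) (g : Γ(Y.scheme, V.1.1)),
        (1 : DualNumber k) ⊗ₜ[k] (f : Γ(Y.scheme, V.1.1)) + DualNumber.eps ⊗ₜ[k] g ∈
            Y.pulledIdeal η.ideal V.1 →
          (Φ η).1 V f ![] = Ideal.Quotient.mk _ g) ∧
    -- (2) obstructions
    (∀ (A B : Type u) [CommRing A] [Algebra k A] [IsLocalRing A] [IsArtinianRing A]
        [CommRing B] [Algebra k B] [IsLocalRing B] [IsArtinianRing B]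
        (ε : A →ₐ[k] k) (φ : B →ₐ[k] A) (t : B), IsSmallExtension φ t →
      ∀ η : InfDeformation X A ε,
        ∃ o : X.H1,
          (Nonempty (LocalLiftings η φ) ∧
            ∀ D : LocalLiftings η φ, 
              (∃! z : PoissonSubscheme.Z1 D.cover, D.Represents t z) ∧
              ∀ z : PoissonSubscheme.Z1 D.cover, D.Represents t z →
                PoissonSubscheme.classH1 D.cover z = o) ∧
          (o = 0 ↔ ∃ η' : InfDeformation X B (ε.comp φ), η'.IsLifting φ η)) := by
  refine ⟨exists_equiv_H0 X FlatLift.isSmall_dualNumber (AlgHom.id_comp _),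
    fun A B _ _ _ _ _ _ _ _ ε φ t hφ η => ?_⟩
  have h := hφ.isSmall ε
  have hne := nonempty_localLiftings hX hφ.surjective η
  let D₀ := hne.some
  refine ⟨PoissonSubscheme.classH1 D₀.cover (FlatLifting.cocycle h D₀.cover D₀.lifting),
    ⟨hne, fun D => ⟨?_, ?_⟩⟩,
    FlatLifting.classH1_cocycle_eq_zero_iff h D₀.cover D₀.lifting⟩
  · simp only [D.represents_iff h]
    exact existsUnique_eq
  · intro z hz
    rw [(D.represents_iff h z).mp hz]
    exact FlatLifting.classH1_cocycle_eq h _ _ _ _
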